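/- Let $\ell>0$ and let $q\in W^{-1,2}(0,\ell)$ be a complex distribution, written $q=\sigma'$ with $\sigma\in L^2(0,\ell)$, so that $(q|\psi)=-\int_0^\ell\sigma\psi'$ for $\psi\in W^{1,2}_0(0,\ell)$. For $y\in W^{1,2}(0,\ell)$ let $\mathbf S_qy=-y''+qy$ be the distribution $(\mathbf S_qy|\phi)=\int_0^\ell y'\phi'+(q|y\phi)$, $\phi\in W^{1,2}_0(0,\ell)$. Assume that $q$ is admissible: there is $f\in W^{1,2}(0,\ell)$ with $\mathbf S_qf=0$, $f(x)\ne0$ for all $x\in[0,\ell]$, and $f(0)=1$. Put $\mathbf D_fy=y'-\frac{f'}{f}y$. For $\rho\in\mathbb C$ let $C_f(\rho,\cdot)$ and $S_f(\rho,\cdot)$ be the solutions in $W^{1,2}(0,\ell)$ of $\mathbf S_qy=\rho^2y$ with $C_f(\rho,0)=1$, $\mathbf D_fC_f(\rho,0)=0$, and $S_f(\rho,0)=0$, $\mathbf D_fS_f(\rho,0)=1$ (for such solutions $\mathbf D_fy\in W^{1,2}(0,\ell)$, so that the value at $0$ makes sense). Let $K_f$ be the transmutation kernel, i.e. the function in $L^2(\{0\le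 x\le\ell,\ |t|\le x\})$, with $K_f(x,\cdot)\in L^2(-x,x)$ for every $x\in(0,\ell]$, such that for every $\rho\in\mathbb C$ $$e_f(\rho,x)=e^{i\rho x}+\int_{-x}^xK_f(x,t)e^{i\rho t}\,dt$$ is the solution of $\mathbf S_qy=\rho^2y$ with $y(0)=1$, $\mathbf D_fy(0)=i\rho$. Let $P_m$ be the Legendre polynomials, $a_m(x)=(m+\tfrac12)\int_{-x}^xK_f(x,t)P_m(t/x)\,dt$, $\alpha_m=2a_m$, $K_{f,N}(x,t)=\sum_{m=0}^N\frac{a_m(x)}xP_m(t/x)$ and $\epsilon_N(x)=\|K_f(x,\cdot)-K_{f,N}(x,\cdot)\|_{L^2(-x,x)}$, and let $j_m(\zeta)=\sqrt{\frac{\pi}{2\zeta}}\,J_{m+\frac12}(\zeta)$ be the spherical Bessel functions (entire functions of $\zeta$). **Theorem.** The solutions $C_f(\rho,\cdot)$, $S_f(\rho,\cdot)$ and the kernel $K_f$ exist. For every $x\in(0,\ell]$, $\epsilon_N(x)\to0$ as $N\to\infty$ (so $K_f(x,t)=\sum_{m\ge0}\frac{a_m(x)}xP_m(t/x)$ in $L^2(-x,x)$),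 and $$C_f(\rho,x)=\cos(\rho x)+\sum_{m=0}^\infty(-1)^m\alpha_{2m}(x)j_{2m}(\rho x)\qquad(\rho\in\mathbb C),$$ $$S_f(\rho,x)=\frac{\sin(\rho x)}\rho+\frac1\rho\sum_{m=0}^\infty(-1)^m\alpha_{2m+1}(x)j_{2m+1}(\rho x)\qquad(\rho\in\mathbb C\setminus\{0\}),$$ where the series converge, and, in the limit $\rho\to0$ of the right-hand side, $S_f(0,x)=x+\frac x3\alpha_1(x)$. For $N\in\mathbb N$, $N\ge1$, the partial sums $$C_{f,N}(\rho,x)=\cos(\rho x)+\sum_{m=0}^{[N/2]}(-1)^m\alpha_{2m}(x)j_{2m}(\rho x),\qquad S_{f,N}(\rho,x)=\frac{\sin(\rho x)}\rho+\frac1\rho\sum_{m=0}^{[(N-1)/2]}(-1)^m\alpha_{2m+1}(x)j_{2m+1}(\rho x)$$ satisfy, for every $C>0$ and every $\rho\in\mathbb C$ with $|\operatorname{Im}\rho|\le C$, $$|C_f(\rho,x)-C_{f,N}(\rho,x)|\le\epsilon_N(x)\sqrt{\frac{\sinh(2Cx)}C},\qquad|\rho S_f(\rho,x)-\rho S_{f,N}(\rho,x)|\le\epsilon_N(x)\sqrt{\frac{\sinh(2Cx)}C},$$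 (at $\rho=0$ the product $\rho S_{f,N}(\rho,x)$ is read as $0$); moreover, if $|K_f(x,t)-K_{f,N}(x,t)|\le M$ for almost every $t\in(-x,x)$, then both left-hand sides are at most $M\,\frac{2\sinh(Cx)}C$. Consequently, for each $x\in(0,\ell]$ and each $C>0$, as $N\to\infty$, $C_{f,N}(\rho,x)\to C_f(\rho,x)$ uniformly in $|\operatorname{Im}\rho|\le C$ and $S_{f,N}(\rho,x)\to S_f(\rho,x)$ uniformly in $|\operatorname{Im}\rho|\le C$, $\rho\ne0$. -/

import Mathlib

namespace NSBF

noncomputable section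

open MeasureTheory

/-! ### Sobolev functions on an interval and the distributional Schroedinger operator -/

/-- `u` (restricted to `[0, ℓ]`) belongs to `W^{1,2}(0,ℓ)`: it is the absolutely continuous
representative of its class, and its derivative is square integrable. -/
def MemW12 (ℓ : ℝ) (u : ℝ → ℂ) : Prop :=
  AbsolutelyContinuousOnInterval u 0 ℓ ∧ MemLp (deriv u) 2 (volume.restrict (Set.Ioo 0 ℓ))

/-- `φ ∈ W₀^{1,2}(0,ℓ)`. -/
def MemW12Zero (ℓ : ℝ) (φ : ℝ → ℂ) : Prop :=
  MemW12 ℓ φ ∧ φ 0 = 0 ∧ φ ℓ = 0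

/-- The action `(q | ψ) = - ∫ σ ψ'` of the distribution `q = σ' ∈ W^{-1,2}(0,ℓ)`,
`σ ∈ L²(0,ℓ)`, on `ψ ∈ W₀^{1,2}(0,ℓ)`. -/
def potentialPairing (ℓ : ℝ) (σ ψ : ℝ → ℂ) : ℂ :=
  -∫ x in (0 : ℝ)..ℓ, σ x * deriv ψ x

/-- The action `(S_q y | φ) = ∫ y' φ' + (q | y φ)` of the distribution `S_q y = -y'' + q y`,
where `q = σ'`. -/
def schrodingerPairing (ℓ : ℝ) (σ y φ : ℝ → ℂ) : ℂ :=
  (∫ x in (0 : ℝ)..ℓ, deriv y x * deriv φ x) + potentialPairing ℓ σ (fun x => y x * φ x)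

/-- `y ∈ W^{1,2}(0,ℓ)` and `S_q y = lam y` as distributions, where `q = σ'`. -/
def IsWeakSolution (ℓ : ℝ) (σ : ℝ → ℂ) (lam : ℂ) (y : ℝ → ℂ) : Prop :=
  MemW12 ℓ y ∧ ∀ φ : ℝ → ℂ, MemW12Zero ℓ φ →
    schrodingerPairing ℓ σ y φ = lam * ∫ x in (0 : ℝ)..ℓ, y x * φ x

/-- `f` is a nonvanishing solution of `S_q f = 0` on `[0,ℓ]`, normalized by `f(0) = 1`. -/
structure IsNonvanishingSolution (ℓ : ℝ) (σ f : ℝ → ℂ) : Prop where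
  isSolution : IsWeakSolution ℓ σ 0 f
  ne_zero : ∀ x ∈ Set.Icc 0 ℓ, f x ≠ 0
  normalized : f 0 = 1

/-- The operator `D_f y = y' - (f'/f) y`. -/
def darbouxD (f y : ℝ → ℂ) (x : ℝ) : ℂ :=
  deriv y x - deriv f x / f x * y x

/-- `y` solves the Cauchy problem `S_q y = lam y`, `y(0) = c₀`, `(D_f y)(0) = c₁`. The value of
`D_f y` at `0` is that of the continuous representative of `D_f y ∈ W^{1,2}(0,ℓ)`. -/
structure IsCauchySolution (ℓ : ℝ) (σ f : ℝ → ℂ) (lam c₀ c₁ : ℂ) (y : ℝ → ℂ) : Prop where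
  isSolution : IsWeakSolution ℓ σ lam y
  init_value : y 0 = c₀
  init_deriv : ∃ v : ℝ → ℂ, MemW12 ℓ v ∧
    (∀ᵐ x ∂(volume.restrict (Set.Ioo 0 ℓ)), v x = darbouxD f y x) ∧ v 0 = c₁

/-! ### The transmutation kernel -/

/-- The triangle `0 ≤ x ≤ ℓ`, `|t| ≤ x`. -/
def triangle (ℓ : ℝ) : Set (ℝ × ℝ) :=
  {p | 0 ≤ p.1 ∧ p.1 ≤ ℓ ∧ |p.2| ≤ p.1}

/-- `K` is the transmutation kernel `K_f`: it is in `L²` of the triangle, each slice `K(x,·)`,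
`0 < x ≤ ℓ`, is in `L²(-x,x)`, and for every `ρ` the function
`e_f(ρ,x) = e^{iρx} + ∫_{-x}^x K(x,t) e^{iρt} dt` is the solution of `S_q y = ρ² y` with
`y(0) = 1`, `(D_f y)(0) = iρ`. -/
structure IsTransmutationKernel (ℓ : ℝ) (σ f : ℝ → ℂ) (K : ℝ → ℝ → ℂ) : Prop where
  memLp : MemLp (Function.uncurry K) 2 (volume.restrict (triangle ℓ))
  memLp_slice : ∀ x ∈ Set.Ioc 0 ℓ, MemLp (K x) 2 (volume.restrict (Set.Ioo (-x) x))
  represents : ∀ ρ : ℂ, IsCauchySolution ℓ σ f (ρ ^ 2) 1 (Complex.I * ρ)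
    (fun x => Complex.exp (Complex.I * ρ * x) +
      ∫ t in (-x)..x, K x t * Complex.exp (Complex.I * ρ * t))

/-! ### Legendre polynomials and spherical Bessel functions -/

/-- The Legendre polynomial `P_m` (Rodrigues' formula). -/
def legendreP (m : ℕ) : Polynomial ℝ :=
  Polynomial.C ((2 ^ m * (m.factorial : ℝ))⁻¹) *
    (Polynomial.derivative^[m]) ((Polynomial.X ^ 2 - 1) ^ m)

/-- The Bessel function `J_ν(z)` of the first kind (principal branch). -/
def besselJ (ν z : ℂ) : ℂ :=
  ∑' k : ℕ, (-1) ^ k / ((k.factorial : ℂ) * Complex.Gamma (k + ν + 1)) *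
    (z / 2) ^ (2 * (k : ℂ) + ν)

/-- The spherical Bessel function `j_m`, as an entire function: the power series obtained from
`√(π/(2z)) J_{m+1/2}(z)` by cancelling the half-integer powers of `z`. -/
def sphericalBesselJ (m : ℕ) (z : ℂ) : ℂ :=
  (Real.sqrt Real.pi / 2 : ℝ) * ∑' k : ℕ,
    (-1) ^ k / ((k.factorial : ℂ) * Complex.Gamma (k + m + 3 / 2)) * (z / 2) ^ (2 * k + m)

/-- Off the branch cut, `j_m(z) = √(π/(2z)) J_{m+1/2}(z)`. -/
theorem sphericalBesselJ_eq (m : ℕ) (z : ℂ) (hz : z ∈ Complex.slitPlane) :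
    sphericalBesselJ m z =
      ((Real.pi : ℂ) / (2 * z)) ^ (1 / 2 : ℂ) * besselJ (m + 1 / 2) z := by
  have hz0 : z ≠ 0 := Complex.slitPlane_ne_zero hz
  obtain ⟨w, rfl⟩ : ∃ w, z = 2 * w := ⟨z / 2, by ring⟩
  have hw0 : w ≠ 0 := by rintro rfl; simp at hz0
  have harg : w.arg ≠ Real.pi := by
    have h := Complex.mem_slitPlane_iff_arg.1 hz
    have h2 := Complex.arg_real_mul w (r := 2) (by norm_num)
    push_cast at h2
    rw [h2] at h
    exact h.1
  have e1 : ((Real.pi : ℂ) / (2 * (2 * w))) ^ (1 / 2 : ℂ) * w ^ (1 / 2 : ℂ)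
      = (Real.sqrt Real.pi / 2 : ℝ) := by
    have hq : (0 : ℝ) < Real.pi / 4 := by positivity
    have h1 : (Real.pi : ℂ) / (2 * (2 * w)) = ((Real.pi / 4 : ℝ) : ℂ) * w⁻¹ := by
      push_cast; field_simp; norm_num
    have h3 : Real.sqrt Real.pi / 2 = (Real.pi / 4) ^ (1 / 2 : ℝ) := by
      rw [← Real.sqrt_eq_rpow, Real.sqrt_div Real.pi_pos.le,
        show (4 : ℝ) = 2 ^ 2 by norm_num, Real.sqrt_sq (by norm_num)]
    rw [h1, Complex.cpow_def_of_ne_zero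
        (mul_ne_zero (by exact_mod_cast hq.ne') (inv_ne_zero hw0)),
      Complex.cpow_def_of_ne_zero hw0, ← Complex.exp_add, Complex.log_ofReal_mul hq
        (inv_ne_zero hw0), Complex.log_inv _ harg, h3, Real.rpow_def_of_pos hq]
    push_cast
    congr 1
    ring
  unfold sphericalBesselJ besselJ
  rw [← e1, mul_assoc, ← tsum_mul_left]
  congr 2
  ext k
  have h4 : (2 * (k : ℂ) + (m + 1 / 2)) = ((2 * k + m : ℕ) : ℂ) + 1 / 2 := by push_cast; ring
  have h5 : (k : ℂ) + (m + 1 / 2) + 1 = k + m + 3 / 2 := by ring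
  rw [h4, h5, mul_div_cancel_left₀ w two_ne_zero, Complex.cpow_add _ _ hw0,
    Complex.cpow_natCast]
  ring

/-- `a_m(x) = (m + 1/2) ∫_{-x}^x K(x,t) P_m(t/x) dt`, the Fourier-Legendre coefficients of
`K(x,·)`: `K(x,t) = ∑ (a_m(x)/x) P_m(t/x)`. -/
def legendreCoeff (K : ℝ → ℝ → ℂ) (m : ℕ) (x : ℝ) : ℂ :=
  ((m : ℂ) + 1 / 2) * ∫ t in (-x)..x, K x t * ((legendreP m).eval (t / x) : ℝ)

/-- `α_m = 2 a_m`. -/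
def alphaCoeff (K : ℝ → ℝ → ℂ) (m : ℕ) (x : ℝ) : ℂ :=
  2 * legendreCoeff K m x

/-- The partial sum `K_N(x,t)`, up to degree `N`, of the Fourier-Legendre series. -/
def kernelPartial (K : ℝ → ℝ → ℂ) (N : ℕ) (x t : ℝ) : ℂ :=
  ∑ m ∈ Finset.range (N + 1), legendreCoeff K m x / x * ((legendreP m).eval (t / x) : ℝ)

/-- `ε_N(x) = ‖K(x,·) - K_N(x,·)‖_{L²(-x,x)}`. -/
def kernelError (K : ℝ → ℝ → ℂ) (N : ℕ) (x : ℝ) : ℝ :=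
  Real.sqrt (∫ t in (-x)..x, ‖K x t - kernelPartial K N x t‖ ^ 2)

/-- `C_{f,N}(ρ,x)`. -/
def cosPartial (K : ℝ → ℝ → ℂ) (N : ℕ) (ρ : ℂ) (x : ℝ) : ℂ :=
  Complex.cos (ρ * x) + ∑ m ∈ Finset.range (N / 2 + 1),
    (-1) ^ m * alphaCoeff K (2 * m) x * sphericalBesselJ (2 * m) (ρ * x)

/-- `S_{f,N}(ρ,x)`, for `ρ ≠ 0` and `N ≥ 1`. -/
def sinPartial (K : ℝ → ℝ → ℂ) (N : ℕ) (ρ : ℂ) (x : ℝ) : ℂ :=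
  Complex.sin (ρ * x) / ρ + 1 / ρ * ∑ m ∈ Finset.range ((N - 1) / 2 + 1),
    (-1) ^ m * alphaCoeff K (2 * m + 1) x * sphericalBesselJ (2 * m + 1) (ρ * x)

end

end NSBF

/-!
Let `p = f'/f`. If `y₁' = iρ y₁ + p y₂` and `y₂' = -iρ y₂ + p y₁`, then `y = (y₁ + y₂)/2` solves
`S_q y = ρ² y`, with `D_f y = iρ (y₁ - y₂)/2`. For `y₁ = u(ρ, ·)` and `y₂ = u(-ρ, ·)` this system is
the single integral equation `u(ρ, x) = e^{iρx} + ∫₀ˣ e^{iρ(x - s)} p(s) u(-ρ, s) ds`. Writing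
`u(ρ, x) = e^{iρx} + ∫ G(x, t) e^{iρt} dt` turns it into a Volterra equation for `G` that does not
involve `ρ`, and `K_f` is a combination of `G` for the coefficients `p` and `-p`.

The even and odd parts in `ρ` of `e_f` give `C_f = cos ρx + ∫ K_f cos ρt dt` and
`ρ S_f = sin ρx + ∫ K_f sin ρt dt`. Up to a constant the Fourier transform of `P_m` is `j_m`, so the
Fourier-Legendre expansion of `K_f(x, ·)` becomes the two series, and the error of a partial sum is
the integral of `K_f - K_{f,N}` against `cos ρt` or `sin ρt`. In the strip `|Im ρ| ≤ C` these are
bounded by `cosh Ct`, and `(sin ρt)/ρ` is bounded up to `ρ = 0`.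
-/

namespace NSBF

open MeasureTheory Set Filter Topology
open scoped ENNReal NNReal Polynomial

/-! ### Functions on a bounded interval -/

section Interval

variable {E : Type*} [NormedAddCommGroup E] {a b : ℝ}

theorem absolutelyContinuousOnInterval_of_dist_le {X Y : Type*} [PseudoMetricSpace X]
    [PseudoMetricSpace Y] {F : ℝ → X} {u : ℝ → Y} {C : ℝ}
    (hF : AbsolutelyContinuousOnInterval F a b)
    (h : ∀ x ∈ uIcc a b, ∀ y ∈ uIcc a b, dist (u x) (u y) ≤ C * dist (F x) (F y)) :
    AbsolutelyContinuousOnInterval u a b := by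
  have h_lim := Tendsto.const_mul C hF
  rw [mul_zero] at h_lim
  refine squeeze_zero' (.of_forall fun E => Finset.sum_nonneg fun _ _ => dist_nonneg) ?_ h_lim
  filter_upwards [mem_inf_of_right (mem_principal_self _)] with E hE
  rw [Finset.mul_sum]
  exact Finset.sum_le_sum fun i hi => h _ (hE.1 i hi).1 _ (hE.1 i hi).2

theorem absolutelyContinuousOnInterval_intervalIntegral [NormedSpace ℝ E] {g : ℝ → E}
    (hg : IntervalIntegrable g volume a b) :
    AbsolutelyContinuousOnInterval (fun x => ∫ t in a..x, g t) a b := by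
  have hsub : ∀ x ∈ uIcc a b, IntervalIntegrable g volume a x := fun x hx =>
    hg.mono_set (uIcc_subset_uIcc_left hx)
  refine absolutelyContinuousOnInterval_of_dist_le (C := 1)
    (hg.norm.absolutelyContinuousOnInterval_intervalIntegral (c := a) left_mem_uIcc)
    fun x hx y hy => ?_
  rw [one_mul, dist_eq_norm, Real.dist_eq,
    intervalIntegral.integral_interval_sub_left (hsub x hx) (hsub y hy),
    intervalIntegral.integral_interval_sub_left (hsub x hx).norm (hsub y hy).norm]
  exact intervalIntegral.norm_integral_le_abs_integral_norm

theorem ae_restrict_Ioo_of_ae_uIcc {P : ℝ → Prop} (h : ∀ᵐ x, x ∈ uIcc a b → P x) :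
    ∀ᵐ x ∂(volume.restrict (Ioo a b)), P x := by
  rw [ae_restrict_iff' measurableSet_Ioo]
  filter_upwards [h] with x hx hx'
  exact hx (Icc_subset_uIcc (Ioo_subset_Icc_self hx'))

theorem ae_restrict_Ioo_of_forall_Icc {P : ℝ → Prop} (h : ∀ x ∈ Icc a b, P x) :
    ∀ᵐ x ∂(volume.restrict (Ioo a b)), P x :=
  ae_restrict_of_forall_mem measurableSet_Ioo fun x hx => h x (Ioo_subset_Icc_self hx)

theorem intervalIntegral_eq_setIntegral_Ioo [NormedSpace ℝ E] (hab : a ≤ b) (g : ℝ → E) :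
    ∫ x in a..b, g x = ∫ x in Ioo a b, g x := by
  rw [intervalIntegral.integral_of_le hab, integral_Ioc_eq_integral_Ioo]

theorem intervalIntegral_congr_ae_Ioo [NormedSpace ℝ E] (hab : a ≤ b) {g h : ℝ → E}
    (hgh : g =ᵐ[volume.restrict (Ioo a b)] h) : ∫ x in a..b, g x = ∫ x in a..b, h x := by
  rw [intervalIntegral_eq_setIntegral_Ioo hab, intervalIntegral_eq_setIntegral_Ioo hab]
  exact integral_congr_ae hgh

theorem intervalIntegrable_of_memLp (hab : a ≤ b) {p : ℝ≥0∞} (hp : 1 ≤ p) {g : ℝ → E}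
    (hg : MemLp g p (volume.restrict (Ioo a b))) : IntervalIntegrable g volume a b := by
  rw [intervalIntegrable_iff_integrableOn_Ioo_of_le hab]
  exact hg.integrable hp

theorem intervalIntegrable_mul_of_memLp_two (hab : a ≤ b) {g h : ℝ → ℂ}
    (hg : MemLp g 2 (volume.restrict (Ioo a b))) (hh : MemLp h 2 (volume.restrict (Ioo a b))) :
    IntervalIntegrable (fun x => g x * h x) volume a b := by
  rw [intervalIntegrable_iff_integrableOn_Ioo_of_le hab]
  exact hg.integrable_mul hh

theorem memLp_of_continuousOn_Icc (p : ℝ≥0∞) {u : ℝ → E} (hu : ContinuousOn u (Icc a b)) :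
    MemLp u p (volume.restrict (Ioo a b)) := by
  obtain ⟨C, hC⟩ := isCompact_Icc.exists_bound_of_continuousOn hu
  exact .of_bound ((hu.mono Ioo_subset_Icc_self).aestronglyMeasurable measurableSet_Ioo) C
    (ae_restrict_Ioo_of_forall_Icc hC)

theorem memLp_mul_continuousOn_Icc {p : ℝ≥0∞} {g u : ℝ → ℂ}
    (hg : MemLp g p (volume.restrict (Ioo a b))) (hu : ContinuousOn u (Icc a b)) :
    MemLp (fun x => g x * u x) p (volume.restrict (Ioo a b)) :=
  (memLp_of_continuousOn_Icc ⊤ hu).mul hg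

theorem intervalIntegral_conj (g : ℝ → ℂ) :
    ∫ x in a..b, starRingEnd ℂ (g x) = starRingEnd ℂ (∫ x in a..b, g x) := by
  simp only [intervalIntegral, integral_conj, map_sub]

end Interval

/-! ### Calculus in `W^{1,2}(0, ℓ)` -/

/-- `u ∈ W^{1,2}(0,ℓ)` has weak derivative `g`. Products, reciprocals and primitives are computed
through this relation, since `deriv u` itself is only determined almost everywhere. -/
structure HasWeakDeriv (ℓ : ℝ) (u g : ℝ → ℂ) : Prop where
  memW12 : MemW12 ℓ u
  deriv_ae_eq : deriv u =ᵐ[volume.restrict (Ioo 0 ℓ)] g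

section WeakDeriv

variable {ℓ : ℝ} {u v w g h : ℝ → ℂ} {c : ℂ}

theorem MemW12.hasWeakDeriv (hu : MemW12 ℓ u) : HasWeakDeriv ℓ u (deriv u) :=
  ⟨hu, .rfl⟩

theorem MemW12.continuousOn (hℓ : 0 ≤ ℓ) (hu : MemW12 ℓ u) : ContinuousOn u (Icc 0 ℓ) := by
  simpa only [uIcc_of_le hℓ] using hu.1.continuousOn

theorem MemW12.ae_differentiableAt (hu : MemW12 ℓ u) :
    ∀ᵐ x ∂(volume.restrict (Ioo 0 ℓ)), DifferentiableAt ℝ u x :=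
  ae_restrict_Ioo_of_ae_uIcc hu.1.boundedVariationOn.ae_differentiableAt_of_mem_uIcc

theorem MemW12.eqOn_of_ae_eq (hℓ : 0 < ℓ) (hu : MemW12 ℓ u) (hw : MemW12 ℓ w)
    (h : u =ᵐ[volume.restrict (Ioo 0 ℓ)] w) : EqOn u w (Icc 0 ℓ) :=
  Measure.eqOn_Icc_of_ae_eq volume hℓ.ne (by rwa [← restrict_Ioo_eq_restrict_Icc])
    (hu.continuousOn hℓ.le) (hw.continuousOn hℓ.le)

namespace HasWeakDeriv

theorem continuousOn (hℓ : 0 ≤ ℓ) (hu : HasWeakDeriv ℓ u g) : ContinuousOn u (Icc 0 ℓ) :=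
  hu.memW12.continuousOn hℓ

theorem memLp (hu : HasWeakDeriv ℓ u g) : MemLp g 2 (volume.restrict (Ioo 0 ℓ)) :=
  hu.memW12.2.ae_eq hu.deriv_ae_eq

theorem congr_deriv (hu : HasWeakDeriv ℓ u g) (hgh : g =ᵐ[volume.restrict (Ioo 0 ℓ)] h) :
    HasWeakDeriv ℓ u h :=
  ⟨hu.memW12, hu.deriv_ae_eq.trans hgh⟩

theorem ae_hasDerivAt (hu : HasWeakDeriv ℓ u g) :
    ∀ᵐ x ∂(volume.restrict (Ioo 0 ℓ)), HasDerivAt u (g x) x := by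
  filter_upwards [hu.memW12.ae_differentiableAt, hu.deriv_ae_eq] with x hx hg
  exact hg ▸ hx.hasDerivAt

theorem of_ae_hasDerivAt (hu : AbsolutelyContinuousOnInterval u 0 ℓ)
    (hg : MemLp g 2 (volume.restrict (Ioo 0 ℓ)))
    (h : ∀ᵐ x ∂(volume.restrict (Ioo 0 ℓ)), HasDerivAt u (g x) x) : HasWeakDeriv ℓ u g :=
  have hderiv : deriv u =ᵐ[volume.restrict (Ioo 0 ℓ)] g := h.mono fun _ hx => hx.deriv
  ⟨⟨hu, hg.ae_eq hderiv.symm⟩, hderiv⟩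

theorem eq_integral (hℓ : 0 ≤ ℓ) (hu : HasWeakDeriv ℓ u g) {x : ℝ} (hx : x ∈ Icc 0 ℓ) :
    u x = u 0 + ∫ t in (0 : ℝ)..x, g t := by
  have hgi := intervalIntegrable_of_memLp hℓ one_le_two hu.memLp
  have hac := hu.memW12.1.sub (absolutelyContinuousOnInterval_intervalIntegral hgi)
  have hu' : ∀ᵐ x, x ∈ uIcc 0 ℓ → HasDerivAt u (g x) x := by
    rw [uIcc_of_le hℓ, ← ae_restrict_iff' measurableSet_Icc, ← restrict_Ioo_eq_restrict_Icc]
    exact hu.ae_hasDerivAt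
  obtain ⟨C, hC⟩ := hac.const_of_ae_hasDerivAt_zero (by
    filter_upwards [hu', hgi.ae_hasDerivAt_integral] with x hux hgx hx
    simpa using (hux hx).sub (hgx hx 0 left_mem_uIcc))
  have hC0 := hC 0 left_mem_uIcc
  have hCx := hC x (by rwa [uIcc_of_le hℓ])
  simp only [Pi.sub_apply, intervalIntegral.integral_same, sub_zero] at hC0 hCx
  rw [hC0, ← hCx, sub_add_cancel]

theorem of_eq_integral (hℓ : 0 ≤ ℓ) (hg : MemLp g 2 (volume.restrict (Ioo 0 ℓ)))
    (h : ∀ x ∈ Icc 0 ℓ, u x = c + ∫ t in (0 : ℝ)..x, g t) : HasWeakDeriv ℓ u g := by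
  have hgi := intervalIntegrable_of_memLp hℓ one_le_two hg
  refine of_ae_hasDerivAt (absolutelyContinuousOnInterval_of_dist_le (C := 1)
    (absolutelyContinuousOnInterval_intervalIntegral hgi) fun x hx y hy => ?_) hg ?_
  · rw [uIcc_of_le hℓ] at hx hy
    rw [h x hx, h y hy, dist_add_left, one_mul]
  · filter_upwards [ae_restrict_Ioo_of_ae_uIcc hgi.ae_hasDerivAt_integral,
      ae_restrict_mem measurableSet_Ioo] with x hx hx'
    refine ((hx 0 left_mem_uIcc).const_add c).congr_of_eventuallyEq ?_
    filter_upwards [isOpen_Ioo.mem_nhds hx'] with y hy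
    exact h y (Ioo_subset_Icc_self hy)

theorem congr (hℓ : 0 ≤ ℓ) (hu : HasWeakDeriv ℓ u g) (h : EqOn w u (Icc 0 ℓ)) :
    HasWeakDeriv ℓ w g :=
  of_eq_integral hℓ hu.memLp fun _ hx => (h hx).trans (hu.eq_integral hℓ hx)

theorem of_hasDerivAt (hℓ : 0 ≤ ℓ) (hg : Continuous g) (h : ∀ x, HasDerivAt u (g x) x) :
    HasWeakDeriv ℓ u g :=
  of_eq_integral (c := u 0) hℓ (memLp_of_continuousOn_Icc 2 hg.continuousOn) fun x _ => by
    rw [intervalIntegral.integral_eq_sub_of_hasDerivAt (fun t _ => h t)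
      (hg.intervalIntegrable _ _), add_sub_cancel]

theorem integral (hℓ : 0 ≤ ℓ) (hg : MemLp g 2 (volume.restrict (Ioo 0 ℓ))) :
    HasWeakDeriv ℓ (fun x => ∫ t in (0 : ℝ)..x, g t) g :=
  of_eq_integral (c := 0) hℓ hg fun _ _ => (zero_add _).symm

theorem linearComb (hu : HasWeakDeriv ℓ u g) (hw : HasWeakDeriv ℓ w h) (α β : ℂ) :
    HasWeakDeriv ℓ (fun x => α * u x + β * w x) (fun x => α * g x + β * h x) := by
  refine of_ae_hasDerivAt ((hu.memW12.1.const_smul α).add (hw.memW12.1.const_smul β))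
    ((hu.memLp.const_mul α).add (hw.memLp.const_mul β)) ?_
  filter_upwards [hu.ae_hasDerivAt, hw.ae_hasDerivAt] with x hux hwx
  exact (hux.const_mul α).add (hwx.const_mul β)

theorem mul (hℓ : 0 ≤ ℓ) (hu : HasWeakDeriv ℓ u g) (hw : HasWeakDeriv ℓ w h) :
    HasWeakDeriv ℓ (fun x => u x * w x) (fun x => g x * w x + h x * u x) := by
  refine of_ae_hasDerivAt (hu.memW12.1.smul hw.memW12.1)
    ((memLp_mul_continuousOn_Icc hu.memLp (hw.continuousOn hℓ)).add
      (memLp_mul_continuousOn_Icc hw.memLp (hu.continuousOn hℓ))) ?_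
  filter_upwards [hu.ae_hasDerivAt, hw.ae_hasDerivAt] with x hux hwx
  exact mul_comm (u x) (h x) ▸ hux.mul hwx

theorem inv (hℓ : 0 ≤ ℓ) (hu : HasWeakDeriv ℓ u g) (hne : ∀ x ∈ Icc 0 ℓ, u x ≠ 0) :
    HasWeakDeriv ℓ (fun x => (u x)⁻¹) (fun x => g x * -((u x) ^ 2)⁻¹) := by
  have hinv : ContinuousOn (fun x => (u x)⁻¹) (Icc 0 ℓ) := (hu.continuousOn hℓ).inv₀ hne
  have hinv_sq : ContinuousOn (fun x => -((u x) ^ 2)⁻¹) (Icc 0 ℓ) :=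
    (((hu.continuousOn hℓ).pow 2).inv₀ fun x hx => pow_ne_zero 2 (hne x hx)).neg
  obtain ⟨C, hC⟩ := isCompact_Icc.exists_bound_of_continuousOn hinv
  refine of_ae_hasDerivAt (absolutelyContinuousOnInterval_of_dist_le (C := C * C)
    hu.memW12.1 fun x hx y hy => ?_) (memLp_mul_continuousOn_Icc hu.memLp hinv_sq) ?_
  · rw [uIcc_of_le hℓ] at hx hy
    rw [dist_inv_inv₀ (hne x hx) (hne y hy), div_eq_inv_mul, mul_inv, ← norm_inv, ← norm_inv]
    have hC0 : 0 ≤ C := (norm_nonneg _).trans (hC x hx)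
    gcongr
    · exact hC x hx
    · exact hC y hy
  · filter_upwards [hu.ae_hasDerivAt, ae_restrict_Ioo_of_forall_Icc hne] with x hux hx
    exact (hux.fun_inv hx).congr_deriv (by rw [neg_div, div_eq_mul_inv, mul_neg])

theorem hasDerivWithinAt_Ici (hℓ : 0 ≤ ℓ) (hu : HasWeakDeriv ℓ u g)
    (hg : ContinuousOn g (Icc 0 ℓ)) {x : ℝ} (hx : x ∈ Ico 0 ℓ) :
    HasDerivWithinAt u (g x) (Ici x) x := by
  have hx' : x ∈ Icc 0 ℓ := Ico_subset_Icc_self hx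
  have hg_right : ContinuousOn g (Icc x ℓ) := hg.mono (Icc_subset_Icc_left hx.1)
  have hg_left : IntervalIntegrable g volume 0 x :=
    (hg.mono (Icc_subset_Icc_right hx.2.le)).intervalIntegrable_of_Icc hx.1
  have hcont : ContinuousWithinAt g (Ioi x) x :=
    ((hg_right x (left_mem_Icc.2 hx'.2)).mono_of_mem_nhdsWithin
      (Icc_mem_nhdsGE hx.2)).mono Ioi_subset_Ici_self
  have hmeas : StronglyMeasurableAtFilter g (𝓝[>] x) volume :=
    ⟨Icc x ℓ, Icc_mem_nhdsGT hx.2, hg_right.aestronglyMeasurable measurableSet_Icc⟩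
  refine ((intervalIntegral.integral_hasDerivWithinAt_right hg_left hmeas hcont
    (s := Ici x)).const_add (u 0)).congr_of_eventuallyEq ?_ (hu.eq_integral hℓ hx')
  filter_upwards [Icc_mem_nhdsGE hx.2] with z hz
  exact hu.eq_integral hℓ ⟨hx.1.trans hz.1, hz.2⟩

end HasWeakDeriv

theorem MemW12Zero.mul (hℓ : 0 ≤ ℓ) (hu : MemW12 ℓ u) (hw : MemW12Zero ℓ w) :
    MemW12Zero ℓ (fun x => u x * w x) :=
  ⟨(hu.hasWeakDeriv.mul hℓ hw.1.hasWeakDeriv).memW12, by simp [hw.2.1], by simp [hw.2.2]⟩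

theorem HasWeakDeriv.integral_mul_deriv (hℓ : 0 ≤ ℓ) (hu : HasWeakDeriv ℓ u g)
    (hw : MemW12Zero ℓ w) :
    ∫ x in (0 : ℝ)..ℓ, u x * deriv w x = -∫ x in (0 : ℝ)..ℓ, g x * w x := by
  have h := (hu.mul hℓ hw.1.hasWeakDeriv).eq_integral hℓ (right_mem_Icc.2 hℓ)
  rw [hw.2.1, hw.2.2, intervalIntegral.integral_add
    (intervalIntegrable_of_memLp hℓ one_le_two
      (memLp_mul_continuousOn_Icc hu.memLp (hw.1.continuousOn hℓ)))
    (intervalIntegrable_of_memLp hℓ one_le_two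
      (memLp_mul_continuousOn_Icc hw.1.2 (hu.continuousOn hℓ)))] at h
  simp only [mul_zero, zero_add, mul_comm (deriv w _)] at h
  linear_combination -h

/-! ### The lemma of du Bois-Reymond -/

theorem ae_eq_zero_of_integral_mul_conj_eq_zero {X : Type*} [MeasurableSpace X] {μ : Measure X}
    {k : X → ℂ} (hk : MemLp k 2 μ) (h : ∫ x, k x * starRingEnd ℂ (k x) ∂μ = 0) : k =ᵐ[μ] 0 := by
  have hnorm : ∫ x, ‖k x‖ ^ 2 ∂μ = 0 := by
    simp only [Complex.mul_conj, Complex.normSq_eq_norm_sq, integral_complex_ofReal] at h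
    exact_mod_cast h
  rw [integral_eq_zero_iff_of_nonneg (fun x => by positivity)
    (by simpa using hk.integrable_norm_pow two_ne_zero)] at hnorm
  filter_upwards [hnorm] with x hx
  simpa using hx

theorem ae_eq_const_of_integral_mul_deriv_eq_zero (hℓ : 0 < ℓ)
    (hh : MemLp h 2 (volume.restrict (Ioo 0 ℓ)))
    (H : ∀ ψ, MemW12Zero ℓ ψ → ∫ x in (0 : ℝ)..ℓ, h x * deriv ψ x = 0) :
    ∃ c : ℂ, h =ᵐ[volume.restrict (Ioo 0 ℓ)] fun _ => c := by
  let c : ℂ := (∫ x in (0 : ℝ)..ℓ, h x) / ℓ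
  let k : ℝ → ℂ := fun x => h x - c
  have hk : MemLp k 2 (volume.restrict (Ioo 0 ℓ)) := hh.sub (memLp_const c)
  have hk_conj : MemLp (fun x => starRingEnd ℂ (k x)) 2 (volume.restrict (Ioo 0 ℓ)) := hk.star
  have hk_mean : ∫ x in (0 : ℝ)..ℓ, starRingEnd ℂ (k x) = 0 := by
    have hℓ' : (ℓ : ℂ) ≠ 0 := by exact_mod_cast hℓ.ne'
    rw [intervalIntegral_conj, intervalIntegral.integral_sub
      (intervalIntegrable_of_memLp hℓ.le one_le_two hh) intervalIntegrable_const,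
      intervalIntegral.integral_const, sub_zero, Complex.real_smul, mul_div_cancel₀ _ hℓ',
      sub_self, map_zero]
  -- The primitive of `conj k` vanishes at both ends, so it is a test function.
  have hψ := HasWeakDeriv.integral hℓ.le hk_conj
  have hψh := H _ ⟨hψ.memW12, intervalIntegral.integral_same, hk_mean⟩
  rw [intervalIntegral_congr_ae_Ioo hℓ.le (h := fun x => h x * starRingEnd ℂ (k x))
    (hψ.deriv_ae_eq.mono fun x hx => congrArg (h x * ·) hx)] at hψh
  have hkk : ∫ x in (0 : ℝ)..ℓ, k x * starRingEnd ℂ (k x) = 0 := by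
    simp only [k, sub_mul] at hψh hk_mean ⊢
    rw [intervalIntegral.integral_sub (intervalIntegrable_mul_of_memLp_two hℓ.le hh hk_conj)
      ((intervalIntegrable_of_memLp hℓ.le one_le_two hk_conj).const_mul c),
      intervalIntegral.integral_const_mul, hk_mean, mul_zero, sub_zero]
    exact hψh
  rw [intervalIntegral_eq_setIntegral_Ioo hℓ.le] at hkk
  refine ⟨c, ?_⟩
  filter_upwards [ae_eq_zero_of_integral_mul_conj_eq_zero hk hkk] with x hx
  exact sub_eq_zero.1 hx

theorem exists_hasWeakDeriv_ae_eq (hℓ : 0 < ℓ) (hh : MemLp h 2 (volume.restrict (Ioo 0 ℓ)))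
    (hg : MemLp g 2 (volume.restrict (Ioo 0 ℓ)))
    (H : ∀ ψ, MemW12Zero ℓ ψ →
      ∫ x in (0 : ℝ)..ℓ, h x * deriv ψ x = -∫ x in (0 : ℝ)..ℓ, g x * ψ x) :
    ∃ V, HasWeakDeriv ℓ V g ∧ V =ᵐ[volume.restrict (Ioo 0 ℓ)] h := by
  let G : ℝ → ℂ := fun x => ∫ t in (0 : ℝ)..x, g t
  have hG : HasWeakDeriv ℓ G g := .integral hℓ.le hg
  have hGL : MemLp G 2 (volume.restrict (Ioo 0 ℓ)) :=
    memLp_of_continuousOn_Icc 2 (hG.continuousOn hℓ.le)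
  obtain ⟨c, hc⟩ := ae_eq_const_of_integral_mul_deriv_eq_zero hℓ (hh.sub hGL) fun ψ hψ => by
    simp only [Pi.sub_apply, sub_mul]
    rw [intervalIntegral.integral_sub (intervalIntegrable_mul_of_memLp_two hℓ.le hh hψ.1.2)
      (intervalIntegrable_mul_of_memLp_two hℓ.le hGL hψ.1.2), H ψ hψ,
      hG.integral_mul_deriv hℓ.le hψ, sub_self]
  refine ⟨fun x => c + G x, .of_eq_integral hℓ.le hg fun _ _ => rfl, ?_⟩
  filter_upwards [hc] with x hx
  rw [← hx, Pi.sub_apply, sub_add_cancel]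

end WeakDeriv

/-! ### The Schrödinger equation as a first order system -/

section Schrodinger

variable {ℓ : ℝ} {σ f y w φ ψ : ℝ → ℂ} {lam c₀ c₁ d₀ d₁ : ℂ}

theorem schrodingerPairing_congr (hℓ : 0 ≤ ℓ) (h : EqOn φ ψ (Icc 0 ℓ)) :
    schrodingerPairing ℓ σ y φ = schrodingerPairing ℓ σ y ψ := by
  have h_deriv : ∀ k : ℝ → ℂ, deriv (fun x => k x * φ x) =ᵐ[volume.restrict (Ioo 0 ℓ)]
      deriv fun x => k x * ψ x := fun k => by
    filter_upwards [ae_restrict_mem measurableSet_Ioo] with x hx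
    refine EventuallyEq.deriv_eq ?_
    filter_upwards [isOpen_Ioo.mem_nhds hx] with z hz
    rw [h (Ioo_subset_Icc_self hz)]
  have h_one := h_deriv 1
  simp only [Pi.one_apply, one_mul] at h_one
  unfold schrodingerPairing potentialPairing
  rw [intervalIntegral_congr_ae_Ioo hℓ (h_one.mono fun x hx => congrArg (deriv y x * ·) hx),
    intervalIntegral_congr_ae_Ioo hℓ ((h_deriv y).mono fun x hx => congrArg (σ x * ·) hx)]

theorem schrodingerPairing_sub_schrodingerPairing (hℓ : 0 ≤ ℓ) (hf : MemW12 ℓ f)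
    (hy : MemW12 ℓ y) (hw : MemW12 ℓ w) :
    schrodingerPairing ℓ σ y (fun x => f x * w x) -
        schrodingerPairing ℓ σ f (fun x => y x * w x) =
      ∫ x in (0 : ℝ)..ℓ, (f x * deriv y x - deriv f x * y x) * deriv w x := by
  have hfw := hf.hasWeakDeriv.mul hℓ hw.hasWeakDeriv
  have hyw := hy.hasWeakDeriv.mul hℓ hw.hasWeakDeriv
  simp only [schrodingerPairing, mul_left_comm (y _) (f _)]
  rw [add_sub_add_right_eq_sub, ← intervalIntegral.integral_sub
    (intervalIntegrable_mul_of_memLp_two hℓ hy.2 hfw.memW12.2)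
    (intervalIntegrable_mul_of_memLp_two hℓ hf.2 hyw.memW12.2)]
  refine intervalIntegral_congr_ae_Ioo hℓ ?_
  filter_upwards [hfw.deriv_ae_eq, hyw.deriv_ae_eq] with x hfwx hywx
  rw [hfwx, hywx]
  ring

theorem schrodingerPairing_mul_eq (hℓ : 0 ≤ ℓ) (hf : IsNonvanishingSolution ℓ σ f)
    (hy : MemW12 ℓ y) (hψ : MemW12Zero ℓ ψ) :
    schrodingerPairing ℓ σ y (fun x => f x * ψ x) =
      ∫ x in (0 : ℝ)..ℓ, (f x * deriv y x - deriv f x * y x) * deriv ψ x := by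
  rw [← schrodingerPairing_sub_schrodingerPairing (σ := σ) hℓ hf.isSolution.1 hy hψ.1,
    hf.isSolution.2 _ (hψ.mul hℓ hy), zero_mul, sub_zero]

-- Since `f` does not vanish, the products `f ψ` exhaust the test functions.
theorem isWeakSolution_iff_integral_wronskian_mul_deriv (hℓ : 0 ≤ ℓ)
    (hf : IsNonvanishingSolution ℓ σ f) (hy : MemW12 ℓ y) :
    IsWeakSolution ℓ σ lam y ↔ ∀ ψ, MemW12Zero ℓ ψ →
      ∫ x in (0 : ℝ)..ℓ, (f x * deriv y x - deriv f x * y x) * deriv ψ x =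
        -∫ x in (0 : ℝ)..ℓ, -lam * y x * f x * ψ x := by
  have h_rhs : ∀ ψ : ℝ → ℂ, -∫ x in (0 : ℝ)..ℓ, -lam * y x * f x * ψ x =
      lam * ∫ x in (0 : ℝ)..ℓ, y x * (f x * ψ x) := fun ψ => by
    simp only [mul_assoc, neg_mul, intervalIntegral.integral_neg,
      intervalIntegral.integral_const_mul, neg_neg]
  constructor
  · intro h ψ hψ
    rw [← schrodingerPairing_mul_eq hℓ hf hy hψ, h.2 _ (hψ.mul hℓ hf.isSolution.1), h_rhs]
  · refine fun h => ⟨hy, fun φ hφ => ?_⟩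
    have hψ := hφ.mul hℓ (hf.isSolution.1.hasWeakDeriv.inv hℓ hf.ne_zero).memW12
    have hφψ : EqOn φ (fun x => f x * ((f x)⁻¹ * φ x)) (Icc 0 ℓ) := fun x hx =>
      (mul_inv_cancel_left₀ (hf.ne_zero x hx) (φ x)).symm
    rw [schrodingerPairing_congr hℓ hφψ, schrodingerPairing_mul_eq hℓ hf hy hψ, h _ hψ, h_rhs]
    refine congrArg (lam * ·) (intervalIntegral.integral_congr fun x hx => ?_)
    rw [uIcc_of_le hℓ] at hx
    exact congrArg (y x * ·) (hφψ hx).symm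

theorem IsNonvanishingSolution.ae_ne_zero (hf : IsNonvanishingSolution ℓ σ f) :
    ∀ᵐ x ∂(volume.restrict (Ioo 0 ℓ)), f x ≠ 0 :=
  ae_restrict_Ioo_of_forall_Icc hf.ne_zero

/-- The equation `S_q y = lam y`, `y(0) = c₀`, `(D_f y)(0) = c₁`, as the system
`y' = (f'/f) y + v`, `v' = -(f'/f) v - lam y` for the pair `(y, v)` with `v = D_f y`. -/
structure IsCauchySystem (ℓ : ℝ) (f : ℝ → ℂ) (lam c₀ c₁ : ℂ) (y v : ℝ → ℂ) : Prop where
  hasWeakDeriv_fst : HasWeakDeriv ℓ y fun x => deriv f x / f x * y x + v x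
  hasWeakDeriv_snd : HasWeakDeriv ℓ v fun x => -(deriv f x / f x) * v x - lam * y x
  fst_zero : y 0 = c₀
  snd_zero : v 0 = c₁

theorem IsCauchySystem.isCauchySolution {v : ℝ → ℂ} (hℓ : 0 ≤ ℓ)
    (hf : IsNonvanishingSolution ℓ σ f) (h : IsCauchySystem ℓ f lam c₀ c₁ y v) :
    IsCauchySolution ℓ σ f lam c₀ c₁ y := by
  have hy := h.hasWeakDeriv_fst
  have hfv : HasWeakDeriv ℓ (fun x => f x * v x) fun x => -lam * y x * f x :=
    (hf.isSolution.1.hasWeakDeriv.mul hℓ h.hasWeakDeriv_snd).congr_deriv <|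
      hf.ae_ne_zero.mono fun x hx => by simp only; field_simp; ring
  refine ⟨(isWeakSolution_iff_integral_wronskian_mul_deriv hℓ hf hy.memW12).2 fun ψ hψ => ?_,
    h.fst_zero, v, h.hasWeakDeriv_snd.memW12, ?_, h.snd_zero⟩
  · rw [← hfv.integral_mul_deriv hℓ hψ]
    refine intervalIntegral_congr_ae_Ioo hℓ ?_
    filter_upwards [hy.deriv_ae_eq, hf.ae_ne_zero] with x hyx hfx
    rw [hyx]
    field_simp
    ring
  · filter_upwards [hy.deriv_ae_eq] with x hyx
    rw [darbouxD, hyx, add_sub_cancel_left]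

theorem IsCauchySolution.exists_isCauchySystem (hℓ : 0 < ℓ)
    (hf : IsNonvanishingSolution ℓ σ f) (hy : IsCauchySolution ℓ σ f lam c₀ c₁ y) :
    ∃ v, IsCauchySystem ℓ f lam c₀ c₁ y v := by
  have hfW := hf.isSolution.1
  have hyW := hy.isSolution.1
  obtain ⟨v, hv, hvD, hv0⟩ := hy.init_deriv
  have hfc := hfW.continuousOn hℓ.le
  have hyc := hyW.continuousOn hℓ.le
  have h_wronskian : MemLp (fun x => f x * deriv y x - deriv f x * y x) 2
      (volume.restrict (Ioo 0 ℓ)) := by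
    simp only [mul_comm (f _)]
    exact (memLp_mul_continuousOn_Icc hyW.2 hfc).sub (memLp_mul_continuousOn_Icc hfW.2 hyc)
  obtain ⟨V, hV, hV_ae⟩ := exists_hasWeakDeriv_ae_eq (g := fun x => -lam * y x * f x) hℓ
    h_wronskian
    (memLp_of_continuousOn_Icc 2 ((continuousOn_const.mul hyc).mul hfc))
    ((isWeakSolution_iff_integral_wronskian_mul_deriv hℓ.le hf hyW).1 hy.isSolution)
  -- `V = f v`, so `v` inherits its weak derivative from `V`.
  have hVv : EqOn v (fun x => V x * (f x)⁻¹) (Icc 0 ℓ) := by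
    refine hv.eqOn_of_ae_eq hℓ (hV.mul hℓ.le (hfW.hasWeakDeriv.inv hℓ.le hf.ne_zero)).memW12 ?_
    filter_upwards [hV_ae, hvD, hf.ae_ne_zero] with x hVx hvx hfx
    rw [hvx, hVx, darbouxD]
    field_simp
  refine ⟨v, hyW.hasWeakDeriv.congr_deriv ?_, ?_, hy.init_value, hv0⟩
  · filter_upwards [hvD] with x hvx
    rw [hvx, darbouxD, add_sub_cancel]
  · refine ((hV.mul hℓ.le (hfW.hasWeakDeriv.inv hℓ.le hf.ne_zero)).congr hℓ.le hVv).congr_deriv ?_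
    filter_upwards [ae_restrict_Ioo_of_forall_Icc hVv, hf.ae_ne_zero] with x hVx hfx
    rw [hVx]
    field_simp
    ring

theorem IsCauchySystem.linearComb {y₁ y₂ v₁ v₂ : ℝ → ℂ}
    (h₁ : IsCauchySystem ℓ f lam c₀ c₁ y₁ v₁) (h₂ : IsCauchySystem ℓ f lam d₀ d₁ y₂ v₂)
    (α β : ℂ) :
    IsCauchySystem ℓ f lam (α * c₀ + β * d₀) (α * c₁ + β * d₁)
      (fun x => α * y₁ x + β * y₂ x) fun x => α * v₁ x + β * v₂ x where
  hasWeakDeriv_fst := (h₁.hasWeakDeriv_fst.linearComb h₂.hasWeakDeriv_fst α β).congr_deriv <|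
    .of_forall fun _ => by ring
  hasWeakDeriv_snd := (h₁.hasWeakDeriv_snd.linearComb h₂.hasWeakDeriv_snd α β).congr_deriv <|
    .of_forall fun _ => by ring
  fst_zero := by rw [h₁.fst_zero, h₂.fst_zero]
  snd_zero := by rw [h₁.snd_zero, h₂.snd_zero]

theorem IsCauchySolution.linearComb (hℓ : 0 < ℓ) (hf : IsNonvanishingSolution ℓ σ f)
    {y₁ y₂ : ℝ → ℂ} (h₁ : IsCauchySolution ℓ σ f lam c₀ c₁ y₁)
    (h₂ : IsCauchySolution ℓ σ f lam d₀ d₁ y₂) (α β : ℂ) :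
    IsCauchySolution ℓ σ f lam (α * c₀ + β * d₀) (α * c₁ + β * d₁)
      (fun x => α * y₁ x + β * y₂ x) := by
  obtain ⟨v₁, hv₁⟩ := h₁.exists_isCauchySystem hℓ hf
  obtain ⟨v₂, hv₂⟩ := h₂.exists_isCauchySystem hℓ hf
  exact (hv₁.linearComb hv₂ α β).isCauchySolution hℓ.le hf

theorem exists_isCauchySolution_zero_zero_one (hℓ : 0 ≤ ℓ) (hf : IsNonvanishingSolution ℓ σ f) :
    ∃ y, IsCauchySolution ℓ σ f 0 0 1 y := by
  have hfW := hf.isSolution.1.hasWeakDeriv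
  have hinv := hfW.inv hℓ hf.ne_zero
  have hinv_sq : MemLp (fun x => (f x)⁻¹ ^ 2) 2 (volume.restrict (Ioo 0 ℓ)) :=
    memLp_of_continuousOn_Icc 2 ((hinv.continuousOn hℓ).pow 2)
  have hsys : IsCauchySystem ℓ f 0 0 1 (fun x => f x * ∫ t in (0 : ℝ)..x, (f t)⁻¹ ^ 2)
      fun x => (f x)⁻¹ := by
    refine ⟨(hfW.mul hℓ (.integral hℓ hinv_sq)).congr_deriv ?_, hinv.congr_deriv ?_, ?_, ?_⟩
    · exact hf.ae_ne_zero.mono fun x hx => by simp only; field_simp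
    · exact hf.ae_ne_zero.mono fun x hx => by simp only; field_simp; ring
    · rw [intervalIntegral.integral_same, mul_zero]
    · rw [hf.normalized, inv_one]
  exact ⟨_, hsys.isCauchySolution hℓ hf⟩

/-! ### Dependence of the solutions on the spectral parameter -/

/-- The right hand side of the system `Y' = V / f²`, `V' = -lam f² Y` satisfied by `Y = y / f` and
`V = f D_f y`; unlike the system for `(y, D_f y)`, its coefficients are continuous. -/
noncomputable def quotientField (f : ℝ → ℂ) (lam : ℂ) (t : ℝ) (z : ℂ × ℂ) : ℂ × ℂ :=
  (((f t) ^ 2)⁻¹ * z.2, -lam * f t ^ 2 * z.1)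

theorem lipschitzWith_quotientField {t : ℝ} {L : ℝ≥0} (h_inv : ‖((f t) ^ 2)⁻¹‖ ≤ L)
    (h_sq : ‖lam‖ * ‖f t ^ 2‖ ≤ L) : LipschitzWith L (quotientField f lam t) := by
  refine LipschitzWith.of_dist_le_mul fun z z' => ?_
  rw [Prod.dist_eq (x := quotientField f lam t z), dist_eq_norm, dist_eq_norm, dist_eq_norm,
    quotientField, quotientField, ← mul_sub, ← mul_sub, norm_mul, norm_mul, norm_mul, norm_neg]
  refine max_le ?_ ?_ <;> gcongr
  · exact norm_snd_le (z - z')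
  · exact norm_fst_le (z - z')

theorem IsCauchySolution.exists_hasDerivWithinAt_quotientField (hℓ : 0 < ℓ)
    (hf : IsNonvanishingSolution ℓ σ f) (hy : IsCauchySolution ℓ σ f lam c₀ c₁ y) :
    ∃ Z : ℝ → ℂ × ℂ, ContinuousOn Z (Icc 0 ℓ) ∧
      (∀ t ∈ Ico 0 ℓ, HasDerivWithinAt Z (quotientField f lam t (Z t)) (Ici t) t) ∧
      Z 0 = (c₀, c₁) ∧ ∀ x ∈ Icc 0 ℓ, y x = f x * (Z x).1 := by
  obtain ⟨v, hyD, hvD, hy0, hv0⟩ := hy.exists_isCauchySystem hℓ hf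
  have hfW := hf.isSolution.1.hasWeakDeriv
  have hinv := hfW.inv hℓ.le hf.ne_zero
  have hY : HasWeakDeriv ℓ (fun x => y x * (f x)⁻¹) fun x => v x * (f x)⁻¹ :=
    (hyD.mul hℓ.le hinv).congr_deriv <|
      hf.ae_ne_zero.mono fun x hx => by simp only; field_simp; ring
  have hV : HasWeakDeriv ℓ (fun x => f x * v x) fun x => -lam * f x * y x :=
    (hfW.mul hℓ.le hvD).congr_deriv <|
      hf.ae_ne_zero.mono fun x hx => by simp only; field_simp; ring
  have hfc := hfW.continuousOn hℓ.le
  have hY' := (hvD.continuousOn hℓ.le).mul (hinv.continuousOn hℓ.le)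
  have hV' := (continuousOn_const (c := -lam)).mul hfc |>.mul (hyD.continuousOn hℓ.le)
  refine ⟨fun x => (y x * (f x)⁻¹, f x * v x),
    (hY.continuousOn hℓ.le).prodMk (hV.continuousOn hℓ.le), fun t ht => ?_, ?_, fun x hx => ?_⟩
  · convert (hY.hasDerivWithinAt_Ici hℓ.le hY' ht).prodMk (hV.hasDerivWithinAt_Ici hℓ.le hV' ht)
      using 1
    have := hf.ne_zero t (Ico_subset_Icc_self ht)
    ext <;> simp only [quotientField] <;> field_simp
  · simp only [hy0, hv0, hf.normalized, inv_one, mul_one, one_mul]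
  · have := hf.ne_zero x hx
    field_simp

theorem exists_lipschitzWith_quotientField (hfc : ContinuousOn f (Icc 0 ℓ))
    (hne : ∀ x ∈ Icc 0 ℓ, f x ≠ 0) (R : ℝ≥0) :
    ∃ L : ℝ≥0, L ≠ 0 ∧ ∀ lam, ‖lam‖ ≤ R → ∀ t ∈ Icc 0 ℓ,
      LipschitzWith L (quotientField f lam t) := by
  have hsq : ContinuousOn (fun x => f x ^ 2) (Icc 0 ℓ) := hfc.pow 2
  have hinv : ContinuousOn (fun x => (f x ^ 2)⁻¹) (Icc 0 ℓ) :=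
    hsq.inv₀ fun x hx => pow_ne_zero 2 (hne x hx)
  obtain ⟨A, hA⟩ := isCompact_Icc.exists_bound_of_continuousOn hinv
  obtain ⟨B, hB⟩ := isCompact_Icc.exists_bound_of_continuousOn hsq
  refine ⟨A.toNNReal + R * B.toNNReal + 1, (add_pos_of_nonneg_of_pos zero_le one_pos).ne',
    fun lam hlam t ht => lipschitzWith_quotientField ?_ ?_⟩
  · calc ‖(f t ^ 2)⁻¹‖ ≤ A.toNNReal := (hA t ht).trans (Real.le_coe_toNNReal A)
      _ ≤ ↑(A.toNNReal + R * B.toNNReal + 1) :=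
        NNReal.coe_le_coe.2 (le_self_add.trans le_self_add)
  · calc ‖lam‖ * ‖f t ^ 2‖ ≤ R * B.toNNReal := by
          gcongr
          exact (hB t ht).trans (Real.le_coe_toNNReal B)
      _ ≤ ↑(A.toNNReal + R * B.toNNReal + 1) :=
        NNReal.coe_le_coe.2 (le_add_self.trans le_self_add : R * B.toNNReal ≤ _)

theorem dist_quotientField_le (lam₀ : ℂ) (t : ℝ) (z : ℂ × ℂ) :
    dist (quotientField f lam₀ t z) (quotientField f lam t z) ≤
      ‖lam - lam₀‖ * (‖f t ^ 2‖ * ‖z‖) := by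
  rw [Prod.dist_eq, quotientField, quotientField, dist_self, max_eq_right dist_nonneg,
    dist_eq_norm, show -lam₀ * f t ^ 2 * z.1 - -lam * f t ^ 2 * z.1 =
      (lam - lam₀) * (f t ^ 2 * z.1) by ring, norm_mul, norm_mul]
  gcongr
  exact norm_fst_le z

theorem IsCauchySolution.exists_norm_sub_le (hℓ : 0 < ℓ) (hf : IsNonvanishingSolution ℓ σ f)
    {lam₀ : ℂ} {y₀ : ℝ → ℂ} (hy₀ : IsCauchySolution ℓ σ f lam₀ c₀ c₁ y₀) {x : ℝ}
    (hx : x ∈ Icc 0 ℓ) :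
    ∃ C : ℝ, ∀ lam y, ‖lam - lam₀‖ ≤ 1 → IsCauchySolution ℓ σ f lam c₀ c₁ y →
      ‖y x - y₀ x‖ ≤ C * ‖lam - lam₀‖ := by
  have hfc := hf.isSolution.1.continuousOn hℓ.le
  obtain ⟨B, hB⟩ : ∃ B, ∀ x ∈ Icc 0 ℓ, ‖f x ^ 2‖ ≤ B :=
    isCompact_Icc.exists_bound_of_continuousOn (hfc.pow 2)
  obtain ⟨L, hL, h_lip⟩ := exists_lipschitzWith_quotientField hfc hf.ne_zero (1 + ‖lam₀‖₊)
  obtain ⟨Z₀, hZ₀c, hZ₀', hZ₀0, hyZ₀⟩ := hy₀.exists_hasDerivWithinAt_quotientField hℓ hf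
  obtain ⟨M, hM⟩ := isCompact_Icc.exists_bound_of_continuousOn hZ₀c
  refine ⟨‖f x‖ * (B * M / L * (Real.exp (L * x) - 1)), fun lam y hlam hy => ?_⟩
  obtain ⟨Z, hZc, hZ', hZ0, hyZ⟩ := hy.exists_hasDerivWithinAt_quotientField hℓ hf
  have hlam' : ‖lam‖ ≤ (1 + ‖lam₀‖₊ : ℝ≥0) := by
    push_cast
    linarith [norm_le_norm_add_norm_sub' lam lam₀]
  -- `Z₀` solves the system for `lam` up to an error of size `‖lam - lam₀‖`.
  have h_approx : ∀ t ∈ Ico 0 ℓ, dist (quotientField f lam₀ t (Z₀ t))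
      (quotientField f lam t (Z₀ t)) ≤ ‖lam - lam₀‖ * (B * M) := fun t ht => by
    have ht' := Ico_subset_Icc_self ht
    have hB0 : 0 ≤ B := (norm_nonneg _).trans (hB t ht')
    refine (dist_quotientField_le lam₀ t _).trans ?_
    gcongr
    exacts [hB t ht', hM t ht']
  have h_gronwall := dist_le_of_approx_trajectories_ODE_of_mem
    (fun t ht => (h_lip lam hlam' t (Ico_subset_Icc_self ht)).lipschitzOnWith) hZc hZ'
    (fun t _ => (dist_self _).le) (fun _ _ => mem_univ _) hZ₀c hZ₀' h_approx
    (fun _ _ => mem_univ _) (by rw [hZ0, hZ₀0, dist_self]) x hx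
  simp only [gronwallBound_of_K_ne_0 (NNReal.coe_ne_zero.2 hL), zero_mul, zero_add, sub_zero,
    dist_eq_norm] at h_gronwall
  calc ‖y x - y₀ x‖ = ‖f x‖ * ‖(Z x - Z₀ x).1‖ := by
        rw [hyZ x hx, hyZ₀ x hx, ← mul_sub, norm_mul, Prod.fst_sub]
    _ ≤ ‖f x‖ * (‖lam - lam₀‖ * (B * M) / L * (Real.exp (L * x) - 1)) := by
        gcongr
        exact (norm_fst_le _).trans h_gronwall
    _ = ‖f x‖ * (B * M / L * (Real.exp (L * x) - 1)) * ‖lam - lam₀‖ := by ring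

theorem IsCauchySolution.unique (hℓ : 0 < ℓ) (hf : IsNonvanishingSolution ℓ σ f)
    {y₁ y₂ : ℝ → ℂ} (h₁ : IsCauchySolution ℓ σ f lam c₀ c₁ y₁)
    (h₂ : IsCauchySolution ℓ σ f lam c₀ c₁ y₂) : EqOn y₁ y₂ (Icc 0 ℓ) := fun x hx => by
  obtain ⟨C, hC⟩ := h₂.exists_norm_sub_le hℓ hf hx
  simpa only [sub_self, norm_zero, mul_zero, norm_le_zero_iff, sub_eq_zero] using
    hC lam y₁ (by simp) h₁

theorem continuous_isCauchySolution (hℓ : 0 < ℓ) (hf : IsNonvanishingSolution ℓ σ f)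
    {α : Type*} [TopologicalSpace α] {Λ : α → ℂ} (hΛ : Continuous Λ) {Y : α → ℝ → ℂ}
    (hY : ∀ a, IsCauchySolution ℓ σ f (Λ a) c₀ c₁ (Y a)) {x : ℝ} (hx : x ∈ Icc 0 ℓ) :
    Continuous fun a => Y a x := by
  refine continuous_iff_continuousAt.2 fun a₀ => ?_
  obtain ⟨C, hC⟩ := (hY a₀).exists_norm_sub_le hℓ hf hx
  have h_lim : Tendsto (fun a => C * ‖Λ a - Λ a₀‖) (𝓝 a₀) (𝓝 0) := by
    simpa using (by fun_prop : Continuous fun a => C * ‖Λ a - Λ a₀‖).tendsto a₀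
  refine tendsto_iff_norm_sub_tendsto_zero.2
    (squeeze_zero' (.of_forall fun _ => norm_nonneg _) ?_ h_lim)
  filter_upwards [hΛ.continuousAt (Metric.closedBall_mem_nhds (Λ a₀) one_pos)] with a ha
  exact hC (Λ a) _ (mem_closedBall_iff_norm.1 ha) (hY a)

end Schrodinger

/-! ### A Volterra equation on the cone `|t| ≤ x` -/

/-- The standing assumption `p ∈ L¹(ℝ) ∩ L²(ℝ)` on the coefficient of the Volterra equation, for
a measurable representative: the equation evaluates `p` pointwise. -/
structure IsVolterraCoefficient (p : ℝ → ℂ) : Prop where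
  measurable : Measurable p
  integrable : Integrable p
  integrable_sq : Integrable fun s => ‖p s‖ ^ 2

/-- The operator `(T F)(x, t) = ∫₀ˣ p(s) F(s, x - s - t) ds`, which corresponds under the Fourier
transform in `t` to `u(ρ, ·) ↦ ∫₀ˣ e^{iρ(x - s)} p(s) u(-ρ, s) ds`. -/
noncomputable def volterraOp (p : ℝ → ℂ) (F : ℝ → ℝ → ℂ) (x t : ℝ) : ℂ :=
  ∫ s in Ioc 0 x, p s * F s (x - s - t)

/-- The free term of the Volterra equation: the image under `T` of the unit mass at `t = x`. -/
noncomputable def volterraFree (p : ℝ → ℂ) (x t : ℝ) : ℂ :=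
  {q : ℝ × ℝ | |q.2| < q.1}.indicator (fun q => p ((q.1 - q.2) / 2) / 2) (x, t)

/-- `F(x, ·)` vanishes outside `[-x, x]`. -/
def SupportedInCone (F : ℝ → ℝ → ℂ) : Prop :=
  ∀ x t, x < |t| → F x t = 0

/-- The rate `c` for which `T` is a contraction of factor `1/2` in the norm
`sup ‖F(x, t)‖ e^{-cx}`. -/
noncomputable def volterraWeight (p : ℝ → ℂ) : ℝ := 2 * ((∫ s, ‖p s‖ ^ 2) + 1)

section Volterra

variable {p : ℝ → ℂ} {F : ℝ → ℝ → ℂ} {M : ℝ}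

theorem IsVolterraCoefficient.neg (hp : IsVolterraCoefficient p) :
    IsVolterraCoefficient (-p) where
  measurable := hp.measurable.neg
  integrable := hp.integrable.neg
  integrable_sq := by simpa only [Pi.neg_apply, norm_neg] using hp.integrable_sq

theorem IsVolterraCoefficient.memLp_two (hp : IsVolterraCoefficient p) : MemLp p 2 :=
  (memLp_two_iff_integrable_sq_norm hp.measurable.aestronglyMeasurable).2 hp.integrable_sq

theorem volterraWeight_pos (p : ℝ → ℂ) : 0 < volterraWeight p := by
  rw [volterraWeight]
  positivity

theorem measurable_volterraFree (hpm : Measurable p) :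
    Measurable (Function.uncurry (volterraFree p)) :=
  (by fun_prop : Measurable fun q : ℝ × ℝ => p ((q.1 - q.2) / 2) / 2).indicator
    (measurableSet_lt measurable_snd.abs measurable_fst)

theorem measurable_volterraOp (hpm : Measurable p) (hF : Measurable (Function.uncurry F)) :
    Measurable (Function.uncurry (volterraOp p F)) := by
  have h_integrand : Measurable fun q : (ℝ × ℝ) × ℝ => p q.2 * F q.2 (q.1.1 - q.2 - q.1.2) :=
    (hpm.comp measurable_snd).mul
      (hF.comp (by fun_prop : Measurable fun q : (ℝ × ℝ) × ℝ => (q.2, q.1.1 - q.2 - q.1.2)))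
  have h_range : MeasurableSet {q : (ℝ × ℝ) × ℝ | q.2 ∈ Ioc 0 q.1.1} :=
    (measurableSet_lt measurable_const measurable_snd).inter
      (measurableSet_le measurable_snd measurable_fst.fst)
  convert ((h_integrand.indicator h_range).stronglyMeasurable.integral_prod_right'
    (ν := volume)).measurable using 1
  ext ⟨x, t⟩
  rw [Function.uncurry, volterraOp, ← integral_indicator measurableSet_Ioc]
  rfl

theorem SupportedInCone.apply_sub_sub_eq_zero (hF : SupportedInCone F) {x t s : ℝ} (hs : s ≤ x)
    (hxt : x < |t|) : F s (x - s - t) = 0 := by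
  refine hF s _ ?_
  have h_tri := abs_sub_abs_le_abs_sub t (x - s)
  rw [abs_sub_comm t, abs_of_nonneg (sub_nonneg.2 hs)] at h_tri
  linarith

theorem SupportedInCone.volterraOp (hF : SupportedInCone F) :
    SupportedInCone (volterraOp p F) := fun x t hxt =>
  setIntegral_eq_zero_of_forall_eq_zero fun s hs => by
    rw [hF.apply_sub_sub_eq_zero hs.2 hxt, mul_zero]

theorem supportedInCone_volterraFree : SupportedInCone (volterraFree p) := fun _ _ hxt =>
  indicator_of_notMem (by simpa using hxt.le) _

theorem norm_volterraFree_le (x t : ℝ) : ‖volterraFree p x t‖ ≤ ‖p ((x - t) / 2)‖ / 2 :=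
  (norm_indicator_le_norm_self _ _).trans (by simp)

theorem integrableOn_norm_mul_exp (hp : Integrable p) (c x : ℝ) :
    IntegrableOn (fun s => ‖p s‖ * Real.exp (c * s)) (Ioc 0 x) :=
  (integrableOn_Icc_iff_integrableOn_Ioc).1 <|
    hp.norm.integrableOn.mul_continuousOn (by fun_prop) isCompact_Icc

theorem mul_exp_le {c : ℝ} (hc : 0 < c) (a s x : ℝ) : a * Real.exp (c * s) ≤
    Real.exp (c * x) / 2 * (c⁻¹ * a ^ 2 + c * Real.exp (2 * c * s - 2 * c * x)) := by
  have h_split : Real.exp (c * s) = Real.exp (c * x) * Real.exp (c * s - c * x) := by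
    rw [← Real.exp_add, add_sub_cancel]
  have h_sq : Real.exp (2 * c * s - 2 * c * x) = Real.exp (c * s - c * x) ^ 2 := by
    rw [← Real.exp_nat_mul]
    push_cast
    ring_nf
  rw [h_split, h_sq]
  set u := Real.exp (c * s - c * x)
  have h_amgm : a * u ≤ (c⁻¹ * a ^ 2 + c * u ^ 2) / 2 := by
    have h_nonneg : 0 ≤ c⁻¹ * (a - c * u) ^ 2 := by positivity
    have h_expand : c⁻¹ * (a - c * u) ^ 2 = c⁻¹ * a ^ 2 + c * u ^ 2 - 2 * (a * u) := by
      field_simp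
      ring
    linarith
  calc a * (Real.exp (c * x) * u) = Real.exp (c * x) * (a * u) := by ring
    _ ≤ Real.exp (c * x) * ((c⁻¹ * a ^ 2 + c * u ^ 2) / 2) := by gcongr
    _ = _ := by ring

theorem setIntegral_mul_exp_le {c x : ℝ} (hc : 0 < c) (hx : 0 ≤ x) :
    ∫ s in Ioc 0 x, c * Real.exp (2 * c * s - 2 * c * x) ≤ 1 / 2 := by
  rw [← intervalIntegral.integral_of_le hx, intervalIntegral.integral_const_mul,
    intervalIntegral.integral_comp_mul_sub (f := Real.exp) (by positivity), integral_exp, sub_self,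
    Real.exp_zero, smul_eq_mul, ← mul_assoc, show c * (2 * c)⁻¹ = 1 / 2 by field_simp]
  linarith [Real.exp_pos (2 * c * 0 - 2 * c * x)]

theorem setIntegral_norm_mul_exp_le (hp : IsVolterraCoefficient p) (x : ℝ) :
    ∫ s in Ioc 0 x, ‖p s‖ * Real.exp (volterraWeight p * s) ≤
      Real.exp (volterraWeight p * x) / 2 := by
  rcases le_total x 0 with hx | hx
  · rw [Ioc_eq_empty_of_le hx, setIntegral_empty]
    positivity
  set c := volterraWeight p with hc
  have hc_pos : 0 < c := volterraWeight_pos p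
  have h_sq : IntegrableOn (fun s => c⁻¹ * ‖p s‖ ^ 2) (Ioc 0 x) :=
    (hp.integrable_sq.const_mul _).integrableOn
  have h_exp : IntegrableOn (fun s => c * Real.exp (2 * c * s - 2 * c * x)) (Ioc 0 x) :=
    (by fun_prop : Continuous fun s => c * Real.exp (2 * c * s - 2 * c * x)).integrableOn_Ioc
  have h_sq_le : ∫ s in Ioc 0 x, c⁻¹ * ‖p s‖ ^ 2 ≤ 1 / 2 := by
    have h_le : ∫ s in Ioc 0 x, ‖p s‖ ^ 2 ≤ ∫ s, ‖p s‖ ^ 2 :=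
      setIntegral_le_integral hp.integrable_sq (.of_forall fun _ => by positivity)
    rw [integral_const_mul, inv_mul_le_iff₀ hc_pos, hc, volterraWeight]
    linarith
  have h_bound : IntegrableOn (fun s => Real.exp (c * x) / 2 *
      (c⁻¹ * ‖p s‖ ^ 2 + c * Real.exp (2 * c * s - 2 * c * x))) (Ioc 0 x) :=
    Integrable.const_mul (h_sq.add h_exp) _
  calc ∫ s in Ioc 0 x, ‖p s‖ * Real.exp (c * s)
      ≤ ∫ s in Ioc 0 x, Real.exp (c * x) / 2 *
          (c⁻¹ * ‖p s‖ ^ 2 + c * Real.exp (2 * c * s - 2 * c * x)) :=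
        setIntegral_mono (integrableOn_norm_mul_exp hp.integrable c x) h_bound
          fun s => mul_exp_le hc_pos _ s x
    _ = Real.exp (c * x) / 2 * ((∫ s in Ioc 0 x, c⁻¹ * ‖p s‖ ^ 2) +
          ∫ s in Ioc 0 x, c * Real.exp (2 * c * s - 2 * c * x)) := by
        rw [integral_const_mul, integral_add h_sq h_exp]
    _ ≤ Real.exp (c * x) / 2 * (1 / 2 + 1 / 2) := by
        gcongr
        exact setIntegral_mul_exp_le hc_pos hx
    _ = Real.exp (c * x) / 2 := by ring

theorem norm_mul_le_mul_exp {s : ℝ} (hs : 0 < s) {c : ℝ}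
    (hM : ∀ s, 0 < s → ∀ t, ‖F s t‖ ≤ M * Real.exp (c * s)) (t : ℝ) :
    ‖p s * F s t‖ ≤ M * (‖p s‖ * Real.exp (c * s)) := by
  rw [norm_mul, mul_left_comm]
  gcongr
  exact hM s hs t

theorem integrableOn_volterraOp (hp : Integrable p) (hF : Measurable (Function.uncurry F)) {c : ℝ}
    (hM : ∀ s, 0 < s → ∀ t, ‖F s t‖ ≤ M * Real.exp (c * s)) (x t : ℝ) :
    IntegrableOn (fun s => p s * F s (x - s - t)) (Ioc 0 x) := by
  refine Integrable.mono' ((integrableOn_norm_mul_exp hp c x).const_mul M)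
    (hp.aestronglyMeasurable.restrict.mul (Measurable.aestronglyMeasurable
      (hF.comp (by fun_prop : Measurable fun s : ℝ => (s, x - s - t))))) ?_
  filter_upwards [ae_restrict_mem measurableSet_Ioc] with s hs
  exact norm_mul_le_mul_exp hs.1 hM _

theorem setIntegral_norm_volterraOp_le (hp : IsVolterraCoefficient p)
    (hF : Measurable (Function.uncurry F)) (hM0 : 0 ≤ M)
    (hM : ∀ s, 0 < s → ∀ t, ‖F s t‖ ≤ M * Real.exp (volterraWeight p * s)) (x t : ℝ) :
    ∫ s in Ioc 0 x, ‖p s * F s (x - s - t)‖ ≤ M / 2 * Real.exp (volterraWeight p * x) := by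
  calc ∫ s in Ioc 0 x, ‖p s * F s (x - s - t)‖
      ≤ ∫ s in Ioc 0 x, M * (‖p s‖ * Real.exp (volterraWeight p * s)) :=
        setIntegral_mono_on (integrableOn_volterraOp hp.integrable hF hM x t).norm
          ((integrableOn_norm_mul_exp hp.integrable _ x).const_mul M) measurableSet_Ioc
          fun s hs => norm_mul_le_mul_exp hs.1 hM _
    _ ≤ M * (Real.exp (volterraWeight p * x) / 2) := by
        rw [integral_const_mul]
        gcongr
        exact setIntegral_norm_mul_exp_le hp x
    _ = M / 2 * Real.exp (volterraWeight p * x) := by ring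

theorem norm_volterraOp_le (hp : IsVolterraCoefficient p) (hF : Measurable (Function.uncurry F))
    (hM0 : 0 ≤ M) (hM : ∀ s, 0 < s → ∀ t, ‖F s t‖ ≤ M * Real.exp (volterraWeight p * s))
    (x t : ℝ) : ‖volterraOp p F x t‖ ≤ M / 2 * Real.exp (volterraWeight p * x) :=
  (norm_integral_le_integral_norm _).trans (setIntegral_norm_volterraOp_le hp hF hM0 hM x t)

theorem norm_mul_volterraFree_le (x t s : ℝ) : ‖p s * volterraFree p s (x - s - t)‖ ≤
    (‖p s‖ ^ 2 + ‖p (s - (x - t) / 2)‖ ^ 2) / 2 := by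
  have h_free : ‖volterraFree p s (x - s - t)‖ ≤ ‖p (s - (x - t) / 2)‖ / 2 :=
    (norm_volterraFree_le _ _).trans_eq (by ring_nf)
  rw [norm_mul]
  nlinarith [two_mul_le_add_sq ‖p s‖ ‖p (s - (x - t) / 2)‖, sq_nonneg ‖p s‖,
    sq_nonneg ‖p (s - (x - t) / 2)‖, mul_le_mul_of_nonneg_left h_free (norm_nonneg (p s))]

theorem integrableOn_volterraOp_volterraFree (hp : IsVolterraCoefficient p) (x t : ℝ) :
    IntegrableOn (fun s => p s * volterraFree p s (x - s - t)) (Ioc 0 x) :=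
  Integrable.mono'
    ((hp.integrable_sq.add (hp.integrable_sq.comp_sub_right _)).div_const 2).integrableOn
    (hp.measurable.mul ((measurable_volterraFree hp.measurable).comp
      (by fun_prop : Measurable fun s : ℝ => (s, x - s - t)))).aestronglyMeasurable
    (.of_forall fun s => norm_mul_volterraFree_le x t s)

-- The free term is only in `L²(-x, x)`, but its image under `T` is bounded, by Cauchy-Schwarz.
theorem norm_volterraOp_volterraFree_le (hp : IsVolterraCoefficient p) (x t : ℝ) :
    ‖volterraOp p (volterraFree p) x t‖ ≤ ∫ s, ‖p s‖ ^ 2 := by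
  have h_shift := hp.integrable_sq.comp_sub_right ((x - t) / 2)
  have h_int : Integrable fun s => (‖p s‖ ^ 2 + ‖p (s - (x - t) / 2)‖ ^ 2) / 2 :=
    (hp.integrable_sq.add h_shift).div_const 2
  calc ‖volterraOp p (volterraFree p) x t‖
      ≤ ∫ s in Ioc 0 x, (‖p s‖ ^ 2 + ‖p (s - (x - t) / 2)‖ ^ 2) / 2 :=
        norm_integral_le_of_norm_le h_int.integrableOn
          (.of_forall fun s => norm_mul_volterraFree_le x t s)
    _ ≤ ∫ s, (‖p s‖ ^ 2 + ‖p (s - (x - t) / 2)‖ ^ 2) / 2 :=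
        setIntegral_le_integral h_int (.of_forall fun s => by positivity)
    _ = ∫ s, ‖p s‖ ^ 2 := by
        rw [integral_div, integral_add hp.integrable_sq h_shift,
          integral_sub_right_eq_self fun s => ‖p s‖ ^ 2]
        ring

/-- The Neumann iterates `Tⁿ⁺¹ G₀` of the free term `G₀`. -/
noncomputable def volterraIterate (p : ℝ → ℂ) : ℕ → ℝ → ℝ → ℂ
  | 0 => volterraOp p (volterraFree p)
  | n + 1 => volterraOp p (volterraIterate p n)

theorem measurable_volterraIterate (hpm : Measurable p) :
    ∀ n, Measurable (Function.uncurry (volterraIterate p n))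
  | 0 => measurable_volterraOp hpm (measurable_volterraFree hpm)
  | n + 1 => measurable_volterraOp hpm (measurable_volterraIterate hpm n)

theorem supportedInCone_volterraIterate : ∀ n, SupportedInCone (volterraIterate p n)
  | 0 => supportedInCone_volterraFree.volterraOp
  | n + 1 => (supportedInCone_volterraIterate n).volterraOp

theorem volterraIterate_of_nonpos {x : ℝ} (hx : x ≤ 0) (t : ℝ) (n : ℕ) :
    volterraIterate p n x t = 0 := by
  cases n <;> simp only [volterraIterate, volterraOp, Ioc_eq_empty_of_le hx, setIntegral_empty]

theorem norm_volterraIterate_le (hp : IsVolterraCoefficient p) (n : ℕ) :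
    ∀ x, 0 < x → ∀ t, ‖volterraIterate p n x t‖ ≤
      (∫ s, ‖p s‖ ^ 2) * (1 / 2) ^ n * Real.exp (volterraWeight p * x) := by
  induction n with
  | zero =>
    intro x hx t
    rw [pow_zero, mul_one]
    refine (norm_volterraOp_volterraFree_le hp x t).trans
      (le_mul_of_one_le_right (by positivity) ?_)
    exact Real.one_le_exp (mul_pos (volterraWeight_pos p) hx).le
  | succ n ih =>
    intro x _ t
    refine (norm_volterraOp_le hp (measurable_volterraIterate hp.measurable n) (by positivity) ih x
      t).trans_eq ?_
    ring

theorem hasSum_volterraIterate_succ (hp : IsVolterraCoefficient p) (x t : ℝ) :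
    HasSum (fun n => volterraIterate p (n + 1) x t)
      (volterraOp p (fun s t => ∑' n, volterraIterate p n s t) x t) := by
  have h_meas := measurable_volterraIterate hp.measurable
  have h_summable : Summable fun n =>
      ∫ s in Ioc 0 x, ‖p s * volterraIterate p n s (x - s - t)‖ :=
    .of_nonneg_of_le (fun n => integral_nonneg fun _ => norm_nonneg _)
      (fun n => setIntegral_norm_volterraOp_le hp (h_meas n) (by positivity)
        (norm_volterraIterate_le hp n) x t)
      (((summable_geometric_two.mul_left _).div_const 2).mul_right _)
  have h_sum := hasSum_integral_of_summable_integral_norm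
    (fun n => integrableOn_volterraOp hp.integrable (h_meas n) (norm_volterraIterate_le hp n) x t)
    h_summable
  simp only [tsum_mul_left] at h_sum
  exact h_sum

theorem summable_volterraIterate (hp : IsVolterraCoefficient p) (x t : ℝ) :
    Summable fun n => volterraIterate p n x t :=
  (summable_nat_add_iff 1).1 (hasSum_volterraIterate_succ hp x t).summable

theorem measurable_tsum_volterraIterate (hp : IsVolterraCoefficient p) :
    Measurable (Function.uncurry fun x t => ∑' n, volterraIterate p n x t) := by
  refine measurable_of_tendsto_metrizable (f := fun (N : ℕ) (q : ℝ × ℝ) =>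
    ∑ n ∈ Finset.range N, volterraIterate p n q.1 q.2)
    (fun N => Finset.measurable_sum _ fun n _ => measurable_volterraIterate hp.measurable n) ?_
  exact tendsto_pi_nhds.2 fun q => (summable_volterraIterate hp q.1 q.2).hasSum.tendsto_sum_nat

theorem norm_tsum_volterraIterate_le (hp : IsVolterraCoefficient p) (x : ℝ) (hx : 0 < x) (t : ℝ) :
    ‖∑' n, volterraIterate p n x t‖ ≤
      2 * (∫ s, ‖p s‖ ^ 2) * Real.exp (volterraWeight p * x) := by
  have h_geom := (hasSum_geometric_two.mul_left (∫ s, ‖p s‖ ^ 2)).mul_right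
    (Real.exp (volterraWeight p * x))
  rw [mul_comm _ (2 : ℝ)] at h_geom
  exact tsum_of_norm_bounded h_geom fun n => norm_volterraIterate_le hp n x hx t

/-- The solution `G = G₀ + T G₀ + T² G₀ + ⋯` of the Volterra equation `G = G₀ + T G`. -/
noncomputable def volterraSol (p : ℝ → ℂ) (x t : ℝ) : ℂ :=
  volterraFree p x t + ∑' n, volterraIterate p n x t

theorem measurable_volterraSol (hp : IsVolterraCoefficient p) :
    Measurable (Function.uncurry (volterraSol p)) :=
  (measurable_volterraFree hp.measurable).add (measurable_tsum_volterraIterate hp)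

theorem supportedInCone_volterraSol : SupportedInCone (volterraSol p) := fun x t hxt => by
  simp only [volterraSol, supportedInCone_volterraFree x t hxt,
    supportedInCone_volterraIterate _ x t hxt, tsum_zero, zero_add]

theorem volterraSol_eq (hp : IsVolterraCoefficient p) (x t : ℝ) :
    volterraSol p x t = volterraFree p x t + volterraOp p (volterraSol p) x t := by
  rw [volterraSol, (summable_volterraIterate hp x t).tsum_eq_zero_add,
    (hasSum_volterraIterate_succ hp x t).tsum_eq]
  simp only [volterraIterate, volterraOp, volterraSol, mul_add]
  rw [integral_add (integrableOn_volterraOp_volterraFree hp x t)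
    (integrableOn_volterraOp hp.integrable (measurable_tsum_volterraIterate hp)
      (norm_tsum_volterraIterate_le hp) x t)]

theorem exists_norm_volterraSol_le (hp : IsVolterraCoefficient p) (ℓ : ℝ) :
    ∃ M, 0 ≤ M ∧ ∀ x ≤ ℓ, ∀ t, ‖volterraSol p x t‖ ≤
      ‖p ((x - t) / 2)‖ + (Icc (-x) x).indicator (fun _ => M) t := by
  have h_weight := volterraWeight_pos p
  let M := 2 * (∫ s, ‖p s‖ ^ 2) * Real.exp (volterraWeight p * ℓ)
  have hM : 0 ≤ M := by positivity
  refine ⟨M, hM, fun x hx t => ?_⟩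
  by_cases ht : t ∈ Icc (-x) x
  · rw [indicator_of_mem ht, volterraSol]
    refine (norm_add_le _ _).trans (add_le_add ?_ ?_)
    · exact (norm_volterraFree_le x t).trans (half_le_self (norm_nonneg _))
    · rcases le_or_gt x 0 with hx0 | hx0
      · simpa only [volterraIterate_of_nonpos hx0, tsum_zero, norm_zero] using hM
      · refine (norm_tsum_volterraIterate_le hp x hx0 t).trans ?_
        simp only [M]
        gcongr
  · rw [mem_Icc, ← abs_le, not_le] at ht
    rw [supportedInCone_volterraSol x t ht, norm_zero]
    exact add_nonneg (norm_nonneg _) (indicator_nonneg (fun _ _ => hM) t)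

end Volterra

/-! ### The Fourier transform of the Volterra equation -/

theorem cos_eq_exp_I_mul (ρ : ℂ) (t : ℝ) : Complex.cos (ρ * t) =
    1 / 2 * (Complex.exp (Complex.I * ρ * t) + Complex.exp (-(Complex.I * ρ * t))) := by
  rw [Complex.cos]
  ring_nf

theorem sin_eq_exp_I_mul (ρ : ℂ) (t : ℝ) : Complex.sin (ρ * t) =
    -(Complex.I / 2) * (Complex.exp (Complex.I * ρ * t) - Complex.exp (-(Complex.I * ρ * t))) := by
  rw [Complex.sin]
  ring_nf

theorem intervalIntegral_mul_cos {a b : ℝ} {w : ℝ → ℂ} (hw : IntervalIntegrable w volume a b)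
    (ρ : ℂ) : ∫ t in a..b, w t * Complex.cos (ρ * t) =
      1 / 2 * ((∫ t in a..b, w t * Complex.exp (Complex.I * ρ * t)) +
        ∫ t in a..b, w t * Complex.exp (-(Complex.I * ρ * t))) := by
  rw [← intervalIntegral.integral_add (hw.mul_continuousOn (by fun_prop))
    (hw.mul_continuousOn (by fun_prop)), ← intervalIntegral.integral_const_mul]
  simp only [cos_eq_exp_I_mul, mul_add, mul_left_comm]

theorem intervalIntegral_mul_sin {a b : ℝ} {w : ℝ → ℂ} (hw : IntervalIntegrable w volume a b)
    (ρ : ℂ) : ∫ t in a..b, w t * Complex.sin (ρ * t) =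
      -(Complex.I / 2) * ((∫ t in a..b, w t * Complex.exp (Complex.I * ρ * t)) -
        ∫ t in a..b, w t * Complex.exp (-(Complex.I * ρ * t))) := by
  rw [← intervalIntegral.integral_sub (hw.mul_continuousOn (by fun_prop))
    (hw.mul_continuousOn (by fun_prop)), ← intervalIntegral.integral_const_mul]
  simp only [sin_eq_exp_I_mul, mul_sub, mul_left_comm]

/-- The Fourier transform `∫ F(x, t) e^{iρt} dt` of the slice `F(x, ·)`, for complex `ρ`. -/
noncomputable def sliceFourier (F : ℝ → ℝ → ℂ) (ρ : ℂ) (x : ℝ) : ℂ :=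
  ∫ t, F x t * Complex.exp (Complex.I * ρ * t)

section SliceFourier

variable {p : ℝ → ℂ} {F : ℝ → ℝ → ℂ} {x C : ℝ}

theorem norm_exp_I_mul_le (ρ : ℂ) (t : ℝ) :
    ‖Complex.exp (Complex.I * ρ * t)‖ ≤ Real.exp (‖ρ‖ * |t|) :=
  (Complex.norm_exp_le_exp_norm _).trans_eq (by simp)

theorem hasDerivAt_exp_I_mul (ρ : ℂ) (x : ℝ) :
    HasDerivAt (fun t : ℝ => Complex.exp (Complex.I * ρ * t))
      (Complex.exp (Complex.I * ρ * x) * (Complex.I * ρ)) x := by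
  simpa only [mul_one, id_eq] using
    ((hasDerivAt_id (x : ℂ)).const_mul (Complex.I * ρ)).cexp.comp_ofReal

theorem SupportedInCone.norm_mul_exp_le (hF : SupportedInCone F) (ρ : ℂ) (x t : ℝ) :
    ‖F x t * Complex.exp (Complex.I * ρ * t)‖ ≤ ‖F x t‖ * Real.exp (‖ρ‖ * x) := by
  rcases lt_or_ge x |t| with hxt | hxt
  · rw [hF x t hxt, zero_mul, norm_zero, zero_mul]
  · rw [norm_mul]
    gcongr
    exact (norm_exp_I_mul_le ρ t).trans (by gcongr)

theorem SupportedInCone.integrable_mul_exp (hF : SupportedInCone F) (hi : Integrable (F x))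
    (ρ : ℂ) : Integrable fun t : ℝ => F x t * Complex.exp (Complex.I * ρ * t) :=
  Integrable.mono' (hi.norm.mul_const (Real.exp (‖ρ‖ * x)))
    (hi.aestronglyMeasurable.mul
      (by fun_prop : Continuous fun t : ℝ => Complex.exp (Complex.I * ρ * t)).aestronglyMeasurable)
    (.of_forall fun t => hF.norm_mul_exp_le ρ x t)

theorem SupportedInCone.norm_sliceFourier_le (hF : SupportedInCone F) (hi : Integrable (F x))
    (ρ : ℂ) : ‖sliceFourier F ρ x‖ ≤ (∫ t, ‖F x t‖) * Real.exp (‖ρ‖ * x) := by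
  rw [← integral_mul_const]
  exact norm_integral_le_of_norm_le (hi.norm.mul_const _)
    (.of_forall fun t => hF.norm_mul_exp_le ρ x t)

theorem measurable_sliceFourier (hF : Measurable (Function.uncurry F)) (ρ : ℂ) :
    Measurable (sliceFourier F ρ) :=
  ((hF.mul (by fun_prop : Measurable fun q : ℝ × ℝ => Complex.exp (Complex.I * ρ * q.2))
    ).stronglyMeasurable.integral_prod_right' (ν := volume)).measurable

theorem integrable_prod_mul_comp_sub (hpm : Measurable p) (hp : Integrable p)
    (hFm : Measurable (Function.uncurry F)) (hi : ∀ s ∈ Ioc 0 x, Integrable (F s))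
    (hC : ∀ s ∈ Ioc 0 x, ∫ t, ‖F s t‖ ≤ C) :
    Integrable (fun q : ℝ × ℝ => p q.1 * F q.1 (x - q.1 - q.2))
      ((volume.restrict (Ioc 0 x)).prod volume) := by
  have h_meas : Measurable fun q : ℝ × ℝ => p q.1 * F q.1 (x - q.1 - q.2) :=
    (hpm.comp measurable_fst).mul
      (hFm.comp (by fun_prop : Measurable fun q : ℝ × ℝ => (q.1, x - q.1 - q.2)))
  refine (integrable_prod_iff h_meas.aestronglyMeasurable).2 ⟨?_, ?_⟩
  · filter_upwards [ae_restrict_mem measurableSet_Ioc] with s hs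
    exact ((hi s hs).comp_sub_left (x - s)).const_mul _
  · refine Integrable.mono' (hp.norm.mul_const C).integrableOn
      h_meas.norm.stronglyMeasurable.integral_prod_right'.aestronglyMeasurable ?_
    filter_upwards [ae_restrict_mem measurableSet_Ioc] with s hs
    simp only [norm_mul]
    rw [integral_const_mul, integral_sub_left_eq_self fun t => ‖F s t‖, norm_mul, norm_norm,
      Real.norm_of_nonneg (integral_nonneg fun _ => norm_nonneg _)]
    gcongr
    exact hC s hs

theorem SupportedInCone.integrable_prod_mul_exp (hF : SupportedInCone F) (hpm : Measurable p)
    (hp : Integrable p) (hFm : Measurable (Function.uncurry F))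
    (hi : ∀ s ∈ Ioc 0 x, Integrable (F s)) (hC : ∀ s ∈ Ioc 0 x, ∫ t, ‖F s t‖ ≤ C) (ρ : ℂ) :
    Integrable (fun q : ℝ × ℝ => p q.1 * F q.1 (x - q.1 - q.2) *
      Complex.exp (Complex.I * ρ * q.2)) ((volume.restrict (Ioc 0 x)).prod volume) := by
  have h_int := integrable_prod_mul_comp_sub hpm hp hFm hi hC
  refine Integrable.mono' (h_int.norm.mul_const (Real.exp (‖ρ‖ * x)))
    (h_int.aestronglyMeasurable.mul (by fun_prop : Continuous fun q : ℝ × ℝ =>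
      Complex.exp (Complex.I * ρ * q.2)).aestronglyMeasurable) ?_
  filter_upwards [Measure.quasiMeasurePreserving_fst.ae (ae_restrict_mem measurableSet_Ioc)]
    with q hq
  rcases lt_or_ge x |q.2| with hxt | hxt
  · rw [hF.apply_sub_sub_eq_zero hq.2 hxt, mul_zero, zero_mul, norm_zero, zero_mul]
  · rw [norm_mul]
    gcongr
    exact (norm_exp_I_mul_le ρ q.2).trans (by gcongr)

theorem SupportedInCone.sliceFourier_volterraOp (hF : SupportedInCone F) (hpm : Measurable p)
    (hp : Integrable p) (hFm : Measurable (Function.uncurry F))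
    (hi : ∀ s ∈ Ioc 0 x, Integrable (F s)) (hC : ∀ s ∈ Ioc 0 x, ∫ t, ‖F s t‖ ≤ C) (ρ : ℂ) :
    sliceFourier (NSBF.volterraOp p F) ρ x = ∫ s in Ioc 0 x,
      Complex.exp (Complex.I * ρ * (x - s)) * (p s * sliceFourier F (-ρ) s) := by
  simp only [sliceFourier, NSBF.volterraOp, ← integral_mul_const]
  rw [← integral_integral_swap (f := fun s t => p s * F s (x - s - t) *
    Complex.exp (Complex.I * ρ * t)) (hF.integrable_prod_mul_exp hpm hp hFm hi hC ρ)]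
  congr 1 with s
  rw [← integral_sub_left_eq_self (μ := volume) _ (x - s), ← integral_const_mul,
    ← integral_const_mul]
  congr 1 with u
  have h_exp : Complex.exp (Complex.I * ρ * ((x - s - u : ℝ) : ℂ)) =
      Complex.exp (Complex.I * ρ * (x - s)) * Complex.exp (Complex.I * -ρ * u) := by
    rw [← Complex.exp_add]
    push_cast
    ring_nf
  rw [sub_sub_cancel, h_exp]
  ring

theorem volterraFree_mul_exp (ρ : ℂ) (x t : ℝ) :
    volterraFree p x t * Complex.exp (Complex.I * ρ * t) =
      (Ioo 0 x).indicator (fun s : ℝ => Complex.exp (Complex.I * ρ * (x - s)) *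
        (p s * Complex.exp (Complex.I * -ρ * s))) ((x - t) / 2) / 2 := by
  have h_mem : (x, t) ∈ {q : ℝ × ℝ | |q.2| < q.1} ↔ (x - t) / 2 ∈ Ioo 0 x := by
    simp only [mem_ofPred_eq, mem_Ioo, abs_lt]
    constructor <;> rintro ⟨_, _⟩ <;> constructor <;> linarith
  by_cases ht : (x - t) / 2 ∈ Ioo 0 x
  · have h_exp : Complex.exp (Complex.I * ρ * t) =
        Complex.exp (Complex.I * ρ * (x - (((x - t) / 2 : ℝ) : ℂ))) *
          Complex.exp (Complex.I * -ρ * (((x - t) / 2 : ℝ) : ℂ)) := by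
      rw [← Complex.exp_add]
      push_cast
      ring_nf
    rw [volterraFree, indicator_of_mem (h_mem.2 ht), indicator_of_mem ht, h_exp]
    ring
  · rw [volterraFree, indicator_of_notMem (h_mem.not.2 ht), indicator_of_notMem ht, zero_mul,
      zero_div]

theorem integrable_comp_sub_div_two {E : Type*} [NormedAddCommGroup E] {q : ℝ → E}
    (hq : Integrable q) (x : ℝ) : Integrable fun t => q ((x - t) / 2) :=
  (hq.comp_div two_ne_zero).comp_sub_left x

theorem integral_comp_sub_div_two {E : Type*} [NormedAddCommGroup E] [NormedSpace ℝ E] (q : ℝ → E)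
    (x : ℝ) : ∫ t, q ((x - t) / 2) = (2 : ℝ) • ∫ t, q t := by
  rw [integral_sub_left_eq_self (fun u : ℝ => q (u / 2)) volume x, Measure.integral_comp_div,
    abs_two]

theorem sliceFourier_volterraFree (ρ : ℂ) (x : ℝ) :
    sliceFourier (volterraFree p) ρ x = ∫ s in Ioc 0 x,
      Complex.exp (Complex.I * ρ * (x - s)) * (p s * Complex.exp (Complex.I * -ρ * s)) := by
  simp only [sliceFourier, volterraFree_mul_exp]
  rw [integral_div, integral_comp_sub_div_two, integral_indicator measurableSet_Ioo,
    integral_Ioc_eq_integral_Ioo, Complex.real_smul, Complex.ofReal_ofNat,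
    mul_div_cancel_left₀ _ two_ne_zero]

theorem integrable_indicator_Icc_const (a b M : ℝ) :
    Integrable ((Icc a b).indicator fun _ => M) :=
  (integrable_indicator_iff measurableSet_Icc).2 (integrableOn_const measure_Icc_lt_top.ne)

theorem integrable_volterraFree (hp : IsVolterraCoefficient p) (x : ℝ) :
    Integrable (volterraFree p x) :=
  Integrable.mono' ((integrable_comp_sub_div_two hp.integrable x).norm.div_const 2)
    ((measurable_volterraFree hp.measurable).comp measurable_prodMk_left).aestronglyMeasurable
    (.of_forall fun t => norm_volterraFree_le x t)

theorem integrable_volterraSol (hp : IsVolterraCoefficient p) (x : ℝ) :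
    Integrable (volterraSol p x) := by
  obtain ⟨M, -, hM⟩ := exists_norm_volterraSol_le hp x
  exact Integrable.mono' ((integrable_comp_sub_div_two hp.integrable x).norm.add
    (integrable_indicator_Icc_const (-x) x M))
    ((measurable_volterraSol hp).comp measurable_prodMk_left).aestronglyMeasurable
    (.of_forall fun t => hM x le_rfl t)

theorem exists_integral_norm_volterraSol_le (hp : IsVolterraCoefficient p) (ℓ : ℝ) :
    ∃ C, 0 ≤ C ∧ ∀ x ∈ Icc 0 ℓ, ∫ t, ‖volterraSol p x t‖ ≤ C := by
  obtain ⟨M, hM₀, hM⟩ := exists_norm_volterraSol_le hp ℓ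
  refine ⟨2 * (∫ s, ‖p s‖) + 2 * |ℓ| * M, by positivity, fun x hx => ?_⟩
  have h_free := (integrable_comp_sub_div_two hp.integrable x).norm
  have h_bounded := integrable_indicator_Icc_const (-x) x M
  calc ∫ t, ‖volterraSol p x t‖
      ≤ ∫ t, (‖p ((x - t) / 2)‖ + (Icc (-x) x).indicator (fun _ => M) t) :=
        integral_mono (integrable_volterraSol hp x).norm (h_free.add h_bounded) (hM x hx.2)
    _ = 2 * (∫ s, ‖p s‖) + (x - -x) * M := by
        rw [integral_add h_free h_bounded, integral_comp_sub_div_two fun s => ‖p s‖,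
          integral_indicator measurableSet_Icc, setIntegral_const,
          Real.volume_real_Icc_of_le (by linarith [hx.1]), smul_eq_mul, smul_eq_mul]
    _ ≤ 2 * (∫ s, ‖p s‖) + 2 * |ℓ| * M := by
        gcongr
        linarith [hx.2, le_abs_self ℓ]

theorem sliceFourier_volterraSol (hp : IsVolterraCoefficient p) (ρ : ℂ) (x : ℝ) :
    sliceFourier (volterraSol p) ρ x = sliceFourier (volterraFree p) ρ x +
      sliceFourier (volterraOp p (volterraSol p)) ρ x := by
  have h_free := integrable_volterraFree hp x
  have h_op : Integrable (volterraOp p (volterraSol p) x) :=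
    ((integrable_volterraSol hp x).sub h_free).congr
      (.of_forall fun t => sub_eq_of_eq_add' (volterraSol_eq hp x t))
  rw [sliceFourier, sliceFourier, sliceFourier, ← integral_add
    (supportedInCone_volterraFree.integrable_mul_exp h_free ρ)
    (supportedInCone_volterraSol.volterraOp.integrable_mul_exp h_op ρ)]
  congr 1 with t
  rw [volterraSol_eq hp, add_mul]

/-- `g_p(ρ, x) = e^{iρx} + ∫ G(x, t) e^{iρt} dt`, where `G` is the solution of the Volterra
equation with coefficient `p`. -/
noncomputable def volterraExp (p : ℝ → ℂ) (ρ : ℂ) (x : ℝ) : ℂ :=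
  Complex.exp (Complex.I * ρ * x) + sliceFourier (volterraSol p) ρ x

theorem measurable_volterraExp (hp : IsVolterraCoefficient p) (ρ : ℂ) :
    Measurable (volterraExp p ρ) :=
  (by fun_prop : Measurable fun x : ℝ => Complex.exp (Complex.I * ρ * x)).add
    (measurable_sliceFourier (measurable_volterraSol hp) ρ)

theorem exists_norm_sliceFourier_volterraSol_le (hp : IsVolterraCoefficient p) (ρ : ℂ) (ℓ : ℝ) :
    ∃ D, ∀ x ∈ Icc 0 ℓ, ‖sliceFourier (volterraSol p) ρ x‖ ≤ D := by
  obtain ⟨C, hC₀, hC⟩ := exists_integral_norm_volterraSol_le hp ℓ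
  refine ⟨C * Real.exp (‖ρ‖ * ℓ), fun x hx => ?_⟩
  refine (supportedInCone_volterraSol.norm_sliceFourier_le (integrable_volterraSol hp x) ρ).trans ?_
  gcongr
  exacts [hC x hx, hx.2]

theorem exists_norm_volterraExp_le (hp : IsVolterraCoefficient p) (ρ : ℂ) (ℓ : ℝ) :
    ∃ D, ∀ x ∈ Icc 0 ℓ, ‖volterraExp p ρ x‖ ≤ D := by
  obtain ⟨D, hD⟩ := exists_norm_sliceFourier_volterraSol_le hp ρ ℓ
  refine ⟨Real.exp (‖ρ‖ * ℓ) + D, fun x hx => (norm_add_le _ _).trans ?_⟩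
  refine add_le_add ((norm_exp_I_mul_le ρ x).trans ?_) (hD x hx)
  rw [abs_of_nonneg hx.1]
  gcongr
  exact hx.2

theorem integrableOn_exp_mul_mul (hp : Integrable p) {u : ℝ → ℂ} (hu : Measurable u)
    (hC : ∀ s ∈ Icc 0 x, ‖u s‖ ≤ C) (ρ : ℂ) :
    IntegrableOn (fun s : ℝ => Complex.exp (Complex.I * ρ * (x - s)) * (p s * u s)) (Ioc 0 x) := by
  refine IntegrableOn.mono_set (IntegrableOn.continuousOn_mul (by fun_prop) ?_ isCompact_Icc)
    Ioc_subset_Icc_self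
  exact hp.integrableOn.mul_bdd hu.aestronglyMeasurable
    (ae_restrict_of_forall_mem measurableSet_Icc hC)

theorem volterraExp_eq (hp : IsVolterraCoefficient p) (ρ : ℂ) (x : ℝ) :
    volterraExp p ρ x = Complex.exp (Complex.I * ρ * x) + ∫ s in Ioc 0 x,
      Complex.exp (Complex.I * ρ * (x - s)) * (p s * volterraExp p (-ρ) s) := by
  obtain ⟨C, -, hC⟩ := exists_integral_norm_volterraSol_le hp x
  obtain ⟨D, hD⟩ := exists_norm_sliceFourier_volterraSol_le hp (-ρ) x
  have h_meas := measurable_volterraSol hp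
  have h_exp : ∀ s ∈ Icc 0 x, ‖Complex.exp (Complex.I * -ρ * s)‖ ≤ Real.exp (‖ρ‖ * x) :=
    fun s hs => (norm_exp_I_mul_le (-ρ) s).trans (by
      rw [norm_neg, abs_of_nonneg hs.1]
      gcongr
      exact hs.2)
  rw [volterraExp, sliceFourier_volterraSol hp, sliceFourier_volterraFree,
    supportedInCone_volterraSol.sliceFourier_volterraOp hp.measurable hp.integrable h_meas
      (fun s _ => integrable_volterraSol hp s) (fun s hs => hC s (Ioc_subset_Icc_self hs)),
    ← integral_add (integrableOn_exp_mul_mul hp.integrable (by fun_prop) h_exp ρ)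
      (integrableOn_exp_mul_mul hp.integrable (measurable_sliceFourier h_meas _) hD ρ)]
  simp only [volterraExp, mul_add]

theorem volterraExp_zero (hp : IsVolterraCoefficient p) (ρ : ℂ) : volterraExp p ρ 0 = 1 := by
  rw [volterraExp_eq hp, Ioc_self, setIntegral_empty, Complex.ofReal_zero, mul_zero,
    Complex.exp_zero, add_zero]

theorem volterraExp_eq_exp_mul (hp : IsVolterraCoefficient p) (ρ : ℂ) (hx : 0 ≤ x) :
    volterraExp p ρ x = Complex.exp (Complex.I * ρ * x) * (1 + ∫ s in (0 : ℝ)..x,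
      Complex.exp (-(Complex.I * ρ * s)) * (p s * volterraExp p (-ρ) s)) := by
  rw [volterraExp_eq hp, mul_add, mul_one, intervalIntegral.integral_of_le hx,
    ← integral_const_mul]
  congr 2 with s
  rw [mul_sub, sub_eq_add_neg, Complex.exp_add, mul_assoc]

theorem hasWeakDeriv_volterraExp {ℓ : ℝ} (hℓ : 0 ≤ ℓ) (hp : IsVolterraCoefficient p) (ρ : ℂ) :
    HasWeakDeriv ℓ (volterraExp p ρ)
      fun x => Complex.I * ρ * volterraExp p ρ x + p x * volterraExp p (-ρ) x := by
  obtain ⟨D, hD⟩ := exists_norm_volterraExp_le hp (-ρ) ℓ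
  let k : ℝ → ℂ := fun s => Complex.exp (-(Complex.I * ρ * s)) * (p s * volterraExp p (-ρ) s)
  have h_bdd : MemLp (volterraExp p (-ρ)) ⊤ (volume.restrict (Ioo 0 ℓ)) :=
    memLp_top_of_bound (measurable_volterraExp hp _).aestronglyMeasurable D
      (ae_restrict_Ioo_of_forall_Icc hD)
  have hk : MemLp k 2 (volume.restrict (Ioo 0 ℓ)) :=
    (h_bdd.mul (r := 2) (hp.memLp_two.restrict _)).mul (memLp_of_continuousOn_Icc ⊤ (by fun_prop))
  have h_integral : HasWeakDeriv ℓ (fun x => 1 + ∫ s in (0 : ℝ)..x, k s) k :=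
    .of_eq_integral hℓ hk fun _ _ => rfl
  have h_exp := HasWeakDeriv.of_hasDerivAt hℓ (by fun_prop) (hasDerivAt_exp_I_mul ρ)
  refine ((h_exp.mul hℓ h_integral).congr hℓ fun x hx =>
    volterraExp_eq_exp_mul hp ρ hx.1).congr_deriv (ae_restrict_Ioo_of_forall_Icc fun x hx => ?_)
  have h_cancel : Complex.exp (Complex.I * ρ * x) * Complex.exp (-(Complex.I * ρ * x)) = 1 := by
    rw [← Complex.exp_add, add_neg_cancel, Complex.exp_zero]
  simp only [volterraExp_eq_exp_mul hp ρ hx.1, k]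
  linear_combination (p x * volterraExp p (-ρ) x) * h_cancel

end SliceFourier

/-! ### The transmutation kernel -/

section TransmutationKernel

variable {p : ℝ → ℂ} {F : ℝ → ℝ → ℂ}

theorem measurableSet_triangle (ℓ : ℝ) : MeasurableSet (triangle ℓ) :=
  (measurableSet_le measurable_const measurable_fst).inter
    ((measurableSet_le measurable_fst measurable_const).inter
      (measurableSet_le measurable_snd.abs measurable_fst))

theorem volume_triangle_lt_top (ℓ : ℝ) : volume (triangle ℓ) < ⊤ := by
  have h_subset : triangle ℓ ⊆ Icc 0 ℓ ×ˢ Icc (-ℓ) ℓ := fun q hq =>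
    ⟨⟨hq.1, hq.2.1⟩, abs_le.1 (hq.2.2.trans hq.2.1)⟩
  exact (measure_mono h_subset).trans_lt (isCompact_Icc.prod isCompact_Icc).measure_lt_top

theorem memLp_comp_sub_div_two_triangle (hp : IsVolterraCoefficient p) (ℓ : ℝ) :
    MemLp (fun q : ℝ × ℝ => p ((q.1 - q.2) / 2)) 2 (volume.restrict (triangle ℓ)) := by
  have h_meas : Measurable fun q : ℝ × ℝ => p ((q.1 - q.2) / 2) :=
    hp.measurable.comp (by fun_prop)
  have h_subset : triangle ℓ ⊆ Icc 0 ℓ ×ˢ univ := fun q hq => ⟨⟨hq.1, hq.2.1⟩, mem_univ _⟩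
  rw [memLp_two_iff_integrable_sq_norm h_meas.aestronglyMeasurable]
  refine IntegrableOn.mono_set ?_ h_subset
  rw [IntegrableOn, Measure.volume_eq_prod, ← Measure.prod_restrict, Measure.restrict_univ,
    integrable_prod_iff (h_meas.norm.pow_const 2).aestronglyMeasurable]
  refine ⟨.of_forall fun x => integrable_comp_sub_div_two hp.integrable_sq x, ?_⟩
  simp only [norm_pow, norm_norm, integral_comp_sub_div_two fun s => ‖p s‖ ^ 2]
  exact integrable_const _

theorem memLp_volterraSol_triangle (hp : IsVolterraCoefficient p) (ℓ : ℝ) :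
    MemLp (fun q : ℝ × ℝ => volterraSol p q.1 q.2) 2 (volume.restrict (triangle ℓ)) := by
  have h_finite : IsFiniteMeasure (volume.restrict (triangle ℓ)) :=
    ⟨by simpa using volume_triangle_lt_top ℓ⟩
  obtain ⟨M, hM₀, hM⟩ := exists_norm_volterraSol_le hp ℓ
  refine ((memLp_comp_sub_div_two_triangle hp ℓ).norm.add (memLp_const M)).of_le
    (measurable_volterraSol hp).aestronglyMeasurable ?_
  filter_upwards [ae_restrict_mem (measurableSet_triangle ℓ)] with q hq
  refine (hM q.1 hq.2.1 q.2).trans (le_trans ?_ (le_abs_self _))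
  exact add_le_add le_rfl (indicator_le_self' (fun _ _ => hM₀) _)

theorem measurePreserving_reflect_triangle (ℓ : ℝ) :
    MeasurePreserving (fun q : ℝ × ℝ => (q.1, -q.2)) (volume.restrict (triangle ℓ))
      (volume.restrict (triangle ℓ)) := by
  have h_reflect : MeasurePreserving (fun q : ℝ × ℝ => (q.1, -q.2)) :=
    (MeasurePreserving.id volume).prod (Measure.measurePreserving_neg volume)
  have h_preimage : (fun q : ℝ × ℝ => (q.1, -q.2)) ⁻¹' triangle ℓ = triangle ℓ := by
    simp only [triangle, preimage_ofPred_eq, abs_neg]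
  simpa only [h_preimage] using h_reflect.restrict_preimage (measurableSet_triangle ℓ)

theorem memLp_volterraSol (hp : IsVolterraCoefficient p) (x : ℝ) : MemLp (volterraSol p x) 2 := by
  have h_meas : Measurable fun t => p ((x - t) / 2) := hp.measurable.comp (by fun_prop)
  have h_free : MemLp (fun t => p ((x - t) / 2)) 2 :=
    (memLp_two_iff_integrable_sq_norm h_meas.aestronglyMeasurable).2
      (integrable_comp_sub_div_two hp.integrable_sq x)
  obtain ⟨M, -, hM⟩ := exists_norm_volterraSol_le hp x
  refine (h_free.norm.add (memLp_indicator_const 2 (measurableSet_Icc (a := -x) (b := x)) M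
    (.inr measure_Icc_lt_top.ne))).of_le
    ((measurable_volterraSol hp).comp measurable_prodMk_left).aestronglyMeasurable
    (.of_forall fun t => (hM x le_rfl t).trans (le_abs_self _))

theorem sliceFourier_reflect (F : ℝ → ℝ → ℂ) (ρ : ℂ) (x : ℝ) :
    sliceFourier (fun x t => F x (-t)) ρ x = sliceFourier F (-ρ) x := by
  rw [sliceFourier, sliceFourier, ← integral_neg_eq_self]
  congr 1 with t
  rw [neg_neg, Complex.ofReal_neg, mul_neg, mul_neg, neg_mul]

theorem SupportedInCone.reflect (hF : SupportedInCone F) : SupportedInCone fun x t => F x (-t) :=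
  fun x t hxt => hF x (-t) (by rwa [abs_neg])

theorem SupportedInCone.intervalIntegral_mul_exp (hF : SupportedInCone F) (ρ : ℂ) (x : ℝ) :
    ∫ t in (-x)..x, F x t * Complex.exp (Complex.I * ρ * t) = sliceFourier F ρ x := by
  rcases lt_or_ge x 0 with hx | hx
  · have h_zero (t : ℝ) : F x t = 0 := hF x t (hx.trans_le (abs_nonneg t))
    simp only [sliceFourier, h_zero, zero_mul, intervalIntegral.integral_zero, integral_zero]
  · rw [intervalIntegral.integral_of_le (neg_le_self hx), ← integral_Icc_eq_integral_Ioc]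
    refine setIntegral_eq_integral_of_forall_compl_eq_zero fun t ht => ?_
    rw [mem_Icc, ← abs_le, not_le] at ht
    rw [hF x t ht, zero_mul]

/-- The transmutation kernel of a nonvanishing solution `f` with `f'/f = p`. The signs are those
for which the Fourier transform satisfies the initial conditions `y(0) = 1`, `D_f y(0) = iρ`. -/
noncomputable def transmutationKernel (p : ℝ → ℂ) (x t : ℝ) : ℂ :=
  1 / 2 * (volterraSol p x t + volterraSol (-p) x t +
    (volterraSol p x (-t) - volterraSol (-p) x (-t)))

theorem supportedInCone_transmutationKernel : SupportedInCone (transmutationKernel p) :=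
  fun x t hxt => by
    have hxt' : x < |-t| := by rwa [abs_neg]
    simp only [transmutationKernel, supportedInCone_volterraSol x _ hxt,
      supportedInCone_volterraSol x _ hxt', add_zero, sub_zero, mul_zero]

theorem sliceFourier_transmutationKernel (hp : IsVolterraCoefficient p) (ρ : ℂ) (x : ℝ) :
    sliceFourier (transmutationKernel p) ρ x =
      1 / 2 * (sliceFourier (volterraSol p) ρ x + sliceFourier (volterraSol (-p)) ρ x +
        (sliceFourier (volterraSol p) (-ρ) x - sliceFourier (volterraSol (-p)) (-ρ) x)) := by
  have h_int {p : ℝ → ℂ} (hp : IsVolterraCoefficient p) :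
      Integrable fun t : ℝ => volterraSol p x t * Complex.exp (Complex.I * ρ * t) :=
    supportedInCone_volterraSol.integrable_mul_exp (integrable_volterraSol hp x) ρ
  have h_int_reflect {p : ℝ → ℂ} (hp : IsVolterraCoefficient p) :
      Integrable fun t : ℝ => volterraSol p x (-t) * Complex.exp (Complex.I * ρ * t) :=
    supportedInCone_volterraSol.reflect.integrable_mul_exp
      (F := fun x t => volterraSol p x (-t)) (integrable_volterraSol hp x).comp_neg ρ
  rw [← sliceFourier_reflect, ← sliceFourier_reflect]
  simp only [sliceFourier]
  rw [← integral_add (h_int hp) (h_int hp.neg),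
    ← integral_sub (h_int_reflect hp) (h_int_reflect hp.neg),
    ← integral_add (by exact (h_int hp).add (h_int hp.neg))
      (by exact (h_int_reflect hp).sub (h_int_reflect hp.neg)), ← integral_const_mul]
  congr 1 with t
  rw [transmutationKernel]
  ring

variable {ℓ : ℝ} {σ f : ℝ → ℂ}

theorem isCauchySystem_of_coupled {ρ : ℂ} {y₁ y₂ : ℝ → ℂ}
    (hp : ∀ᵐ x ∂(volume.restrict (Ioo 0 ℓ)), p x = deriv f x / f x)
    (h₁ : HasWeakDeriv ℓ y₁ fun x => Complex.I * ρ * y₁ x + p x * y₂ x)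
    (h₂ : HasWeakDeriv ℓ y₂ fun x => -(Complex.I * ρ * y₂ x) + p x * y₁ x) :
    IsCauchySystem ℓ f (ρ ^ 2) ((y₁ 0 + y₂ 0) / 2) (Complex.I * ρ * (y₁ 0 - y₂ 0) / 2)
      (fun x => (1 / 2) * y₁ x + (1 / 2) * y₂ x)
      fun x => Complex.I * ρ / 2 * y₁ x + -(Complex.I * ρ / 2) * y₂ x where
  hasWeakDeriv_fst := (h₁.linearComb h₂ _ _).congr_deriv <| by
    filter_upwards [hp] with x hpx
    rw [← hpx]
    ring
  hasWeakDeriv_snd := (h₁.linearComb h₂ _ _).congr_deriv <| by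
    filter_upwards [hp] with x hpx
    rw [← hpx]
    linear_combination (ρ ^ 2 * (y₁ x + y₂ x) / 2) * Complex.I_sq
  fst_zero := by ring
  snd_zero := by ring

theorem isCauchySolution_volterraExp (hℓ : 0 ≤ ℓ) (hf : IsNonvanishingSolution ℓ σ f)
    (hp : IsVolterraCoefficient p)
    (hpf : ∀ᵐ x ∂(volume.restrict (Ioo 0 ℓ)), p x = deriv f x / f x) (ρ : ℂ) :
    IsCauchySolution ℓ σ f (ρ ^ 2) 1 (Complex.I * ρ) fun x =>
      1 / 2 * (1 * volterraExp p ρ x + 1 * volterraExp (-p) ρ x) +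
        1 / 2 * (1 * volterraExp p (-ρ) x + -1 * volterraExp (-p) (-ρ) x) := by
  have h_plus := hasWeakDeriv_volterraExp hℓ hp
  have h_minus := hasWeakDeriv_volterraExp hℓ hp.neg
  have h_sum := ((h_plus ρ).linearComb (h_minus ρ) 1 1).congr_deriv
    (h := fun x => Complex.I * ρ * (1 * volterraExp p ρ x + 1 * volterraExp (-p) ρ x) +
      p x * (1 * volterraExp p (-ρ) x + -1 * volterraExp (-p) (-ρ) x))
    (.of_forall fun x => by simp only [Pi.neg_apply]; ring)
  have h_diff := ((h_plus (-ρ)).linearComb (h_minus (-ρ)) 1 (-1)).congr_deriv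
    (h := fun x => -(Complex.I * ρ * (1 * volterraExp p (-ρ) x + -1 * volterraExp (-p) (-ρ) x)) +
      p x * (1 * volterraExp p ρ x + 1 * volterraExp (-p) ρ x))
    (.of_forall fun x => by simp only [Pi.neg_apply, neg_neg]; ring)
  convert (isCauchySystem_of_coupled hpf h_sum h_diff).isCauchySolution hℓ hf using 1 <;>
  · simp only [volterraExp_zero hp, volterraExp_zero hp.neg]
    ring

theorem isTransmutationKernel_transmutationKernel (hℓ : 0 ≤ ℓ)
    (hf : IsNonvanishingSolution ℓ σ f) (hp : IsVolterraCoefficient p)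
    (hpf : ∀ᵐ x ∂(volume.restrict (Ioo 0 ℓ)), p x = deriv f x / f x) :
    IsTransmutationKernel ℓ σ f (transmutationKernel p) where
  memLp := by
    have h_mem {p : ℝ → ℂ} (hp : IsVolterraCoefficient p) := memLp_volterraSol_triangle hp ℓ
    have h_reflect {p : ℝ → ℂ} (hp : IsVolterraCoefficient p) :=
      (h_mem hp).comp_measurePreserving (measurePreserving_reflect_triangle ℓ)
    exact (((h_mem hp).add (h_mem hp.neg)).add
      ((h_reflect hp).sub (h_reflect hp.neg))).const_mul (1 / 2)
  memLp_slice x _ := by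
    have h_mem {p : ℝ → ℂ} (hp : IsVolterraCoefficient p) := memLp_volterraSol hp x
    have h_reflect {p : ℝ → ℂ} (hp : IsVolterraCoefficient p) :=
      (h_mem hp).comp_measurePreserving (Measure.measurePreserving_neg volume)
    exact ((((h_mem hp).add (h_mem hp.neg)).add
      ((h_reflect hp).sub (h_reflect hp.neg))).const_mul (1 / 2)).restrict _
  represents ρ := by
    convert isCauchySolution_volterraExp hℓ hf hp hpf ρ using 2 with x
    rw [supportedInCone_transmutationKernel.intervalIntegral_mul_exp,
      sliceFourier_transmutationKernel hp]
    simp only [volterraExp]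
    ring

theorem exists_isTransmutationKernel (hℓ : 0 ≤ ℓ) (hf : IsNonvanishingSolution ℓ σ f) :
    ∃ K, IsTransmutationKernel ℓ σ f K := by
  have h_memW12 : MemW12 ℓ f := hf.isSolution.1
  have h_quot : MemLp (fun x => deriv f x * (f x)⁻¹) 2 (volume.restrict (Ioo 0 ℓ)) :=
    memLp_mul_continuousOn_Icc h_memW12.2 ((h_memW12.continuousOn hℓ).inv₀ hf.ne_zero)
  set p : ℝ → ℂ := (Ioo 0 ℓ).indicator (h_quot.1.mk _)
  have h_mk : MemLp (h_quot.1.mk _) 2 (volume.restrict (Ioo 0 ℓ)) := h_quot.ae_eq h_quot.1.ae_eq_mk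
  have h_meas : Measurable p :=
    h_quot.1.stronglyMeasurable_mk.measurable.indicator measurableSet_Ioo
  have hp : IsVolterraCoefficient p :=
    { measurable := h_meas
      integrable := (integrable_indicator_iff measurableSet_Ioo).2
        (h_mk.integrable one_le_two)
      integrable_sq := (memLp_two_iff_integrable_sq_norm h_meas.aestronglyMeasurable).1
        ((memLp_indicator_iff_restrict measurableSet_Ioo).2 h_mk) }
  refine ⟨_, isTransmutationKernel_transmutationKernel hℓ hf hp ?_⟩
  filter_upwards [h_quot.1.ae_eq_mk, ae_restrict_mem measurableSet_Ioo] with x hx hx_mem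
  rw [div_eq_mul_inv, hx]
  exact indicator_of_mem hx_mem _

end TransmutationKernel

section KernelRepresentation

variable {ℓ : ℝ} {σ f c s : ℝ → ℂ} {K : ℝ → ℝ → ℂ} {ρ : ℂ} {x : ℝ}

theorem IsTransmutationKernel.exists_isCauchySolution_cosine (hℓ : 0 < ℓ)
    (hf : IsNonvanishingSolution ℓ σ f) (hK : IsTransmutationKernel ℓ σ f K) (ρ : ℂ) :
    ∃ y, IsCauchySolution ℓ σ f (ρ ^ 2) 1 0 y := by
  have h_neg := hK.represents (-ρ)
  rw [neg_sq] at h_neg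
  have h_comb := (hK.represents ρ).linearComb hℓ hf h_neg (1 / 2) (1 / 2)
  rw [mul_one, add_halves, mul_neg, mul_neg, add_neg_cancel] at h_comb
  exact ⟨_, h_comb⟩

theorem IsTransmutationKernel.exists_isCauchySolution_sine (hℓ : 0 < ℓ)
    (hf : IsNonvanishingSolution ℓ σ f) (hK : IsTransmutationKernel ℓ σ f K) (ρ : ℂ) :
    ∃ y, IsCauchySolution ℓ σ f (ρ ^ 2) 0 1 y := by
  rcases eq_or_ne ρ 0 with rfl | hρ
  · simpa using exists_isCauchySolution_zero_zero_one hℓ.le hf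
  have h_neg := hK.represents (-ρ)
  rw [neg_sq] at h_neg
  have h_coeff : 1 / (2 * Complex.I * ρ) * (Complex.I * ρ) +
      -(1 / (2 * Complex.I * ρ)) * (Complex.I * -ρ) = 1 := by
    have := Complex.I_ne_zero
    field_simp
    ring
  have h_comb := (hK.represents ρ).linearComb hℓ hf h_neg (1 / (2 * Complex.I * ρ))
    (-(1 / (2 * Complex.I * ρ)))
  rw [mul_one, mul_one, add_neg_cancel, h_coeff] at h_comb
  exact ⟨_, h_comb⟩

theorem IsTransmutationKernel.intervalIntegrable (hK : IsTransmutationKernel ℓ σ f K)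
    (hx : x ∈ Ioc 0 ℓ) : IntervalIntegrable (K x) volume (-x) x :=
  intervalIntegrable_of_memLp (neg_le_self hx.1.le) one_le_two (hK.memLp_slice x hx)

theorem IsTransmutationKernel.exp_add_integral_eq (hℓ : 0 < ℓ)
    (hf : IsNonvanishingSolution ℓ σ f) (hK : IsTransmutationKernel ℓ σ f K)
    (hc : IsCauchySolution ℓ σ f (ρ ^ 2) 1 0 c) (hs : IsCauchySolution ℓ σ f (ρ ^ 2) 0 1 s)
    (hx : x ∈ Icc 0 ℓ) :
    Complex.exp (Complex.I * ρ * x) + ∫ t in (-x)..x, K x t * Complex.exp (Complex.I * ρ * t) =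
      c x + Complex.I * ρ * s x := by
  have h_comb := hc.linearComb hℓ hf hs 1 (Complex.I * ρ)
  simp only [mul_zero, mul_one, one_mul, add_zero, zero_add] at h_comb
  exact (hK.represents ρ).unique hℓ hf h_comb hx

theorem IsTransmutationKernel.exp_neg_add_integral_eq (hℓ : 0 < ℓ)
    (hf : IsNonvanishingSolution ℓ σ f) (hK : IsTransmutationKernel ℓ σ f K)
    (hc : IsCauchySolution ℓ σ f (ρ ^ 2) 1 0 c) (hs : IsCauchySolution ℓ σ f (ρ ^ 2) 0 1 s)
    (hx : x ∈ Icc 0 ℓ) :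
    Complex.exp (-(Complex.I * ρ * x)) +
      ∫ t in (-x)..x, K x t * Complex.exp (-(Complex.I * ρ * t)) = c x - Complex.I * ρ * s x := by
  rw [← neg_sq] at hc hs
  simpa only [mul_neg, neg_mul, ← sub_eq_add_neg] using hK.exp_add_integral_eq hℓ hf hc hs hx

theorem IsTransmutationKernel.cosine_eq (hℓ : 0 < ℓ) (hf : IsNonvanishingSolution ℓ σ f)
    (hK : IsTransmutationKernel ℓ σ f K) (hc : IsCauchySolution ℓ σ f (ρ ^ 2) 1 0 c)
    (hs : IsCauchySolution ℓ σ f (ρ ^ 2) 0 1 s) (hx : x ∈ Ioc 0 ℓ) :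
    c x = Complex.cos (ρ * x) + ∫ t in (-x)..x, K x t * Complex.cos (ρ * t) := by
  have h_pos := hK.exp_add_integral_eq hℓ hf hc hs (Ioc_subset_Icc_self hx)
  have h_neg := hK.exp_neg_add_integral_eq hℓ hf hc hs (Ioc_subset_Icc_self hx)
  rw [intervalIntegral_mul_cos (hK.intervalIntegrable hx), cos_eq_exp_I_mul]
  linear_combination -(1 / 2) * (h_pos + h_neg)

theorem IsTransmutationKernel.mul_sine_eq (hℓ : 0 < ℓ) (hf : IsNonvanishingSolution ℓ σ f)
    (hK : IsTransmutationKernel ℓ σ f K) (hc : IsCauchySolution ℓ σ f (ρ ^ 2) 1 0 c)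
    (hs : IsCauchySolution ℓ σ f (ρ ^ 2) 0 1 s) (hx : x ∈ Ioc 0 ℓ) :
    ρ * s x = Complex.sin (ρ * x) + ∫ t in (-x)..x, K x t * Complex.sin (ρ * t) := by
  have h_pos := hK.exp_add_integral_eq hℓ hf hc hs (Ioc_subset_Icc_self hx)
  have h_neg := hK.exp_neg_add_integral_eq hℓ hf hc hs (Ioc_subset_Icc_self hx)
  rw [intervalIntegral_mul_sin (hK.intervalIntegrable hx), sin_eq_exp_I_mul]
  linear_combination (Complex.I / 2) * (h_pos - h_neg) + (ρ * s x) * Complex.I_sq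

end KernelRepresentation

/-! ### Legendre polynomials and Rodrigues' formula -/

theorem intervalIntegral_iterate_derivative_mul (P : ℝ[X]) {a b : ℝ} {m : ℕ}
    (ha : ∀ j < m, (Polynomial.derivative^[j] P).eval a = 0)
    (hb : ∀ j < m, (Polynomial.derivative^[j] P).eval b = 0) {g : ℕ → ℝ → ℂ}
    (hg : ∀ i t, HasDerivAt (g i) (g (i + 1) t) t) :
    ∫ t in a..b, (((Polynomial.derivative^[m] P).eval t : ℝ) : ℂ) * g 0 t =
      (-1) ^ m * ∫ t in a..b, ((P.eval t : ℝ) : ℂ) * g m t := by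
  induction m generalizing g with
  | zero => simp
  | succ m ih =>
    set Q := Polynomial.derivative^[m] P
    have h_cont (i : ℕ) : Continuous (g i) :=
      continuous_iff_continuousAt.2 fun t => (hg i t).continuousAt
    have h_parts := intervalIntegral.integral_mul_deriv_eq_deriv_mul (a := a) (b := b)
      (fun t _ => (Q.hasDerivAt t).ofReal_comp) (fun t _ => hg 0 t)
      ((Complex.continuous_ofReal.comp Q.derivative.continuous).intervalIntegrable _ _)
      ((h_cont 1).intervalIntegrable _ _)
    rw [ha m m.lt_succ_self, hb m m.lt_succ_self, ih (fun j hj => ha j (hj.trans m.lt_succ_self))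
      (fun j hj => hb j (hj.trans m.lt_succ_self)) (g := fun i => g (i + 1))
      (fun i t => hg (i + 1) t)] at h_parts
    simp only [Complex.ofReal_zero, zero_mul, sub_zero, zero_sub] at h_parts
    rw [Function.iterate_succ_apply', show Polynomial.derivative^[m] P = Q from rfl, pow_succ]
    linear_combination h_parts

theorem eval_iterate_derivative_sq_sub_one_pow {m j : ℕ} (h : j < m) {a : ℝ} (ha : a ^ 2 = 1) :
    (Polynomial.derivative^[j] ((Polynomial.X ^ 2 - 1 : ℝ[X]) ^ m)).eval a = 0 := by
  obtain ⟨q, hq⟩ := Polynomial.pow_sub_dvd_iterate_derivative_pow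
    (Polynomial.X ^ 2 - 1 : ℝ[X]) m j
  rw [hq]
  simp [ha, Nat.sub_ne_zero_of_lt h]

theorem integral_legendreP_mul (m : ℕ) {g : ℕ → ℝ → ℂ}
    (hg : ∀ i t, HasDerivAt (g i) (g (i + 1) t) t) :
    ∫ t in (-1 : ℝ)..1, (((legendreP m).eval t : ℝ) : ℂ) * g 0 t =
      (2 ^ m * (m.factorial : ℂ))⁻¹ *
        ∫ t in (-1 : ℝ)..1, (((1 - t ^ 2) ^ m : ℝ) : ℂ) * g m t := by
  have h_sign (t : ℝ) :
      ((((Polynomial.X ^ 2 - 1 : ℝ[X]) ^ m).eval t : ℝ) : ℂ) * g m t =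
        (-1) ^ m * ((((1 - t ^ 2) ^ m : ℝ) : ℂ) * g m t) := by
    rw [← neg_sub (t ^ 2) 1]
    push_cast [Polynomial.eval_pow, Polynomial.eval_sub, Polynomial.eval_X, Polynomial.eval_one]
    rw [← mul_assoc, ← mul_pow, neg_one_mul, neg_neg]
  simp only [legendreP, Polynomial.eval_mul, Polynomial.eval_C, Complex.ofReal_mul, mul_assoc]
  rw [intervalIntegral.integral_const_mul, intervalIntegral_iterate_derivative_mul _
    (fun j hj => eval_iterate_derivative_sq_sub_one_pow hj (by norm_num))
    (fun j hj => eval_iterate_derivative_sq_sub_one_pow hj (by norm_num)) hg]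
  simp only [h_sign]
  rw [intervalIntegral.integral_const_mul, ← mul_assoc ((-1) ^ m), ← mul_pow, neg_one_mul, neg_neg,
    one_pow, one_mul]
  push_cast
  rfl

theorem integral_one_sub_sq_pow_mul_pow (m k : ℕ) :
    ∫ t in (-1 : ℝ)..1, (1 - t ^ 2) ^ m * t ^ (2 * k) =
      Real.Gamma (k + 1 / 2) * m.factorial / Real.Gamma (k + m + 3 / 2) := by
  induction m generalizing k with
  | zero =>
    have h_pos : (0 : ℝ) < k + 1 / 2 := by positivity
    rw [show (k : ℝ) + (0 : ℕ) + 3 / 2 = (k + 1 / 2) + 1 by push_cast; ring,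
      Real.Gamma_add_one h_pos.ne']
    simp only [pow_zero, one_mul, integral_pow, one_pow, Nat.factorial_zero, Nat.cast_one]
    rw [Odd.neg_one_pow ⟨k, rfl⟩]
    push_cast
    field_simp
    ring
  | succ m ih =>
    have h_split (t : ℝ) : (1 - t ^ 2) ^ (m + 1) * t ^ (2 * k) =
        (1 - t ^ 2) ^ m * t ^ (2 * k) - (1 - t ^ 2) ^ m * t ^ (2 * (k + 1)) := by ring
    have h_integrable (j : ℕ) :
        IntervalIntegrable (fun t : ℝ => (1 - t ^ 2) ^ m * t ^ (2 * j)) volume (-1) 1 :=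
      Continuous.intervalIntegrable (by fun_prop) _ _
    have h_num : (0 : ℝ) < k + 1 / 2 := by positivity
    have h_den : (0 : ℝ) < k + m + 3 / 2 := by positivity
    simp only [h_split]
    rw [intervalIntegral.integral_sub (h_integrable k) (h_integrable (k + 1)), ih, ih,
      show ((k + 1 : ℕ) : ℝ) + 1 / 2 = (k + 1 / 2) + 1 by push_cast; ring,
      show ((k + 1 : ℕ) : ℝ) + m + 3 / 2 = (k + m + 3 / 2) + 1 by push_cast; ring,
      show (k : ℝ) + (m + 1 : ℕ) + 3 / 2 = (k + m + 3 / 2) + 1 by push_cast; ring,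
      Real.Gamma_add_one h_num.ne', Real.Gamma_add_one h_den.ne', Nat.factorial_succ]
    push_cast
    field_simp
    ring

theorem Gamma_natCast_add_half (k : ℕ) :
    Real.Gamma (k + 1 / 2) = (2 * k).factorial * √Real.pi / (4 ^ k * k.factorial) := by
  induction k with
  | zero => simpa using Real.Gamma_one_half_eq
  | succ k ih =>
    have h_pos : (0 : ℝ) < k + 1 / 2 := by positivity
    rw [show ((k + 1 : ℕ) : ℝ) + 1 / 2 = (k + 1 / 2) + 1 by push_cast; ring,
      Real.Gamma_add_one h_pos.ne', ih, show 2 * (k + 1) = 2 * k + 1 + 1 by ring,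
      Nat.factorial_succ, Nat.factorial_succ, Nat.factorial_succ]
    push_cast
    field_simp
    ring

/-! ### Spherical Bessel functions as Fourier transforms of Legendre polynomials -/

theorem hasSum_intervalIntegral_mul_cos {a b : ℝ} {w : ℝ → ℂ}
    (hw : IntervalIntegrable w volume a b) (z : ℂ) :
    HasSum (fun k : ℕ => (-1) ^ k * z ^ (2 * k) / ((2 * k).factorial : ℂ) *
        ∫ t in a..b, w t * (t : ℂ) ^ (2 * k))
      (∫ t in a..b, w t * Complex.cos (z * t)) := by
  have h_summable : Summable fun k : ℕ =>
      (‖z‖ * max |a| |b|) ^ (2 * k) / ((2 * k).factorial : ℝ) :=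
    (Real.summable_pow_div_factorial _).comp_injective (mul_right_injective₀ two_ne_zero)
  have h_series := intervalIntegral.hasSum_integral_of_dominated_convergence (a := a) (b := b)
    (F := fun (k : ℕ) (t : ℝ) => w t * ((-1) ^ k * (z * t) ^ (2 * k) / ((2 * k).factorial : ℂ)))
    (f := fun t : ℝ => w t * Complex.cos (z * t))
    (fun k t => ‖w t‖ * ((‖z‖ * max |a| |b|) ^ (2 * k) / ((2 * k).factorial : ℝ)))
    (fun k => hw.aestronglyMeasurable_restrict_uIoc.mul
      (Continuous.aestronglyMeasurable (by fun_prop)))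
    (fun k => .of_forall fun t ht => ?_)
    (.of_forall fun t _ => h_summable.mul_left _)
    (by simpa only [tsum_mul_left] using hw.norm.mul_const _)
    (.of_forall fun t _ => (Complex.hasSum_cos (z * t)).mul_left _)
  · refine h_series.congr_fun fun k => ?_
    rw [← intervalIntegral.integral_const_mul]
    congr 1 with t
    ring
  · have h_abs : |t| ≤ max |a| |b| := by
      rcases le_total a b with hab | hba
      · rw [uIoc_of_le hab] at ht
        exact abs_le_max_abs_abs ht.1.le ht.2
      · rw [uIoc_of_ge hba] at ht
        exact (abs_le_max_abs_abs ht.1.le ht.2).trans_eq (max_comm _ _)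
    simp only [norm_mul, norm_div, norm_pow, norm_neg, norm_one, one_pow, one_mul,
      Complex.norm_natCast, Complex.norm_real, Real.norm_eq_abs]
    gcongr

theorem pow_mul_integral_one_sub_sq_pow_mul_cos (m : ℕ) (z : ℂ) :
    z ^ m * ∫ t in (-1 : ℝ)..1, (((1 - t ^ 2) ^ m : ℝ) : ℂ) * Complex.cos (z * t) =
      2 ^ (m + 1) * m.factorial * sphericalBesselJ m z := by
  have h_term (k : ℕ) : z ^ m * ((-1) ^ k * z ^ (2 * k) / ((2 * k).factorial : ℂ) *
      ∫ t in (-1 : ℝ)..1, (((1 - t ^ 2) ^ m : ℝ) : ℂ) * (t : ℂ) ^ (2 * k)) =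
      2 ^ (m + 1) * m.factorial * ((√Real.pi / 2 : ℝ) *
        ((-1) ^ k / ((k.factorial : ℂ) * Complex.Gamma (k + m + 3 / 2)) *
          (z / 2) ^ (2 * k + m))) := by
    have h_moment := congrArg Complex.ofReal (integral_one_sub_sq_pow_mul_pow m k)
    have h_Gamma : Complex.Gamma (k + m + 3 / 2) = ((Real.Gamma (k + m + 3 / 2) : ℝ) : ℂ) := by
      rw [← Complex.Gamma_ofReal]
      push_cast
      rfl
    have h_Gamma_ne : ((Real.Gamma (k + m + 3 / 2) : ℝ) : ℂ) ≠ 0 :=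
      Complex.ofReal_ne_zero.2 (Real.Gamma_pos_of_pos (by positivity)).ne'
    rw [← intervalIntegral.integral_ofReal, Gamma_natCast_add_half] at h_moment
    simp only [Complex.ofReal_mul, Complex.ofReal_pow (_ : ℝ) (2 * k)] at h_moment
    rw [h_moment, h_Gamma]
    have h_two_k : ((2 * k).factorial : ℂ) ≠ 0 := Nat.cast_ne_zero.2 (Nat.factorial_ne_zero _)
    have h_k : (k.factorial : ℂ) ≠ 0 := Nat.cast_ne_zero.2 (Nat.factorial_ne_zero _)
    push_cast
    rw [div_pow, pow_add (2 : ℂ) (2 * k) m, pow_mul (2 : ℂ) 2 k, show (2 : ℂ) ^ 2 = 4 by norm_num]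
    field_simp
    ring
  have h_weight : IntervalIntegrable (fun t : ℝ => (((1 - t ^ 2) ^ m : ℝ) : ℂ)) volume (-1) 1 :=
    Continuous.intervalIntegrable (by fun_prop) _ _
  rw [← (hasSum_intervalIntegral_mul_cos h_weight z).tsum_eq, sphericalBesselJ, ← tsum_mul_left,
    ← tsum_mul_left, ← tsum_mul_left]
  exact tsum_congr h_term

theorem intervalIntegral_mul_exp_of_even {w : ℝ → ℂ} {a : ℝ}
    (hw : IntervalIntegrable w volume (-a) a) (h_even : Function.Even w) (z : ℂ) :
    ∫ t in (-a)..a, w t * Complex.exp (Complex.I * z * t) =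
      ∫ t in (-a)..a, w t * Complex.cos (z * t) := by
  have h_reflect := intervalIntegral.integral_comp_neg (a := -a) (b := a)
    (fun t : ℝ => w t * Complex.exp (Complex.I * z * t))
  simp only [h_even _, Complex.ofReal_neg, mul_neg, neg_neg] at h_reflect
  rw [intervalIntegral_mul_cos hw, h_reflect]
  ring

theorem integral_legendreP_mul_exp (m : ℕ) (z : ℂ) :
    ∫ t in (-1 : ℝ)..1, (((legendreP m).eval t : ℝ) : ℂ) * Complex.exp (Complex.I * z * t) =
      2 * Complex.I ^ m * sphericalBesselJ m z := by
  have h_rodrigues := integral_legendreP_mul m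
    (g := fun i t => (Complex.I * z) ^ i * Complex.exp (Complex.I * z * t)) fun i t =>
      ((hasDerivAt_exp_I_mul z t).const_mul ((Complex.I * z) ^ i)).congr_deriv (by ring)
  have h_even : Function.Even fun t : ℝ => (((1 - t ^ 2) ^ m : ℝ) : ℂ) := fun t => by
    simp only [neg_sq]
  have h_weight : IntervalIntegrable (fun t : ℝ => (((1 - t ^ 2) ^ m : ℝ) : ℂ)) volume (-1) 1 :=
    Continuous.intervalIntegrable (by fun_prop) _ _
  simp only [pow_zero, one_mul, mul_left_comm _ ((Complex.I * z) ^ m)] at h_rodrigues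
  rw [h_rodrigues, intervalIntegral.integral_const_mul,
    intervalIntegral_mul_exp_of_even h_weight h_even, mul_pow, mul_assoc (Complex.I ^ m),
    pow_mul_integral_one_sub_sq_pow_mul_cos, pow_succ]
  have h_factorial : (m.factorial : ℂ) ≠ 0 := Nat.cast_ne_zero.2 (Nat.factorial_ne_zero _)
  field_simp

theorem sphericalBesselJ_neg (m : ℕ) (z : ℂ) :
    sphericalBesselJ m (-z) = (-1) ^ m * sphericalBesselJ m z := by
  rw [sphericalBesselJ, sphericalBesselJ, mul_left_comm, ← tsum_mul_left (a := (-1 : ℂ) ^ m)]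
  congr 2 with k
  rw [neg_div, neg_pow (z / 2), pow_add (-1 : ℂ), pow_mul (-1 : ℂ), neg_one_sq, one_pow]
  ring

theorem continuous_legendreP_scaled (m : ℕ) (x : ℝ) :
    Continuous fun t : ℝ => (((legendreP m).eval (t / x) : ℝ) : ℂ) :=
  Complex.continuous_ofReal.comp ((legendreP m).continuous.comp (continuous_id.div_const x))

theorem integral_legendreP_scaled (m : ℕ) {x : ℝ} (hx : x ≠ 0) (g : ℝ → ℂ) :
    ∫ t in (-x)..x, (((legendreP m).eval (t / x) : ℝ) : ℂ) * g t =
      x * ∫ t in (-1 : ℝ)..1, (((legendreP m).eval t : ℝ) : ℂ) * g (x * t) := by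
  have h_subst := intervalIntegral.smul_integral_comp_mul_left (a := (-1 : ℝ)) (b := 1)
    (fun t : ℝ => (((legendreP m).eval (t / x) : ℝ) : ℂ) * g t) x
  simpa only [mul_div_cancel_left₀ _ hx, mul_neg_one, mul_one, Complex.real_smul]
    using h_subst.symm

theorem integral_legendreP_scaled_mul_exp (m : ℕ) {x : ℝ} (hx : x ≠ 0) (ρ : ℂ) :
    ∫ t in (-x)..x, (((legendreP m).eval (t / x) : ℝ) : ℂ) * Complex.exp (Complex.I * ρ * t) =
      x * (2 * Complex.I ^ m * sphericalBesselJ m (ρ * x)) := by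
  rw [integral_legendreP_scaled m hx, ← integral_legendreP_mul_exp]
  simp only [Complex.ofReal_mul, mul_assoc]

theorem integral_legendreP_scaled_mul_exp_neg (m : ℕ) {x : ℝ} (hx : x ≠ 0) (ρ : ℂ) :
    ∫ t in (-x)..x, (((legendreP m).eval (t / x) : ℝ) : ℂ) * Complex.exp (-(Complex.I * ρ * t)) =
      x * (2 * Complex.I ^ m * ((-1) ^ m * sphericalBesselJ m (ρ * x))) := by
  rw [← sphericalBesselJ_neg, ← neg_mul, ← integral_legendreP_scaled_mul_exp m hx]
  simp only [mul_neg, neg_mul]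

theorem integral_legendreP_scaled_mul_cos (m : ℕ) {x : ℝ} (hx : x ≠ 0) (ρ : ℂ) :
    ∫ t in (-x)..x, (((legendreP m).eval (t / x) : ℝ) : ℂ) * Complex.cos (ρ * t) =
      x * (Complex.I ^ m * (1 + (-1) ^ m) * sphericalBesselJ m (ρ * x)) := by
  rw [intervalIntegral_mul_cos ((continuous_legendreP_scaled m x).intervalIntegrable _ _),
    integral_legendreP_scaled_mul_exp m hx, integral_legendreP_scaled_mul_exp_neg m hx]
  ring

theorem integral_legendreP_scaled_mul_sin (m : ℕ) {x : ℝ} (hx : x ≠ 0) (ρ : ℂ) :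
    ∫ t in (-x)..x, (((legendreP m).eval (t / x) : ℝ) : ℂ) * Complex.sin (ρ * t) =
      x * (-Complex.I * Complex.I ^ m * (1 - (-1) ^ m) * sphericalBesselJ m (ρ * x)) := by
  rw [intervalIntegral_mul_sin ((continuous_legendreP_scaled m x).intervalIntegrable _ _),
    integral_legendreP_scaled_mul_exp m hx, integral_legendreP_scaled_mul_exp_neg m hx]
  ring

/-! ### Degrees and orthogonality of the Legendre polynomials -/

theorem coeff_legendreP_self (m : ℕ) :
    (legendreP m).coeff m = (2 * m).factorial / (2 ^ m * (m.factorial : ℝ) ^ 2) := by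
  have h_monic : (Polynomial.X ^ 2 - 1 : ℝ[X]).Monic :=
    Polynomial.monic_X_pow_sub_C 1 two_ne_zero
  have h_natDegree : ((Polynomial.X ^ 2 - 1 : ℝ[X]) ^ m).natDegree = m + m := by
    rw [h_monic.natDegree_pow, ← Polynomial.C_1, Polynomial.natDegree_X_pow_sub_C, mul_two]
  have h_coeff := (h_monic.pow m).coeff_natDegree
  rw [h_natDegree] at h_coeff
  rw [legendreP, Polynomial.coeff_C_mul, Polynomial.coeff_iterate_derivative, h_coeff, ← two_mul,
    nsmul_eq_mul, mul_one, Nat.descFactorial_eq_div (by omega), show 2 * m - m = m by omega,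
    Nat.cast_div (Nat.factorial_dvd_factorial (by omega)) (by positivity)]
  field_simp

theorem natDegree_legendreP (m : ℕ) : (legendreP m).natDegree = m := by
  refine Polynomial.natDegree_eq_of_le_of_coeff_ne_zero ?_ ?_
  · have h_le : ((Polynomial.X ^ 2 - 1 : ℝ[X]) ^ m).natDegree ≤ m * 2 :=
      Polynomial.natDegree_pow_le_of_le m (Polynomial.natDegree_X_pow_sub_C (r := 1)).le
    exact (Polynomial.natDegree_C_mul_le _ _).trans
      ((Polynomial.natDegree_iterate_derivative _ _).trans (by omega))
  · rw [coeff_legendreP_self]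
    positivity

theorem legendreP_ne_zero (m : ℕ) : legendreP m ≠ 0 := fun h_zero => by
  have h_coeff : (legendreP m).coeff m ≠ 0 := by
    rw [coeff_legendreP_self]
    positivity
  exact h_coeff (by rw [h_zero, Polynomial.coeff_zero])

theorem span_range_legendreP : Submodule.span ℝ (Set.range legendreP) = ⊤ := by
  let legendreSequence : Polynomial.Sequence ℝ := ⟨legendreP, fun i => by
    rw [Polynomial.degree_eq_natDegree (legendreP_ne_zero i), natDegree_legendreP]⟩
  exact legendreSequence.span fun i =>
    (Polynomial.leadingCoeff_ne_zero.2 (legendreSequence.ne_zero i)).isUnit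

theorem integral_legendreP_mul_polynomial (m : ℕ) (Q : ℝ[X]) :
    ∫ t in (-1 : ℝ)..1, (((legendreP m).eval t : ℝ) : ℂ) * (Q.eval t : ℝ) =
      (2 ^ m * (m.factorial : ℂ))⁻¹ * ∫ t in (-1 : ℝ)..1, (((1 - t ^ 2) ^ m : ℝ) : ℂ) *
        ((Polynomial.derivative^[m] Q).eval t : ℝ) :=
  integral_legendreP_mul m (g := fun i t => ((Polynomial.derivative^[i] Q).eval t : ℝ))
    fun i t => by
      rw [Function.iterate_succ_apply']
      exact ((Polynomial.derivative^[i] Q).hasDerivAt t).ofReal_comp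

theorem integral_legendreP_mul_of_natDegree_lt {m : ℕ} {Q : ℝ[X]} (hQ : Q.natDegree < m) :
    ∫ t in (-1 : ℝ)..1, (((legendreP m).eval t : ℝ) : ℂ) * (Q.eval t : ℝ) = 0 := by
  simp [integral_legendreP_mul_polynomial, Polynomial.iterate_derivative_eq_zero hQ]

theorem integral_legendreP_mul_legendreP_of_ne {m n : ℕ} (hmn : m ≠ n) :
    ∫ t in (-1 : ℝ)..1, (((legendreP m).eval t : ℝ) : ℂ) * ((legendreP n).eval t : ℝ) = 0 := by
  rcases lt_or_gt_of_ne hmn with h_lt | h_gt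
  · simp only [mul_comm (((legendreP m).eval _ : ℝ) : ℂ)]
    exact integral_legendreP_mul_of_natDegree_lt (by rwa [natDegree_legendreP])
  · exact integral_legendreP_mul_of_natDegree_lt (by rwa [natDegree_legendreP])

theorem iterate_derivative_legendreP_self (m : ℕ) :
    Polynomial.derivative^[m] (legendreP m) =
      Polynomial.C ((2 * m).factorial / (2 ^ m * (m.factorial : ℝ))) := by
  have h_natDegree := Polynomial.natDegree_iterate_derivative (legendreP m) m
  rw [natDegree_legendreP, Nat.sub_self] at h_natDegree
  rw [Polynomial.eq_C_of_natDegree_le_zero h_natDegree, Polynomial.coeff_iterate_derivative,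
    zero_add, Nat.descFactorial_self, nsmul_eq_mul, coeff_legendreP_self]
  congr 1
  field_simp

theorem integral_one_sub_sq_pow (m : ℕ) :
    ∫ t in (-1 : ℝ)..1, (1 - t ^ 2 : ℝ) ^ m =
      (2 * (2 ^ m * m.factorial) ^ 2 / ((2 * m + 1) * (2 * m).factorial) : ℝ) := by
  have h_moment := integral_one_sub_sq_pow_mul_pow m 0
  have h_pos : (0 : ℝ) < m + 1 / 2 := by positivity
  have h_pi : √Real.pi ≠ 0 := (Real.sqrt_pos.2 Real.pi_pos).ne'
  simp only [mul_zero, pow_zero, mul_one, Nat.cast_zero, zero_add] at h_moment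
  rw [h_moment, Real.Gamma_one_half_eq, show (m : ℝ) + 3 / 2 = (m + 1 / 2) + 1 by ring,
    Real.Gamma_add_one h_pos.ne', Gamma_natCast_add_half, mul_pow, ← pow_mul, mul_comm m 2,
    pow_mul, show (2 : ℝ) ^ 2 = 4 by norm_num]
  field_simp

theorem integral_legendreP_mul_self (m : ℕ) :
    ∫ t in (-1 : ℝ)..1, (((legendreP m).eval t : ℝ) : ℂ) * ((legendreP m).eval t : ℝ) =
      2 / (2 * m + 1) := by
  rw [integral_legendreP_mul_polynomial, iterate_derivative_legendreP_self]
  simp only [Polynomial.eval_C]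
  rw [intervalIntegral.integral_mul_const, intervalIntegral.integral_ofReal,
    integral_one_sub_sq_pow]
  have h_two_m : ((2 * m).factorial : ℂ) ≠ 0 := Nat.cast_ne_zero.2 (Nat.factorial_ne_zero _)
  have h_m : (m.factorial : ℂ) ≠ 0 := Nat.cast_ne_zero.2 (Nat.factorial_ne_zero _)
  push_cast
  field_simp

/-! ### Functions orthogonal to polynomials -/

theorem integral_continuousOn_mul_eq_zero_of_polynomial {a b : ℝ} {g : ℝ → ℂ}
    (hg : IntegrableOn g (Ioo a b))
    (h_poly : ∀ Q : ℝ[X], ∫ t in Ioo a b, ((Q.eval t : ℝ) : ℂ) * g t = 0) {φ : ℝ → ℝ}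
    (hφ : ContinuousOn φ (Icc a b)) : ∫ t in Ioo a b, (φ t : ℂ) * g t = 0 := by
  have h_integrable {u : ℝ → ℝ} (hu : ContinuousOn u (Icc a b)) :
      Integrable (fun t => (u t : ℂ) * g t) (volume.restrict (Ioo a b)) := by
    simp only [mul_comm _ (g _)]
    exact memLp_one_iff_integrable.1 (memLp_mul_continuousOn_Icc (memLp_one_iff_integrable.2 hg)
      (Complex.continuous_ofReal.comp_continuousOn hu))
  have h_bound (δ : ℝ) (hδ : 0 < δ) :
      ‖∫ t in Ioo a b, (φ t : ℂ) * g t‖ ≤ δ * ∫ t in Ioo a b, ‖g t‖ := by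
    obtain ⟨Q, hQ⟩ := exists_polynomial_near_of_continuousOn a b φ hφ δ hδ
    rw [← sub_zero (∫ t in Ioo a b, _), ← h_poly Q, ← integral_sub (h_integrable hφ)
      (h_integrable Q.continuous.continuousOn), ← integral_const_mul]
    refine norm_integral_le_of_norm_le (hg.norm.const_mul δ)
      (ae_restrict_Ioo_of_forall_Icc fun t ht => ?_)
    rw [← sub_mul, norm_mul, ← Complex.ofReal_sub, Complex.norm_real, Real.norm_eq_abs,
      abs_sub_comm]
    exact mul_le_mul_of_nonneg_right (hQ t ht).le (norm_nonneg _)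
  have h_lim : Tendsto (fun δ : ℝ => δ * ∫ t in Ioo a b, ‖g t‖) (𝓝[>] 0) (𝓝 0) :=
    tendsto_nhdsWithin_of_tendsto_nhds
      (by simpa using (tendsto_id (α := ℝ) (x := 𝓝 0)).mul_const (∫ t in Ioo a b, ‖g t‖))
  exact norm_le_zero_iff.1 (ge_of_tendsto h_lim (eventually_mem_nhdsWithin.mono h_bound))

theorem ae_eq_zero_of_integral_polynomial_mul_eq_zero {a b : ℝ} {g : ℝ → ℂ}
    (hg : IntegrableOn g (Ioo a b))
    (h_poly : ∀ Q : ℝ[X], ∫ t in Ioo a b, ((Q.eval t : ℝ) : ℂ) * g t = 0) :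
    g =ᵐ[volume.restrict (Ioo a b)] 0 := by
  refine (ae_restrict_iff' measurableSet_Ioo).2
    (isOpen_Ioo.ae_eq_zero_of_integral_contDiff_smul_eq_zero hg.locallyIntegrableOn
      fun φ hφ _ h_support => ?_)
  rw [← setIntegral_eq_integral_of_forall_compl_eq_zero (s := Ioo a b) fun t ht => by
    rw [image_eq_zero_of_notMem_tsupport (fun h_mem => ht (h_support h_mem)), zero_smul]]
  simp only [Complex.real_smul]
  exact integral_continuousOn_mul_eq_zero_of_polynomial hg h_poly hφ.continuous.continuousOn

/-! ### The space `L²` -/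

section L2

variable {α : Type*} [MeasurableSpace α] {μ : Measure α} {g h : α → ℂ}

theorem inner_toLp_toLp (hg : MemLp g 2 μ) (hh : MemLp h 2 μ) :
    inner ℂ hg.toLp hh.toLp = ∫ t, starRingEnd ℂ (g t) * h t ∂μ := by
  rw [L2.inner_def]
  refine integral_congr_ae ?_
  filter_upwards [hg.coeFn_toLp, hh.coeFn_toLp] with t hgt hht
  rw [hgt, hht, RCLike.inner_apply, mul_comm]

theorem norm_toLp_eq_sqrt (hg : MemLp g 2 μ) : ‖hg.toLp‖ = √(∫ t, ‖g t‖ ^ 2 ∂μ) := by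
  rw [Lp.norm_toLp, hg.eLpNorm_eq_integral_rpow_norm two_ne_zero ENNReal.ofNat_ne_top,
    ENNReal.toReal_ofReal (by positivity), Real.sqrt_eq_rpow]
  norm_num

theorem norm_integral_mul_le_sqrt_mul_sqrt (hg : MemLp g 2 μ) (hh : MemLp h 2 μ) :
    ‖∫ t, g t * h t ∂μ‖ ≤ √(∫ t, ‖g t‖ ^ 2 ∂μ) * √(∫ t, ‖h t‖ ^ 2 ∂μ) := by
  have h_inner := norm_inner_le_norm (𝕜 := ℂ) hg.star.toLp hh.toLp
  simpa only [inner_toLp_toLp, norm_toLp_eq_sqrt, Pi.star_apply, norm_star, starRingEnd_apply,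
    star_star] using h_inner

end L2

/-! ### Fourier–Legendre series -/

/-- The polynomials `√((m + 1/2)/x) P_m(t/x)`, which form an orthonormal basis of `L²(-x,x)`. -/
noncomputable def normalizedLegendre (x : ℝ) (m : ℕ) (t : ℝ) : ℂ :=
  √((m + 1 / 2) / x) * ((legendreP m).eval (t / x) : ℝ)

theorem continuous_normalizedLegendre (x : ℝ) (m : ℕ) : Continuous (normalizedLegendre x m) :=
  continuous_const.mul (continuous_legendreP_scaled m x)

theorem conj_normalizedLegendre (x : ℝ) (m : ℕ) (t : ℝ) :
    starRingEnd ℂ (normalizedLegendre x m t) = normalizedLegendre x m t := by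
  simp [normalizedLegendre]

theorem memLp_normalizedLegendre (x : ℝ) (m : ℕ) :
    MemLp (normalizedLegendre x m) 2 (volume.restrict (Ioo (-x) x)) :=
  memLp_of_continuousOn_Icc 2 (continuous_normalizedLegendre x m).continuousOn

/-- The normalized Legendre polynomials as elements of `L²(-x,x)`. -/
noncomputable def legendreL2 (x : ℝ) (m : ℕ) : Lp ℂ 2 (volume.restrict (Ioo (-x) x)) :=
  (memLp_normalizedLegendre x m).toLp

section

variable {x : ℝ}

theorem sqrt_mul_sqrt_normalization (hx : 0 < x) (m : ℕ) :
    (√((m + 1 / 2) / x) : ℂ) * √((m + 1 / 2) / x) = (m + 1 / 2) / x := by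
  rw [← Complex.ofReal_mul, Real.mul_self_sqrt (by positivity)]
  push_cast
  rfl

theorem inner_legendreL2_toLp (hx : 0 < x) {g : ℝ → ℂ}
    (hg : MemLp g 2 (volume.restrict (Ioo (-x) x))) (m : ℕ) :
    inner ℂ (legendreL2 x m) hg.toLp =
      √((m + 1 / 2) / x) * ∫ t in (-x)..x, (((legendreP m).eval (t / x) : ℝ) : ℂ) * g t := by
  rw [legendreL2, inner_toLp_toLp, intervalIntegral_eq_setIntegral_Ioo (neg_le_self hx.le),
    ← integral_const_mul]
  simp only [conj_normalizedLegendre]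
  simp only [normalizedLegendre, mul_assoc]

theorem inner_legendreL2_legendreL2 (hx : 0 < x) (m n : ℕ) :
    inner ℂ (legendreL2 x m) (legendreL2 x n) =
      √((m + 1 / 2) / x) * √((n + 1 / 2) / x) * (x *
        ∫ t in (-1 : ℝ)..1, (((legendreP m).eval t : ℝ) : ℂ) * ((legendreP n).eval t : ℝ)) := by
  rw [legendreL2, legendreL2, ← legendreL2, inner_legendreL2_toLp hx,
    integral_legendreP_scaled m hx.ne']
  simp only [normalizedLegendre, mul_div_cancel_left₀ _ hx.ne',
    mul_left_comm _ (√((n + 1 / 2) / x) : ℂ)]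
  rw [intervalIntegral.integral_const_mul]
  ring

theorem orthonormal_legendreL2 (hx : 0 < x) : Orthonormal ℂ (legendreL2 x) := by
  rw [orthonormal_iff_ite]
  intro m n
  rw [inner_legendreL2_legendreL2 hx]
  split_ifs with hmn
  · subst hmn
    have h_ne : (m : ℂ) * 2 + 1 ≠ 0 := mod_cast (m * 2).succ_ne_zero
    have hx' : (x : ℂ) ≠ 0 := mod_cast hx.ne'
    rw [sqrt_mul_sqrt_normalization hx, integral_legendreP_mul_self, mul_comm 2 (m : ℂ)]
    field_simp
  · rw [integral_legendreP_mul_legendreP_of_ne hmn, mul_zero, mul_zero]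

theorem integral_polynomial_scaled_mul_eq_zero {g : ℝ → ℂ}
    (hg : MemLp g 2 (volume.restrict (Ioo (-x) x)))
    (h_orth : ∀ m, ∫ t in Ioo (-x) x, (((legendreP m).eval (t / x) : ℝ) : ℂ) * g t = 0)
    (Q : ℝ[X]) : ∫ t in Ioo (-x) x, ((Q.eval (t / x) : ℝ) : ℂ) * g t = 0 := by
  have h_integrable (Q : ℝ[X]) : Integrable (fun t => ((Q.eval (t / x) : ℝ) : ℂ) * g t)
      (volume.restrict (Ioo (-x) x)) :=
    (memLp_of_continuousOn_Icc 2 (Complex.continuous_ofReal.comp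
      (Q.continuous.comp (continuous_id.div_const x))).continuousOn).integrable_mul hg
  have hQ : Q ∈ Submodule.span ℝ (range legendreP) := span_range_legendreP ▸ Submodule.mem_top
  induction hQ using Submodule.span_induction with
  | mem _ hq =>
    obtain ⟨m, rfl⟩ := hq
    exact h_orth m
  | zero => simp
  | add p q _ _ hp hq =>
    simp only [Polynomial.eval_add, Complex.ofReal_add, add_mul]
    rw [integral_add (h_integrable p) (h_integrable q), hp, hq, add_zero]
  | smul c q _ hq =>
    simp only [Polynomial.eval_smul, smul_eq_mul, Complex.ofReal_mul, mul_assoc]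
    rw [integral_const_mul, hq, mul_zero]

theorem ae_eq_zero_of_integral_legendreP_eq_zero (hx : 0 < x) {g : ℝ → ℂ}
    (hg : MemLp g 2 (volume.restrict (Ioo (-x) x)))
    (h_orth : ∀ m, ∫ t in Ioo (-x) x, (((legendreP m).eval (t / x) : ℝ) : ℂ) * g t = 0) :
    g =ᵐ[volume.restrict (Ioo (-x) x)] 0 := by
  refine ae_eq_zero_of_integral_polynomial_mul_eq_zero (hg.integrable one_le_two) fun Q => ?_
  have h_comp (t : ℝ) : (Q.comp (Polynomial.C x * Polynomial.X)).eval (t / x) = Q.eval t := by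
    rw [Polynomial.eval_comp, Polynomial.eval_C_mul, Polynomial.eval_X, mul_div_cancel₀ _ hx.ne']
  rw [← integral_polynomial_scaled_mul_eq_zero hg h_orth
    (Q.comp (Polynomial.C x * Polynomial.X))]
  congr 1 with t
  rw [h_comp]

theorem orthogonal_span_legendreL2 (hx : 0 < x) :
    (Submodule.span ℂ (range (legendreL2 x)))ᗮ = ⊥ := by
  refine (Submodule.eq_bot_iff _).2 fun Y hY => ?_
  refine Lp.ext ((ae_eq_zero_of_integral_legendreP_eq_zero hx (Lp.memLp Y) fun m => ?_).trans
    (Lp.coeFn_zero _ _ _).symm)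
  have h_inner := Submodule.inner_right_of_mem_orthogonal
    (Submodule.subset_span (mem_range_self m)) hY
  rw [← Lp.toLp_coeFn Y (Lp.memLp Y), inner_legendreL2_toLp hx,
    intervalIntegral_eq_setIntegral_Ioo (neg_le_self hx.le)] at h_inner
  have h_sqrt : 0 < √((m + 1 / 2) / x) := Real.sqrt_pos.2 (by positivity)
  exact (mul_eq_zero.1 h_inner).resolve_left (mod_cast h_sqrt.ne')

/-- The Hilbert basis of `L²(-x,x)` given by the normalized Legendre polynomials. -/
noncomputable def legendreBasis (hx : 0 < x) :
    HilbertBasis ℕ ℂ (Lp ℂ 2 (volume.restrict (Ioo (-x) x))) :=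
  .mkOfOrthogonalEqBot (orthonormal_legendreL2 hx) (orthogonal_span_legendreL2 hx)

theorem legendreBasis_apply (hx : 0 < x) (m : ℕ) : legendreBasis hx m = legendreL2 x m := by
  rw [legendreBasis, HilbertBasis.coe_mkOfOrthogonalEqBot]

variable {K : ℝ → ℝ → ℂ}

theorem inner_legendreL2_mul_normalizedLegendre (hx : 0 < x)
    (hK : MemLp (K x) 2 (volume.restrict (Ioo (-x) x))) (m : ℕ) (t : ℝ) :
    inner ℂ (legendreL2 x m) hK.toLp * normalizedLegendre x m t =
      legendreCoeff K m x / x * ((legendreP m).eval (t / x) : ℝ) := by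
  rw [inner_legendreL2_toLp hx hK, normalizedLegendre, legendreCoeff]
  simp only [mul_comm (K x _)]
  linear_combination (∫ t in (-x)..x, (((legendreP m).eval (t / x) : ℝ) : ℂ) * K x t) *
    ((legendreP m).eval (t / x) : ℝ) * sqrt_mul_sqrt_normalization hx m

theorem hasSum_legendreCoeff_mul_integral (hx : 0 < x)
    (hK : MemLp (K x) 2 (volume.restrict (Ioo (-x) x))) {h : ℝ → ℂ} (hh : Continuous h) :
    HasSum (fun m : ℕ => legendreCoeff K m x / x *
        ∫ t in (-x)..x, (((legendreP m).eval (t / x) : ℝ) : ℂ) * h t)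
      (∫ t in (-x)..x, K x t * h t) := by
  have h_conj : MemLp (fun t => starRingEnd ℂ (h t)) 2 (volume.restrict (Ioo (-x) x)) :=
    memLp_of_continuousOn_Icc 2 (Complex.continuous_conj.comp hh).continuousOn
  have h_parseval := (legendreBasis hx).hasSum_inner_mul_inner h_conj.toLp hK.toLp
  have h_term (m : ℕ) : inner ℂ h_conj.toLp (legendreL2 x m) * inner ℂ (legendreL2 x m) hK.toLp =
      legendreCoeff K m x / x *
        ∫ t in (-x)..x, (((legendreP m).eval (t / x) : ℝ) : ℂ) * h t := by
    rw [intervalIntegral_eq_setIntegral_Ioo (neg_le_self hx.le), ← integral_const_mul,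
      legendreL2, inner_toLp_toLp, ← legendreL2, ← integral_mul_const]
    congr 1 with t
    rw [Complex.conj_conj, mul_assoc, mul_comm (normalizedLegendre x m t),
      inner_legendreL2_mul_normalizedLegendre hx hK]
    ring
  simp only [legendreBasis_apply, h_term, inner_toLp_toLp h_conj hK, Complex.conj_conj,
    mul_comm (h _) (K x _)] at h_parseval
  rwa [intervalIntegral_eq_setIntegral_Ioo (neg_le_self hx.le)]

theorem continuous_kernelPartial (K : ℝ → ℝ → ℂ) (N : ℕ) (x : ℝ) :
    Continuous (kernelPartial K N x) :=
  continuous_finsetSum _ fun m _ => continuous_const.mul (continuous_legendreP_scaled m x)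

theorem memLp_sub_kernelPartial (hK : MemLp (K x) 2 (volume.restrict (Ioo (-x) x))) (N : ℕ) :
    MemLp (fun t => K x t - kernelPartial K N x t) 2 (volume.restrict (Ioo (-x) x)) :=
  hK.sub (memLp_of_continuousOn_Icc 2 (continuous_kernelPartial K N x).continuousOn)

theorem coeFn_sum_legendreBasis_repr (hx : 0 < x)
    (hK : MemLp (K x) 2 (volume.restrict (Ioo (-x) x))) (N : ℕ) :
    ⇑(∑ m ∈ Finset.range (N + 1), (legendreBasis hx).repr hK.toLp m • legendreBasis hx m)
      =ᵐ[volume.restrict (Ioo (-x) x)] kernelPartial K N x := by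
  have h_term (m : ℕ) : ⇑((legendreBasis hx).repr hK.toLp m • legendreBasis hx m)
      =ᵐ[volume.restrict (Ioo (-x) x)]
        fun t => legendreCoeff K m x / x * ((legendreP m).eval (t / x) : ℝ) := by
    rw [HilbertBasis.repr_apply_apply, legendreBasis_apply]
    filter_upwards [Lp.coeFn_smul (inner ℂ (legendreL2 x m) hK.toLp) (legendreL2 x m),
      (memLp_normalizedLegendre x m).coeFn_toLp] with t h_smul h_toLp
    rw [h_smul, Pi.smul_apply, smul_eq_mul, legendreL2, h_toLp, ← legendreL2,
      inner_legendreL2_mul_normalizedLegendre hx hK]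
  filter_upwards [Lp.coeFn_finsetSum (Finset.range (N + 1)) fun m =>
    (legendreBasis hx).repr hK.toLp m • legendreBasis hx m, ae_all_iff.2 h_term] with t h_sum h_eq
  rw [h_sum, Finset.sum_apply, kernelPartial]
  exact Finset.sum_congr rfl fun m _ => h_eq m

theorem tendsto_kernelError (hx : 0 < x)
    (hK : MemLp (K x) 2 (volume.restrict (Ioo (-x) x))) :
    Tendsto (fun N => kernelError K N x) atTop (𝓝 0) := by
  have h_sum := ((legendreBasis hx).hasSum_repr hK.toLp).tendsto_sum_nat.comp
    (tendsto_add_atTop_nat 1)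
  have h_norm := (h_sum.const_sub hK.toLp).norm
  rw [sub_self, norm_zero] at h_norm
  refine h_norm.congr fun N => ?_
  rw [kernelError, intervalIntegral_eq_setIntegral_Ioo (neg_le_self hx.le),
    ← norm_toLp_eq_sqrt (memLp_sub_kernelPartial hK N)]
  congr 1
  refine Lp.ext ?_
  filter_upwards [coeFn_sum_legendreBasis_repr hx hK N, Lp.coeFn_sub hK.toLp
    (∑ m ∈ Finset.range (N + 1), (legendreBasis hx).repr hK.toLp m • legendreBasis hx m),
    hK.coeFn_toLp, (memLp_sub_kernelPartial hK N).coeFn_toLp] with t h_partial h_sub hKt h_diff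
  rw [h_diff, Function.comp_apply, h_sub, Pi.sub_apply, h_partial, hKt]

end

/-! ### Partial sums and series -/

theorem sum_range_even {M : Type*} [AddCommMonoid M] {c : ℕ → M} (hc : ∀ n, c (2 * n + 1) = 0)
    (N : ℕ) :
    ∑ m ∈ Finset.range (N + 1), c m = ∑ n ∈ Finset.range (N / 2 + 1), c (2 * n) := by
  induction N with
  | zero => simp
  | succ N ih =>
    rw [Finset.sum_range_succ, ih]
    rcases Nat.even_or_odd' N with ⟨k, rfl | rfl⟩
    · rw [hc, add_zero, show (2 * k + 1) / 2 = k by lia, show 2 * k / 2 = k by lia]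
    · rw [show (2 * k + 1) / 2 = k by lia, show (2 * k + 1 + 1) / 2 = k + 1 by lia,
        Finset.sum_range_succ _ (k + 1), mul_add_one]

theorem sum_range_odd {M : Type*} [AddCommMonoid M] {c : ℕ → M} (hc : ∀ n, c (2 * n) = 0)
    {N : ℕ} (hN : 1 ≤ N) :
    ∑ m ∈ Finset.range (N + 1), c m =
      ∑ n ∈ Finset.range ((N - 1) / 2 + 1), c (2 * n + 1) := by
  obtain ⟨n, rfl⟩ := Nat.exists_eq_add_of_le' hN
  rw [Finset.sum_range_succ', hc 0, add_zero, Nat.add_sub_cancel]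
  exact sum_range_even (c := fun m => c (m + 1)) (fun k => hc (k + 1)) n

section Series

variable {K : ℝ → ℝ → ℂ} {x : ℝ}

theorem integral_kernelPartial_mul (K : ℝ → ℝ → ℂ) (N : ℕ) (x : ℝ) {h : ℝ → ℂ}
    (hh : Continuous h) :
    ∫ t in (-x)..x, kernelPartial K N x t * h t = ∑ m ∈ Finset.range (N + 1),
      legendreCoeff K m x / x * ∫ t in (-x)..x, (((legendreP m).eval (t / x) : ℝ) : ℂ) * h t := by
  simp only [kernelPartial, Finset.sum_mul, mul_assoc]
  rw [intervalIntegral.integral_finsetSum]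
  · simp only [intervalIntegral.integral_const_mul]
  · exact fun m _ => (continuous_const.mul
      ((continuous_legendreP_scaled m x).mul hh)).intervalIntegrable _ _

theorem legendreCoeff_mul_integral_cos_even (hx : x ≠ 0) (n : ℕ) (ρ : ℂ) :
    legendreCoeff K (2 * n) x / x *
      ∫ t in (-x)..x, (((legendreP (2 * n)).eval (t / x) : ℝ) : ℂ) * Complex.cos (ρ * t) =
    (-1) ^ n * alphaCoeff K (2 * n) x * sphericalBesselJ (2 * n) (ρ * x) := by
  have hxc : (x : ℂ) ≠ 0 := Complex.ofReal_ne_zero.2 hx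
  rw [integral_legendreP_scaled_mul_cos _ hx, alphaCoeff, pow_mul, pow_mul, Complex.I_sq]
  field_simp
  ring

theorem legendreCoeff_mul_integral_cos_odd (hx : x ≠ 0) (n : ℕ) (ρ : ℂ) :
    legendreCoeff K (2 * n + 1) x / x *
      ∫ t in (-x)..x, (((legendreP (2 * n + 1)).eval (t / x) : ℝ) : ℂ) * Complex.cos (ρ * t) =
    0 := by
  rw [integral_legendreP_scaled_mul_cos _ hx, pow_succ (-1 : ℂ), pow_mul]
  ring

theorem legendreCoeff_mul_integral_sin_odd (hx : x ≠ 0) (n : ℕ) (ρ : ℂ) :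
    legendreCoeff K (2 * n + 1) x / x *
      ∫ t in (-x)..x, (((legendreP (2 * n + 1)).eval (t / x) : ℝ) : ℂ) * Complex.sin (ρ * t) =
    (-1) ^ n * alphaCoeff K (2 * n + 1) x * sphericalBesselJ (2 * n + 1) (ρ * x) := by
  have hxc : (x : ℂ) ≠ 0 := Complex.ofReal_ne_zero.2 hx
  have h_I_pow : -Complex.I * Complex.I ^ (2 * n + 1) = (-1) ^ n := by
    rw [pow_succ, pow_mul, Complex.I_sq]
    linear_combination (-(-1 : ℂ) ^ n) * Complex.I_sq
  rw [integral_legendreP_scaled_mul_sin _ hx, alphaCoeff, h_I_pow, pow_succ, pow_mul]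
  field_simp
  ring

theorem legendreCoeff_mul_integral_sin_even (hx : x ≠ 0) (n : ℕ) (ρ : ℂ) :
    legendreCoeff K (2 * n) x / x *
      ∫ t in (-x)..x, (((legendreP (2 * n)).eval (t / x) : ℝ) : ℂ) * Complex.sin (ρ * t) =
    0 := by
  rw [integral_legendreP_scaled_mul_sin _ hx, pow_mul (-1 : ℂ)]
  ring

theorem cosPartial_eq (K : ℝ → ℝ → ℂ) (hx : x ≠ 0) (N : ℕ) (ρ : ℂ) :
    cosPartial K N ρ x = Complex.cos (ρ * x) +
      ∫ t in (-x)..x, kernelPartial K N x t * Complex.cos (ρ * t) := by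
  rw [cosPartial, integral_kernelPartial_mul K N x (by fun_prop), sum_range_even
    (fun n => legendreCoeff_mul_integral_cos_odd hx n ρ) N]
  simp only [legendreCoeff_mul_integral_cos_even hx]

theorem mul_sinPartial_eq (K : ℝ → ℝ → ℂ) (hx : x ≠ 0) {N : ℕ} (hN : 1 ≤ N) (ρ : ℂ) :
    ρ * sinPartial K N ρ x = Complex.sin (ρ * x) +
      ∫ t in (-x)..x, kernelPartial K N x t * Complex.sin (ρ * t) := by
  rcases eq_or_ne ρ 0 with rfl | hρ
  · simp
  rw [sinPartial, integral_kernelPartial_mul K N x (by fun_prop), sum_range_odd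
    (fun n => legendreCoeff_mul_integral_sin_even hx n ρ) hN]
  simp only [legendreCoeff_mul_integral_sin_odd hx]
  field_simp

theorem hasSum_cos_series (hx : 0 < x) (hK : MemLp (K x) 2 (volume.restrict (Ioo (-x) x)))
    (ρ : ℂ) : HasSum (fun n : ℕ => (-1) ^ n * alphaCoeff K (2 * n) x *
      sphericalBesselJ (2 * n) (ρ * x)) (∫ t in (-x)..x, K x t * Complex.cos (ρ * t)) := by
  have h_sum := hasSum_legendreCoeff_mul_integral hx hK
    (h := fun t : ℝ => Complex.cos (ρ * t)) (by fun_prop)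
  have h_inj : Function.Injective fun n : ℕ => 2 * n := mul_right_injective₀ two_ne_zero
  rw [← h_inj.hasSum_iff] at h_sum
  · exact h_sum.congr_fun fun n => (legendreCoeff_mul_integral_cos_even hx.ne' n ρ).symm
  · intro m hm
    rcases Nat.even_or_odd' m with ⟨k, rfl | rfl⟩
    · exact absurd ⟨k, rfl⟩ hm
    · exact legendreCoeff_mul_integral_cos_odd hx.ne' k ρ

theorem hasSum_sin_series (hx : 0 < x) (hK : MemLp (K x) 2 (volume.restrict (Ioo (-x) x)))
    (ρ : ℂ) : HasSum (fun n : ℕ => (-1) ^ n * alphaCoeff K (2 * n + 1) x *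
      sphericalBesselJ (2 * n + 1) (ρ * x)) (∫ t in (-x)..x, K x t * Complex.sin (ρ * t)) := by
  have h_sum := hasSum_legendreCoeff_mul_integral hx hK
    (h := fun t : ℝ => Complex.sin (ρ * t)) (by fun_prop)
  have h_inj : Function.Injective fun n : ℕ => 2 * n + 1 :=
    (add_left_injective 1).comp (mul_right_injective₀ two_ne_zero)
  rw [← h_inj.hasSum_iff] at h_sum
  · exact h_sum.congr_fun fun n => (legendreCoeff_mul_integral_sin_odd hx.ne' n ρ).symm
  · intro m hm
    rcases Nat.even_or_odd' m with ⟨k, rfl | rfl⟩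
    · exact legendreCoeff_mul_integral_sin_even hx.ne' k ρ
    · exact absurd ⟨k, rfl⟩ hm

end Series

/-! ### Bounds in a strip -/

theorem norm_exp_mul_I_add_norm_exp_neg_mul_I (z : ℂ) :
    ‖Complex.exp (z * Complex.I)‖ + ‖Complex.exp (-z * Complex.I)‖ = 2 * Real.cosh z.im := by
  simp only [Complex.norm_exp, Complex.mul_I_re, Complex.neg_im, neg_neg, Real.cosh_eq]
  ring

theorem norm_cos_le_cosh (z : ℂ) : ‖Complex.cos z‖ ≤ Real.cosh z.im := by
  rw [Complex.cos, norm_div, Complex.norm_ofNat, div_le_iff₀' two_pos,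
    ← norm_exp_mul_I_add_norm_exp_neg_mul_I]
  exact norm_add_le _ _

theorem norm_sin_le_cosh (z : ℂ) : ‖Complex.sin z‖ ≤ Real.cosh z.im := by
  rw [Complex.sin, norm_div, norm_mul, Complex.norm_I, mul_one, Complex.norm_ofNat,
    div_le_iff₀' two_pos, ← norm_exp_mul_I_add_norm_exp_neg_mul_I, add_comm]
  exact norm_sub_le _ _

theorem cosh_im_mul_le {C : ℝ} {ρ : ℂ} (hρ : |ρ.im| ≤ C) (t : ℝ) :
    Real.cosh (ρ * t).im ≤ Real.cosh (C * t) := by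
  rw [Real.cosh_le_cosh, Complex.im_mul_ofReal, abs_mul, abs_mul]
  exact mul_le_mul_of_nonneg_right (hρ.trans (le_abs_self C)) (abs_nonneg t)

theorem norm_sin_mul_div_le {C x : ℝ} {ρ : ℂ} (hρ : |ρ.im| ≤ C) {t : ℝ} (ht : |t| ≤ x) :
    ‖Complex.sin (ρ * t) / ρ‖ ≤ Real.cosh (C * x) * x := by
  have hC : 0 ≤ C := (abs_nonneg _).trans hρ
  have hx : 0 ≤ x := (abs_nonneg _).trans ht
  have h_mem_strip {z : ℂ} (hz : |z.im| ≤ C * x) :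
      z ∈ Complex.imLm ⁻¹' Icc (-(C * x)) (C * x) := abs_le.1 hz
  have h_deriv (z : ℂ) (hz : z ∈ Complex.imLm ⁻¹' Icc (-(C * x)) (C * x)) :
      ‖deriv Complex.sin z‖ ≤ Real.cosh (C * x) := by
    rw [Complex.deriv_sin]
    refine (norm_cos_le_cosh z).trans (Real.cosh_le_cosh.2 ?_)
    rw [abs_of_nonneg (mul_nonneg hC hx)]
    exact abs_le.2 hz
  have h_mean_value := ((convex_Icc (-(C * x)) (C * x)).linear_preimage
    Complex.imLm).norm_image_sub_le_of_norm_deriv_le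
    (fun z _ => Complex.differentiable_sin z) h_deriv (h_mem_strip (z := 0) (by
      rw [Complex.zero_im, abs_zero]; positivity))
    (h_mem_strip (z := ρ * t) (by rw [Complex.im_mul_ofReal, abs_mul]; gcongr))
  rw [Complex.sin_zero, sub_zero, sub_zero, norm_mul, Complex.norm_real, Real.norm_eq_abs]
    at h_mean_value
  rw [norm_div]
  refine div_le_of_le_mul₀ (norm_nonneg _) (by positivity) (h_mean_value.trans ?_)
  rw [mul_assoc, mul_comm x]
  gcongr

theorem integral_cosh_mul {c : ℝ} (hc : c ≠ 0) (x : ℝ) :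
    ∫ t in (-x)..x, Real.cosh (c * t) = 2 * Real.sinh (c * x) / c := by
  rw [intervalIntegral.integral_comp_mul_left (fun t => Real.cosh t) hc,
    intervalIntegral.integral_eq_sub_of_hasDerivAt (fun t _ => Real.hasDerivAt_sinh t)
      (Real.continuous_cosh.intervalIntegrable _ _), mul_neg, Real.sinh_neg, smul_eq_mul]
  ring

section Cosh

variable {C x : ℝ} {h : ℝ → ℂ}

theorem integral_norm_le_of_norm_le_cosh (hC : C ≠ 0) (hx : 0 ≤ x) (hh : Continuous h)
    (h_bound : ∀ t, ‖h t‖ ≤ Real.cosh (C * t)) :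
    ∫ t in (-x)..x, ‖h t‖ ≤ 2 * Real.sinh (C * x) / C := by
  rw [← integral_cosh_mul hC]
  exact intervalIntegral.integral_mono (neg_le_self hx) (hh.norm.intervalIntegrable _ _)
    ((by fun_prop : Continuous fun t => Real.cosh (C * t)).intervalIntegrable _ _) h_bound

theorem integral_norm_sq_le_of_norm_le_cosh (hC : C ≠ 0) (hx : 0 ≤ x) (hh : Continuous h)
    (h_bound : ∀ t, ‖h t‖ ≤ Real.cosh (C * t)) :
    ∫ t in (-x)..x, ‖h t‖ ^ 2 ≤ Real.sinh (2 * C * x) / C := by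
  rw [← mul_div_mul_left _ C two_ne_zero, ← integral_cosh_mul (mul_ne_zero two_ne_zero hC)]
  refine intervalIntegral.integral_mono (neg_le_self hx) ((hh.norm.pow 2).intervalIntegrable _ _)
    ((by fun_prop : Continuous fun t => Real.cosh (2 * C * t)).intervalIntegrable _ _) fun t => ?_
  calc ‖h t‖ ^ 2 ≤ Real.cosh (C * t) ^ 2 := pow_le_pow_left₀ (norm_nonneg _) (h_bound t) 2
    _ ≤ Real.cosh (C * t) ^ 2 + Real.sinh (C * t) ^ 2 := le_add_of_nonneg_right (sq_nonneg _)
    _ = Real.cosh (2 * C * t) := by rw [mul_assoc, Real.cosh_two_mul]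

end Cosh

section ErrorIntegral

variable {a b x C M : ℝ} {E h : ℝ → ℂ}

theorem norm_intervalIntegral_mul_le_sqrt_mul_sqrt (hab : a ≤ b)
    (hE : MemLp E 2 (volume.restrict (Ioo a b))) (hh : ContinuousOn h (Icc a b)) :
    ‖∫ t in a..b, E t * h t‖ ≤ √(∫ t in a..b, ‖E t‖ ^ 2) * √(∫ t in a..b, ‖h t‖ ^ 2) := by
  simp only [intervalIntegral_eq_setIntegral_Ioo hab]
  exact norm_integral_mul_le_sqrt_mul_sqrt hE (memLp_of_continuousOn_Icc 2 hh)

theorem norm_intervalIntegral_mul_le_of_ae_norm_le (hab : a ≤ b)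
    (hM : ∀ᵐ t ∂(volume.restrict (Ioo a b)), ‖E t‖ ≤ M) (hh : ContinuousOn h (Icc a b)) :
    ‖∫ t in a..b, E t * h t‖ ≤ M * ∫ t in a..b, ‖h t‖ := by
  have hh_int : Integrable h (volume.restrict (Ioo a b)) :=
    memLp_one_iff_integrable.1 (memLp_of_continuousOn_Icc 1 hh)
  simp only [intervalIntegral_eq_setIntegral_Ioo hab]
  rw [← integral_const_mul]
  refine norm_integral_le_of_norm_le (hh_int.norm.const_mul M) ?_
  filter_upwards [hM] with t ht
  rw [norm_mul]
  exact mul_le_mul_of_nonneg_right ht (norm_nonneg _)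

theorem nonneg_of_ae_norm_le (hab : a < b)
    (hM : ∀ᵐ t ∂(volume.restrict (Ioo a b)), ‖E t‖ ≤ M) : 0 ≤ M := by
  have : (ae (volume.restrict (Ioo a b))).NeBot :=
    ae_neBot.2 (by rwa [Ne, Measure.restrict_eq_zero, Real.volume_Ioo, ENNReal.ofReal_eq_zero,
      not_le, sub_pos])
  obtain ⟨t, ht⟩ := hM.exists
  exact (norm_nonneg _).trans ht

theorem norm_integral_mul_le_sqrt_sinh (hx : 0 ≤ x) (hC : C ≠ 0)
    (hE : MemLp E 2 (volume.restrict (Ioo (-x) x))) (hh : Continuous h)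
    (h_bound : ∀ t, ‖h t‖ ≤ Real.cosh (C * t)) :
    ‖∫ t in (-x)..x, E t * h t‖ ≤
      √(∫ t in (-x)..x, ‖E t‖ ^ 2) * √(Real.sinh (2 * C * x) / C) :=
  (norm_intervalIntegral_mul_le_sqrt_mul_sqrt (neg_le_self hx) hE hh.continuousOn).trans <|
    mul_le_mul_of_nonneg_left
      (Real.sqrt_le_sqrt (integral_norm_sq_le_of_norm_le_cosh hC hx hh h_bound))
      (Real.sqrt_nonneg _)

theorem norm_integral_mul_le_sinh_of_ae_norm_le (hx : 0 < x) (hC : C ≠ 0)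
    (hM : ∀ᵐ t ∂(volume.restrict (Ioo (-x) x)), ‖E t‖ ≤ M) (hh : Continuous h)
    (h_bound : ∀ t, ‖h t‖ ≤ Real.cosh (C * t)) :
    ‖∫ t in (-x)..x, E t * h t‖ ≤ M * (2 * Real.sinh (C * x) / C) :=
  (norm_intervalIntegral_mul_le_of_ae_norm_le (neg_le_self hx.le) hM hh.continuousOn).trans <|
    mul_le_mul_of_nonneg_left (integral_norm_le_of_norm_le_cosh hC hx.le hh h_bound)
      (nonneg_of_ae_norm_le (neg_lt_self hx) hM)

end ErrorIntegral

/-! ### The limit `ρ → 0` -/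

theorem legendreP_one : legendreP 1 = Polynomial.X := by
  simp only [legendreP, pow_one, Function.iterate_one, Nat.factorial_one, Nat.cast_one, mul_one,
    Polynomial.derivative_sub, Polynomial.derivative_X_pow, Polynomial.derivative_one, sub_zero]
  rw [← mul_assoc, ← Polynomial.C_mul]
  norm_num

theorem alphaCoeff_one_mul {x : ℝ} (hx : x ≠ 0) (K : ℝ → ℝ → ℂ) :
    alphaCoeff K 1 x * (x / 3) = ∫ t in (-x)..x, K x t * t := by
  have hxc : (x : ℂ) ≠ 0 := Complex.ofReal_ne_zero.2 hx
  simp only [alphaCoeff, legendreCoeff, legendreP_one, Polynomial.eval_X, Complex.ofReal_div,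
    ← mul_div_assoc, intervalIntegral.integral_div]
  field_simp
  ring

theorem tendsto_sin_mul_div (t : ℂ) :
    Tendsto (fun ρ : ℂ => Complex.sin (ρ * t) / ρ) (𝓝[≠] 0) (𝓝 t) := by
  have h_deriv : HasDerivAt (fun ρ : ℂ => Complex.sin (ρ * t)) t 0 := by
    simpa using ((hasDerivAt_id (0 : ℂ)).mul_const t).csin
  simpa [div_eq_inv_mul] using hasDerivAt_iff_tendsto_slope_zero.1 h_deriv

theorem tendsto_integral_mul_sin_div {x : ℝ} (hx : 0 ≤ x) {g : ℝ → ℂ}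
    (hg : IntegrableOn g (Ioo (-x) x)) :
    Tendsto (fun ρ : ℂ => (∫ t in (-x)..x, g t * Complex.sin (ρ * t)) / ρ) (𝓝[≠] 0)
      (𝓝 (∫ t in (-x)..x, g t * t)) := by
  simp only [intervalIntegral_eq_setIntegral_Ioo (neg_le_self hx), ← integral_div]
  simp only [mul_div_assoc]
  refine tendsto_integral_filter_of_dominated_convergence
    (fun t => ‖g t‖ * (Real.cosh (1 * x) * x)) (.of_forall fun ρ => ?_) ?_
    (hg.norm.mul_const _) (.of_forall fun t => (tendsto_sin_mul_div t).const_mul _)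
  · exact hg.1.mul (by fun_prop : Continuous fun t : ℝ =>
      Complex.sin (ρ * t) / ρ).aestronglyMeasurable
  · filter_upwards [nhdsWithin_le_nhds (Metric.closedBall_mem_nhds (0 : ℂ) one_pos)] with ρ hρ
    refine ae_restrict_Ioo_of_forall_Icc fun t ht => ?_
    rw [norm_mul]
    gcongr
    exact norm_sin_mul_div_le ((Complex.abs_im_le_norm ρ).trans (mem_closedBall_zero_iff.1 hρ))
      (abs_le.2 ht)

/-! ### The error of the partial sums -/

theorem tendstoUniformlyOn_of_norm_sub_le {α E : Type*} [SeminormedAddCommGroup E]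
    {F : ℕ → α → E} {G : α → E} {s : Set α} {e : ℕ → ℝ} (he : Tendsto e atTop (𝓝 0)) {D : ℝ}
    (h : ∀ N, 1 ≤ N → ∀ a ∈ s, ‖G a - F N a‖ ≤ e N * D) : TendstoUniformlyOn F G atTop s := by
  refine Metric.tendstoUniformlyOn_iff.2 fun δ hδ => ?_
  have h_lim : Tendsto (fun N => e N * D) atTop (𝓝 0) := by simpa using he.mul_const D
  filter_upwards [h_lim.eventually_lt_const hδ, eventually_ge_atTop 1] with N hNδ hN a ha
  rw [dist_eq_norm]
  exact (h N hN a ha).trans_lt hNδ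

section Error

variable {ℓ : ℝ} {σ f : ℝ → ℂ} {K : ℝ → ℝ → ℂ} {c s : ℝ → ℂ} {ρ : ℂ} {x C : ℝ}

theorem integral_mul_sub_integral_kernelPartial_mul (hx : 0 ≤ x)
    (hK : MemLp (K x) 2 (volume.restrict (Ioo (-x) x))) (N : ℕ) {h : ℝ → ℂ} (hh : Continuous h) :
    (∫ t in (-x)..x, K x t * h t) - ∫ t in (-x)..x, kernelPartial K N x t * h t =
      ∫ t in (-x)..x, (K x t - kernelPartial K N x t) * h t := by
  simp only [sub_mul]
  refine (intervalIntegral.integral_sub (intervalIntegrable_mul_of_memLp_two (neg_le_self hx) hK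
    (memLp_of_continuousOn_Icc 2 hh.continuousOn))
    (((continuous_kernelPartial K N x).mul hh).intervalIntegrable _ _)).symm

theorem IsTransmutationKernel.cosine_sub_cosPartial (hℓ : 0 < ℓ)
    (hf : IsNonvanishingSolution ℓ σ f) (hK : IsTransmutationKernel ℓ σ f K)
    (hc : IsCauchySolution ℓ σ f (ρ ^ 2) 1 0 c) (hs : IsCauchySolution ℓ σ f (ρ ^ 2) 0 1 s)
    (hx : x ∈ Ioc 0 ℓ) (N : ℕ) : c x - cosPartial K N ρ x =
      ∫ t in (-x)..x, (K x t - kernelPartial K N x t) * Complex.cos (ρ * t) := by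
  rw [hK.cosine_eq hℓ hf hc hs hx, cosPartial_eq K hx.1.ne', add_sub_add_left_eq_sub,
    integral_mul_sub_integral_kernelPartial_mul hx.1.le (hK.memLp_slice x hx) N (by fun_prop)]

theorem IsTransmutationKernel.mul_sine_sub_mul_sinPartial (hℓ : 0 < ℓ)
    (hf : IsNonvanishingSolution ℓ σ f) (hK : IsTransmutationKernel ℓ σ f K)
    (hc : IsCauchySolution ℓ σ f (ρ ^ 2) 1 0 c) (hs : IsCauchySolution ℓ σ f (ρ ^ 2) 0 1 s)
    (hx : x ∈ Ioc 0 ℓ) {N : ℕ} (hN : 1 ≤ N) : ρ * s x - ρ * sinPartial K N ρ x =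
      ∫ t in (-x)..x, (K x t - kernelPartial K N x t) * Complex.sin (ρ * t) := by
  rw [hK.mul_sine_eq hℓ hf hc hs hx, mul_sinPartial_eq K hx.1.ne' hN, add_sub_add_left_eq_sub,
    integral_mul_sub_integral_kernelPartial_mul hx.1.le (hK.memLp_slice x hx) N (by fun_prop)]

theorem IsTransmutationKernel.norm_cosine_sub_le (hℓ : 0 < ℓ)
    (hf : IsNonvanishingSolution ℓ σ f) (hK : IsTransmutationKernel ℓ σ f K)
    (hc : IsCauchySolution ℓ σ f (ρ ^ 2) 1 0 c) (hs : IsCauchySolution ℓ σ f (ρ ^ 2) 0 1 s)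
    (hx : x ∈ Ioc 0 ℓ) (hC : C ≠ 0) (hρ : |ρ.im| ≤ C) (N : ℕ) :
    ‖c x - cosPartial K N ρ x‖ ≤ kernelError K N x * √(Real.sinh (2 * C * x) / C) ∧
    ∀ M : ℝ, (∀ᵐ t ∂(volume.restrict (Ioo (-x) x)), ‖K x t - kernelPartial K N x t‖ ≤ M) →
      ‖c x - cosPartial K N ρ x‖ ≤ M * (2 * Real.sinh (C * x) / C) := by
  have h_cont : Continuous fun t : ℝ => Complex.cos (ρ * t) := by fun_prop
  have h_cosh (t : ℝ) : ‖Complex.cos (ρ * t)‖ ≤ Real.cosh (C * t) :=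
    (norm_cos_le_cosh _).trans (cosh_im_mul_le hρ t)
  rw [hK.cosine_sub_cosPartial hℓ hf hc hs hx N]
  exact ⟨norm_integral_mul_le_sqrt_sinh hx.1.le hC
    (memLp_sub_kernelPartial (hK.memLp_slice x hx) N) h_cont h_cosh, fun M hM =>
    norm_integral_mul_le_sinh_of_ae_norm_le hx.1 hC hM h_cont h_cosh⟩

theorem IsTransmutationKernel.norm_mul_sine_sub_le (hℓ : 0 < ℓ)
    (hf : IsNonvanishingSolution ℓ σ f) (hK : IsTransmutationKernel ℓ σ f K)
    (hc : IsCauchySolution ℓ σ f (ρ ^ 2) 1 0 c) (hs : IsCauchySolution ℓ σ f (ρ ^ 2) 0 1 s)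
    (hx : x ∈ Ioc 0 ℓ) (hC : C ≠ 0) (hρ : |ρ.im| ≤ C) {N : ℕ} (hN : 1 ≤ N) :
    ‖ρ * s x - ρ * sinPartial K N ρ x‖ ≤
      kernelError K N x * √(Real.sinh (2 * C * x) / C) ∧
    ∀ M : ℝ, (∀ᵐ t ∂(volume.restrict (Ioo (-x) x)), ‖K x t - kernelPartial K N x t‖ ≤ M) →
      ‖ρ * s x - ρ * sinPartial K N ρ x‖ ≤ M * (2 * Real.sinh (C * x) / C) := by
  have h_cont : Continuous fun t : ℝ => Complex.sin (ρ * t) := by fun_prop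
  have h_cosh (t : ℝ) : ‖Complex.sin (ρ * t)‖ ≤ Real.cosh (C * t) :=
    (norm_sin_le_cosh _).trans (cosh_im_mul_le hρ t)
  rw [hK.mul_sine_sub_mul_sinPartial hℓ hf hc hs hx hN]
  exact ⟨norm_integral_mul_le_sqrt_sinh hx.1.le hC
    (memLp_sub_kernelPartial (hK.memLp_slice x hx) N) h_cont h_cosh, fun M hM =>
    norm_integral_mul_le_sinh_of_ae_norm_le hx.1 hC hM h_cont h_cosh⟩

theorem IsTransmutationKernel.norm_sine_sub_le (hℓ : 0 < ℓ) (hf : IsNonvanishingSolution ℓ σ f)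
    (hK : IsTransmutationKernel ℓ σ f K) (hc : IsCauchySolution ℓ σ f (ρ ^ 2) 1 0 c)
    (hs : IsCauchySolution ℓ σ f (ρ ^ 2) 0 1 s) (hx : x ∈ Ioc 0 ℓ) (hρ : |ρ.im| ≤ C)
    (hρ0 : ρ ≠ 0) {N : ℕ} (hN : 1 ≤ N) : ‖s x - sinPartial K N ρ x‖ ≤
      kernelError K N x * √(2 * x * (Real.cosh (C * x) * x) ^ 2) := by
  have h_cont : Continuous fun t : ℝ => Complex.sin (ρ * t) / ρ := by fun_prop
  have hx_le : -x ≤ x := neg_le_self hx.1.le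
  have h_error : s x - sinPartial K N ρ x =
      ∫ t in (-x)..x, (K x t - kernelPartial K N x t) * (Complex.sin (ρ * t) / ρ) := by
    simp only [← mul_div_assoc, intervalIntegral.integral_div]
    rw [← hK.mul_sine_sub_mul_sinPartial hℓ hf hc hs hx hN, ← mul_sub, mul_div_cancel_left₀ _ hρ0]
  have h_sq : ∫ t in (-x)..x, ‖Complex.sin (ρ * t) / ρ‖ ^ 2 ≤
      2 * x * (Real.cosh (C * x) * x) ^ 2 :=
    calc ∫ t in (-x)..x, ‖Complex.sin (ρ * t) / ρ‖ ^ 2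
      _ ≤ ∫ _ in (-x)..x, (Real.cosh (C * x) * x) ^ 2 :=
        intervalIntegral.integral_mono_on hx_le ((h_cont.norm.pow 2).intervalIntegrable _ _)
          intervalIntegrable_const fun t ht =>
            pow_le_pow_left₀ (norm_nonneg _) (norm_sin_mul_div_le hρ (abs_le.2 ht)) 2
      _ = 2 * x * (Real.cosh (C * x) * x) ^ 2 := by
        rw [intervalIntegral.integral_const, smul_eq_mul]
        ring
  rw [h_error]
  exact (norm_intervalIntegral_mul_le_sqrt_mul_sqrt hx_le
    (memLp_sub_kernelPartial (hK.memLp_slice x hx) N) h_cont.continuousOn).trans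
    (mul_le_mul_of_nonneg_left (Real.sqrt_le_sqrt h_sq) (Real.sqrt_nonneg _))

theorem IsTransmutationKernel.sine_zero_eq (hℓ : 0 < ℓ) (hf : IsNonvanishingSolution ℓ σ f)
    (hK : IsTransmutationKernel ℓ σ f K) {Cf Sf : ℂ → ℝ → ℂ}
    (hc : ∀ ρ : ℂ, IsCauchySolution ℓ σ f (ρ ^ 2) 1 0 (Cf ρ))
    (hs : ∀ ρ : ℂ, IsCauchySolution ℓ σ f (ρ ^ 2) 0 1 (Sf ρ)) (hx : x ∈ Ioc 0 ℓ) :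
    Sf 0 x = x + alphaCoeff K 1 x * (x / 3) := by
  have h_cont : Continuous fun ρ => Sf ρ x :=
    continuous_isCauchySolution hℓ hf (continuous_pow 2) hs (Ioc_subset_Icc_self hx)
  have h_lim := (tendsto_sin_mul_div (x : ℂ)).add (tendsto_integral_mul_sin_div hx.1.le
    ((hK.memLp_slice x hx).integrable one_le_two))
  rw [alphaCoeff_one_mul hx.1.ne']
  refine tendsto_nhds_unique (h_cont.continuousWithinAt (s := {0}ᶜ)) (h_lim.congr' ?_)
  filter_upwards [self_mem_nhdsWithin] with ρ hρ
  rw [← add_div, ← hK.mul_sine_eq hℓ hf (hc ρ) (hs ρ) hx, mul_div_cancel_left₀ _ hρ]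

end Error

end NSBF

theorem mainTheorem8 (ℓ : ℝ) (hℓ : 0 < ℓ) (σ f : ℝ → ℂ)
    (hσ : MeasureTheory.MemLp σ 2 (MeasureTheory.volume.restrict (Set.Ioo 0 ℓ)))
    (hf : NSBF.IsNonvanishingSolution ℓ σ f) :
    -- the solutions `C_f`, `S_f` and the kernel `K_f` exist
    (∀ ρ : ℂ, (∃ y, NSBF.IsCauchySolution ℓ σ f (ρ ^ 2) 1 0 y) ∧
      (∃ y, NSBF.IsCauchySolution ℓ σ f (ρ ^ 2) 0 1 y)) ∧
    (∃ K, NSBF.IsTransmutationKernel ℓ σ f K) ∧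
    ∀ (Cf Sf : ℂ → ℝ → ℂ) (K : ℝ → ℝ → ℂ),
      (∀ ρ : ℂ, NSBF.IsCauchySolution ℓ σ f (ρ ^ 2) 1 0 (Cf ρ)) →
      (∀ ρ : ℂ, NSBF.IsCauchySolution ℓ σ f (ρ ^ 2) 0 1 (Sf ρ)) →
      NSBF.IsTransmutationKernel ℓ σ f K →
      ∀ x ∈ Set.Ioc 0 ℓ,
        -- the Fourier-Legendre series of `K_f(x,·)` converges in `L²(-x,x)`
        Filter.Tendsto (fun N => NSBF.kernelError K N x) Filter.atTop (nhds 0) ∧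
        -- series representation of `C_f`
        (∀ ρ : ℂ,
          Summable (fun m : ℕ => (-1) ^ m * NSBF.alphaCoeff K (2 * m) x *
            NSBF.sphericalBesselJ (2 * m) (ρ * x)) ∧
          Cf ρ x = Complex.cos (ρ * x) + ∑' m : ℕ, (-1) ^ m * NSBF.alphaCoeff K (2 * m) x *
            NSBF.sphericalBesselJ (2 * m) (ρ * x)) ∧
        -- series representation of `S_f`, and its limiting form at `ρ = 0`
        (∀ ρ : ℂ, ρ ≠ 0 →
          Summable (fun m : ℕ => (-1) ^ m * NSBF.alphaCoeff K (2 * m + 1) x *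
            NSBF.sphericalBesselJ (2 * m + 1) (ρ * x)) ∧
          Sf ρ x = Complex.sin (ρ * x) / ρ +
            1 / ρ * ∑' m : ℕ, (-1) ^ m * NSBF.alphaCoeff K (2 * m + 1) x *
              NSBF.sphericalBesselJ (2 * m + 1) (ρ * x)) ∧
        Sf 0 x = x + NSBF.alphaCoeff K 1 x * (x / 3) ∧
        ∀ C : ℝ, 0 < C →
          -- error bounds for the partial sums in the strip `|Im ρ| ≤ C`
          (∀ N : ℕ, 1 ≤ N → ∀ ρ : ℂ, |ρ.im| ≤ C →
            ‖Cf ρ x - NSBF.cosPartial K N ρ x‖ ≤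
              NSBF.kernelError K N x * Real.sqrt (Real.sinh (2 * C * x) / C) ∧
            ‖ρ * Sf ρ x - ρ * NSBF.sinPartial K N ρ x‖ ≤
              NSBF.kernelError K N x * Real.sqrt (Real.sinh (2 * C * x) / C) ∧
            ∀ M : ℝ, (∀ᵐ t ∂(MeasureTheory.volume.restrict (Set.Ioo (-x) x)),
                ‖K x t - NSBF.kernelPartial K N x t‖ ≤ M) →
              ‖Cf ρ x - NSBF.cosPartial K N ρ x‖ ≤ M * (2 * Real.sinh (C * x) / C) ∧
              ‖ρ * Sf ρ x - ρ * NSBF.sinPartial K N ρ x‖ ≤ M * (2 * Real.sinh (C * x) / C)) ∧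
          -- uniform convergence in the strip `|Im ρ| ≤ C`
          TendstoUniformlyOn (fun (N : ℕ) (ρ : ℂ) => NSBF.cosPartial K N ρ x)
            (fun ρ => Cf ρ x) Filter.atTop {ρ : ℂ | |ρ.im| ≤ C} ∧
          TendstoUniformlyOn (fun (N : ℕ) (ρ : ℂ) => NSBF.sinPartial K N ρ x)
            (fun ρ => Sf ρ x) Filter.atTop {ρ : ℂ | |ρ.im| ≤ C ∧ ρ ≠ 0} := by
  obtain ⟨K₀, hK₀⟩ := NSBF.exists_isTransmutationKernel hℓ.le hf
  refine ⟨fun ρ => ⟨hK₀.exists_isCauchySolution_cosine hℓ hf ρ,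
    hK₀.exists_isCauchySolution_sine hℓ hf ρ⟩, ⟨K₀, hK₀⟩, ?_⟩
  intro Cf Sf K hc hs hK x hx
  have h_slice := hK.memLp_slice x hx
  have h_error := NSBF.tendsto_kernelError hx.1 h_slice
  refine ⟨h_error, fun ρ => ?_, fun ρ hρ => ?_, hK.sine_zero_eq hℓ hf hc hs hx, fun C hC =>
    ⟨fun N hN ρ hρ => ?_, ?_, ?_⟩⟩
  · have h_series := NSBF.hasSum_cos_series hx.1 h_slice ρ
    exact ⟨h_series.summable, by rw [h_series.tsum_eq, hK.cosine_eq hℓ hf (hc ρ) (hs ρ) hx]⟩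
  · have h_series := NSBF.hasSum_sin_series hx.1 h_slice ρ
    refine ⟨h_series.summable, mul_left_cancel₀ hρ ?_⟩
    rw [h_series.tsum_eq, hK.mul_sine_eq hℓ hf (hc ρ) (hs ρ) hx]
    field_simp
  · have h_cos := hK.norm_cosine_sub_le hℓ hf (hc ρ) (hs ρ) hx hC.ne' hρ N
    have h_sin := hK.norm_mul_sine_sub_le hℓ hf (hc ρ) (hs ρ) hx hC.ne' hρ hN
    exact ⟨h_cos.1, h_sin.1, fun M hM => ⟨h_cos.2 M hM, h_sin.2 M hM⟩⟩
  · exact NSBF.tendstoUniformlyOn_of_norm_sub_le h_error fun N _ ρ hρ =>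
      (hK.norm_cosine_sub_le hℓ hf (hc ρ) (hs ρ) hx hC.ne' hρ N).1
  · exact NSBF.tendstoUniformlyOn_of_norm_sub_le h_error fun N hN ρ hρ =>
      hK.norm_sine_sub_le hℓ hf (hc ρ) (hs ρ) hx hρ.1 hρ.2 hN
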